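/- Conventions. A *topologically complemented lattice* (TC-lattice) is a lattice $L$ with least element $\mathbf 0$, greatest element $\mathbf 1$ and a binary operation $a-b$ giving the least $c$ with $a\le b\vee c$ (so $L$ is a co-Heyting algebra; the one-element lattice is allowed). Write $b\ll a$ if $b<a$ and $b\vee c<a$ for all $c<a$. The *lattice dimension* $\dim a\in\{-1,\infty\}\cup\mathbb N$ of $a\in L$ is the supremum of the $n$ for which there is a chain $p_0\subsetneq\dots\subsetneq p_n$ of prime filters of $L$ all containing $a$ (it is $-1$ if there are none). An element $a$ is *$k$-pure* if $\dim(a-b)=k$ for every $b$ with $a-b\ne\mathbf 0$; it *has pure dimension $k$* if moreover $a\neq\mathbf 0$. Here $\mathbb N$ contains $0$. Fix $d\in\mathbb N$. Let $\mathcal L_{SC_d}=\{\mathbf 0,\mathbf 1,\vee,\wedge,-\}\cup\{C^i\}_{0\le i\le d}$ and $\mathcal L_{SC}=\{\mathbf 0,\mathbf 1,\vee,\wedge,-\}\cup\{C^i\}_{i\in\mathbb N}$, with $C^i$ unary function symbols. The *sc-dimension* $\operatorname{sc-dim} a$ is the least $l\in\{-1,0,\dots,d\}$ (for $\mathcal L_{SC}$: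 the least $l\in\{-1\}\cup\mathbb N$) with $a=\bigvee_{0\le i\le l}C^i(a)$, and $\infty$ if there is none; the sc-dimension of $L$ is that of $\mathbf 1$. A *$d$-subscaled lattice* is an $\mathcal L_{SC_d}$-structure that is a TC-lattice and satisfies, for all $a,b$ and all $i,j,k\le d$: 1. $\bigvee_{0\le i\le d}C^i(a)=a$; 2. for every $I\subseteq\{0,\dots,d\}$, $C^k\bigl(\bigvee_{i\in I}C^i(a)\bigr)$ is $C^k(a)$ if $k\in I$ and $\mathbf 0$ if $k\notin I$; 3. if $k\ge\max(\operatorname{sc-dim}a,\operatorname{sc-dim}b)$ then $C^k(a\vee b)=C^k(a)\vee C^k(b)$; 4. if $i\ne j$ then $\operatorname{sc-dim}\bigl(C^i(a)\wedge C^j(a)\bigr)<\min(i,j)$; 5. if $k\ge\operatorname{sc-dim}b$ then $C^k(a)-b=C^k(a)-C^k(b)$; 6. if $b\ll a$ then $\operatorname{sc-dim}b<\operatorname{sc-dim}a$. It is *$d$-scaled* if moreover $\operatorname{sc-dim}a=\dim a$ for all $a$ (*scaling*). An $\mathcal L_{SC}$-structure is a *subscaled* (resp. *scaled*) lattice if its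 $\mathcal L_{SC_d}$-reduct is $d$-subscaled (resp. $d$-scaled) for all $d$ large enough. A *super $d$-scaled* (resp. *super scaled*) lattice is a $d$-scaled (resp. scaled) lattice with the following two properties. * *Catenarity*: for all integers $0\le r\le q\le p$ and all $c\le a$ such that $a$ has pure dimension $p$ and $c$ has pure dimension $r$, there is a $q$-pure $b$ with $c\le b\le a$. * *Splitting*: for all $b_1,b_2,a$ with $b_1\vee b_2\ll a$ there are non-zero $a_1\ge b_1$ and $a_2\ge b_2$ with $a_1=a-a_2$, $a_2=a-a_1$ and $a_1\wedge a_2=b_1\wedge b_2$. A theory $T'$ is the *model-completion* of $T$ if every model of $T'$ is a model of $T$, every model of $T$ embeds in a model of $T'$, and for every model $M$ of $T$ the theory $T'\cup\operatorname{Diag}(M)$ is complete, where $\operatorname{Diag}(M)$ is the quantifier-free diagram of $M$. The theory of a class of structures is the set of sentences true in all its members; the class is elementary if it consists of all the models of its theory. **Theorem.** Let $d\in\mathbb N$. 1. The classes of $d$-subscaled lattices and of super $d$-scaled lattices are elementary, and the theory of super $d$-scaled lattices is the model-completion of the theory of $d$-subscaled lattices. 2. The same holds, in the language $\mathcal L_{SC}$,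 for the subscaled and the super scaled lattices of sc-dimension at most $d$. 3. The same holds, in the language $\mathcal L_{SC}$, for the subscaled and the super scaled lattices of sc-dimension exactly $d$. -/

import Mathlib

open FirstOrder

universe u

namespace ScaledLattice

/-! ### The languages -/

/-- The function symbols `0`, `1`, `∨`, `∧`, `-` of topologically complemented lattices, together
with a unary function symbol `Cⁱ` for every `i ∈ I`. -/
inductive Func (I : Set ℕ) : ℕ → Type
  | zero : Func I 0
  | one : Func I 0
  | sup : Func I 2
  | inf : Func I 2
  | sdiff : Func I 2
  | comp (i : I) : Func I 1

/-- The language `{0, 1, ∨, ∧, -} ∪ {Cⁱ | i ∈ I}`, without relation symbols. -/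
def lang (I : Set ℕ) : FirstOrder.Language.{0, 0} := ⟨Func I, fun _ => Empty⟩

/-- The language with `Cⁱ` for `0 ≤ i ≤ d`. -/
abbrev langD (d : ℕ) : FirstOrder.Language.{0, 0} := lang (Set.Iic d)

/-- The language with `Cⁱ` for all natural numbers `i`. -/
abbrev langSC : FirstOrder.Language.{0, 0} := lang Set.univ

/-! ### Lattice notions

A topologically complemented lattice is a bounded lattice in which `a - b` is the least `c` with
`a ≤ b ∨ c`; this is Mathlib's `CoheytingAlgebra`, with `a \ b` for `a - b`. -/

section Lattice

variable {L : Type u} [CoheytingAlgebra L]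

/-- The relation `b ≪ a`. -/
def MuchBelow (b a : L) : Prop := b < a ∧ ∀ c : L, c < a → b ⊔ c < a

/-- The lattice dimension of `a`: the supremum of the lengths `n` of the chains
`p₀ ⊂ ⋯ ⊂ pₙ` of prime filters containing `a`; the value `-1` (written `⊥`) is taken when there is
no such filter, the value `∞` (written `⊤`) when the lengths are unbounded. -/
noncomputable def latDim (a : L) : WithBot ℕ∞ :=
  Order.krullDim {p : Order.PFilter L // p.IsPrime ∧ a ∈ p}

/-- `a` is `k`-pure. -/
def IsPure (k : ℕ) (a : L) : Prop := ∀ b : L, a \ b ≠ ⊥ → latDim (a \ b) = k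

/-- `a` has pure dimension `k`: it is `k`-pure and non-zero. -/
def HasPureDim (k : ℕ) (a : L) : Prop := IsPure k a ∧ a ≠ ⊥

variable (L) in
/-- The catenarity axiom. -/
def Catenarity : Prop :=
  ∀ r q p : ℕ, r ≤ q → q ≤ p → ∀ c a : L, c ≤ a → HasPureDim p a → HasPureDim r c →
    ∃ b : L, IsPure q b ∧ c ≤ b ∧ b ≤ a

variable (L) in
/-- The splitting axiom. -/
def Splitting : Prop :=
  ∀ b₁ b₂ a : L, MuchBelow (b₁ ⊔ b₂) a →
    ∃ a₁ a₂ : L, a₁ ≠ ⊥ ∧ a₂ ≠ ⊥ ∧ b₁ ≤ a₁ ∧ b₂ ≤ a₂ ∧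
      a₁ = a \ a₂ ∧ a₂ = a \ a₁ ∧ a₁ ⊓ a₂ = b₁ ⊓ b₂

/-! ### Subscaled, scaled and super scaled lattices -/

/-- The sc-dimension of `a`: the least `l ∈ {-1} ∪ I` such that `a` is the join of the `Cⁱ a` for
`i ≤ l`, and `∞` if there is none. As in `latDim`, `⊥` is `-1` and `⊤` is `∞`. -/
noncomputable def scDim {I : Set ℕ} (C : I → L → L) (a : L) : WithBot ℕ∞ :=
  sInf {l : WithBot ℕ∞ | (l = ⊥ ∨ ∃ n ∈ I, l = (n : WithBot ℕ∞)) ∧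
    IsLUB {x : L | ∃ i : I, ((i : ℕ) : WithBot ℕ∞) ≤ l ∧ x = C i a} a}

/-- The topologically complemented lattice `L` with the operations `C⁰, …, Cᵈ` is a `d`-subscaled
lattice. -/
structure IsDSubscaled (d : ℕ) (C : Set.Iic d → L → L) : Prop where
  sc1 : ∀ a : L, (Finset.univ.sup fun i => C i a) = a
  sc2 : ∀ (s : Finset (Set.Iic d)) (k : Set.Iic d) (a : L),
    C k (s.sup fun i => C i a) = if k ∈ s then C k a else ⊥
  sc3 : ∀ (k : Set.Iic d) (a b : L), max (scDim C a) (scDim C b) ≤ ((k : ℕ) : WithBot ℕ∞) →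
    C k (a ⊔ b) = C k a ⊔ C k b
  sc4 : ∀ (i j : Set.Iic d) (a : L), i ≠ j →
    scDim C (C i a ⊓ C j a) < ((min (i : ℕ) (j : ℕ) : ℕ) : WithBot ℕ∞)
  sc5 : ∀ (k : Set.Iic d) (a b : L), scDim C b ≤ ((k : ℕ) : WithBot ℕ∞) →
    C k a \ b = C k a \ C k b
  sc6 : ∀ a b : L, MuchBelow b a → scDim C b < scDim C a

/-- A `d`-scaled lattice is a `d`-subscaled lattice in which sc-dimension and lattice dimension
agree. -/
structure IsDScaled (d : ℕ) (C : Set.Iic d → L → L) : Prop extends IsDSubscaled d C where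
  scDim_eq : ∀ a : L, scDim C a = latDim a

/-- A super `d`-scaled lattice is a `d`-scaled lattice with catenarity and splitting. -/
structure IsSuperDScaled (d : ℕ) (C : Set.Iic d → L → L) : Prop extends IsDScaled d C where
  catenarity : Catenarity L
  splitting : Splitting L

/-- Forget the operations `Cⁱ` for `i > d`. -/
def restrict (C : ↥(Set.univ : Set ℕ) → L → L) (d : ℕ) : Set.Iic d → L → L :=
  fun i => C ⟨i, trivial⟩

/-- Subscaled lattices: those which are `d`-subscaled for every `d` large enough. -/
def IsSubscaled (C : ↥(Set.univ : Set ℕ) → L → L) : Prop :=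
  ∃ d₀ : ℕ, ∀ d ≥ d₀, IsDSubscaled d (restrict C d)

/-- Scaled lattices: those which are `d`-scaled for every `d` large enough. -/
def IsScaled (C : ↥(Set.univ : Set ℕ) → L → L) : Prop :=
  ∃ d₀ : ℕ, ∀ d ≥ d₀, IsDScaled d (restrict C d)

/-- A super scaled lattice is a (subscaled and) scaled lattice with catenarity and splitting. -/
structure IsSuperScaled (C : ↥(Set.univ : Set ℕ) → L → L) : Prop where
  subscaled : IsSubscaled C
  scaled : IsScaled C
  catenarity : Catenarity L
  splitting : Splitting L

end Lattice

/-! ### The classes of first-order structures -/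

/-- The symbols of the language are interpreted in `M` by the operations of the topologically
complemented lattice `M` and by the functions `Cⁱ`. -/
structure Interprets {I : Set ℕ} (M : Type u) [(lang I).Structure M] [CoheytingAlgebra M]
    (C : I → M → M) : Prop where
  zero : FirstOrder.Language.Structure.funMap (L := lang I) (M := M) Func.zero ![] = ⊥
  one : FirstOrder.Language.Structure.funMap (L := lang I) (M := M) Func.one ![] = ⊤
  sup : ∀ a b : M, FirstOrder.Language.Structure.funMap (L := lang I) Func.sup ![a, b] = a ⊔ b
  inf : ∀ a b : M, FirstOrder.Language.Structure.funMap (L := lang I) Func.inf ![a, b] = a ⊓ b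
  sdiff : ∀ a b : M, FirstOrder.Language.Structure.funMap (L := lang I) Func.sdiff ![a, b] = a \ b
  comp : ∀ (i : I) (a : M), FirstOrder.Language.Structure.funMap (L := lang I) (Func.comp i) ![a] = C i a

/-- A class of `L`-structures. -/
abbrev StructClass (L : FirstOrder.Language.{0, 0}) := ∀ (M : Type u) [L.Structure M], Prop

/-- The `d`-subscaled lattices. -/
def dSubscaled (d : ℕ) : StructClass.{u} (langD d) := fun M _ =>
  ∃ (_ : CoheytingAlgebra M) (C : Set.Iic d → M → M), Interprets M C ∧ IsDSubscaled d C

/-- The super `d`-scaled lattices. -/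
def superDScaled (d : ℕ) : StructClass.{u} (langD d) := fun M _ =>
  ∃ (_ : CoheytingAlgebra M) (C : Set.Iic d → M → M), Interprets M C ∧ IsSuperDScaled d C

/-- The subscaled lattices of sc-dimension at most `d`. -/
def subscaledLE (d : ℕ) : StructClass.{u} langSC := fun M _ =>
  ∃ (_ : CoheytingAlgebra M) (C : ↥(Set.univ : Set ℕ) → M → M),
    Interprets M C ∧ IsSubscaled C ∧ scDim C ⊤ ≤ (d : WithBot ℕ∞)

/-- The super scaled lattices of sc-dimension at most `d`. -/
def superScaledLE (d : ℕ) : StructClass.{u} langSC := fun M _ =>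
  ∃ (_ : CoheytingAlgebra M) (C : ↥(Set.univ : Set ℕ) → M → M),
    Interprets M C ∧ IsSuperScaled C ∧ scDim C ⊤ ≤ (d : WithBot ℕ∞)

/-- The subscaled lattices of sc-dimension exactly `d`. -/
def subscaledEQ (d : ℕ) : StructClass.{u} langSC := fun M _ =>
  ∃ (_ : CoheytingAlgebra M) (C : ↥(Set.univ : Set ℕ) → M → M),
    Interprets M C ∧ IsSubscaled C ∧ scDim C ⊤ = (d : WithBot ℕ∞)

/-- The super scaled lattices of sc-dimension exactly `d`. -/
def superScaledEQ (d : ℕ) : StructClass.{u} langSC := fun M _ =>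
  ∃ (_ : CoheytingAlgebra M) (C : ↥(Set.univ : Set ℕ) → M → M),
    Interprets M C ∧ IsSuperScaled C ∧ scDim C ⊤ = (d : WithBot ℕ∞)

/-! ### Theories and model-completions -/

/-- The theory of a class of structures: the sentences that hold in all its members. -/
def theoryOf {L : FirstOrder.Language.{0, 0}} (K : StructClass.{u} L) : L.Theory :=
  {φ | ∀ (M : Type u) [L.Structure M], K M → M ⊨ φ}

/-- `K` is an elementary class: it consists of all the models of its theory. -/
def IsElementaryClass {L : FirstOrder.Language.{0, 0}} (K : StructClass.{u} L) : Prop :=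
  ∀ (M : Type u) [L.Structure M], M ⊨ theoryOf K ↔ K M

/-- `T'` is the model-completion of `T`: every model of `T'` is a model of `T`, every model of `T`
embeds in a model of `T'`, and for every model `M` of `T` the union of `T'` and of the
quantifier-free diagram of `M` is complete, that is, any two models of `T'` extending `M` satisfy
the same formulas with parameters in `M`. (When `M` is itself a model of `T'` the last
condition says that `T'` is model-complete.) -/
structure IsModelCompletion {L : FirstOrder.Language.{0, 0}} (T' T : L.Theory) : Prop where
  models : ∀ (M : Type u) [L.Structure M], M ⊨ T' → M ⊨ T
  extends_to : ∀ (M : Type u) [L.Structure M], M ⊨ T →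
    ∃ (N : Type u) (_ : L.Structure N), N ⊨ T' ∧ Nonempty (M ↪[L] N)
  diagram_complete : ∀ (M N₁ N₂ : Type u) [L.Structure M] [L.Structure N₁] [L.Structure N₂],
    M ⊨ T → N₁ ⊨ T' → N₂ ⊨ T' → ∀ (f₁ : M ↪[L] N₁) (f₂ : M ↪[L] N₂)
      (n : ℕ) (φ : L.Formula (Fin n)) (v : Fin n → M),
      φ.Realize (f₁ ∘ v) ↔ φ.Realize (f₂ ∘ v)

end ScaledLattice

-- Subscaled lattices are lattices of lower sets. Give a poset a strictly increasing rank with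
-- values in {0, …, d}, and let Cᵏ(a) be the lower set generated by the maximal elements of a that
-- have rank k. The lower sets then satisfy all the axioms (`laws_down`), and the sc-dimension of a
-- non-empty a is the largest rank in it. Conversely, order the prime filters of a subscaled lattice
-- by reverse inclusion and let the rank of a filter be the least sc-dimension of its members;
-- sending an element to the set of prime filters containing it is an embedding
-- (`Laws.isEmb_specMap`). On the poset side, embeddings come from good maps: monotone surjections f
-- such that every point above f x is the image of a point above x of the same rank.
--
-- Elementarity. The axioms of subscaled lattices amount to the universal `Laws`. Scaling speaks of
-- prime filters, but under these laws it says that every non-zero a with Cᵏ⁺¹a = a lies above a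
-- non-zero c with Cᵏc = c (`Laws.scDim_eq_latDim_iff`). Moreover k-purity becomes Cᵏa = a under
-- scaling, so catenarity is first-order too.
--
-- Extensions. To solve all instances of the super scaled axioms over a ranked poset, adjoin new
-- points of every smaller rank below each point, then replace each point by copies that choose a
-- side for every splitting problem. Both projections are good. After ω rounds, the lower sets of
-- the inverse limit that come from a finite stage form a super scaled extension
-- (`Laws.exists_super`).
--
-- Completeness of the diagram. Finitely generated substructures are finite, and finitely many
-- elements are coded by a good map from the spectrum to a finite ranked poset (`exists_defMap`).
-- Extending a finite partial isomorphism means lifting such a map along a good map Q → P of finite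
-- ranked posets (`SuperSet.exists_lift`). It suffices to undo the merging of one point into
-- another: splitting divides the inverse image of the merged point, and scaling with catenarity
-- finds a pure part of the required dimension. The resulting back-and-forth system preserves all
-- formulas (`Similar.realize_iff`).

universe v w

namespace ScaledLattice

/-! ### Ranked posets and their lattices of lower sets -/

/-- A poset with a strictly increasing rank function with values in `{0, …, d}`. -/
structure RankedPoset (d : ℕ) where
  carrier : Type u
  [order : PartialOrder carrier]
  rk : carrier → ℕ
  rk_strict : StrictMono rk
  rk_le : ∀ x, rk x ≤ d

attribute [instance] RankedPoset.order

instance (d : ℕ) : CoeSort (RankedPoset.{u} d) (Type u) := ⟨RankedPoset.carrier⟩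

/-- The lattice of lower sets of a ranked poset. -/
abbrev RankedPoset.Down {d : ℕ} (X : RankedPoset.{u} d) : Type u := LowerSet X.carrier

section Down

variable {d : ℕ} {X : RankedPoset.{u} d}

theorem RankedPoset.rk_mono {x y : X} (h : x ≤ y) : X.rk x ≤ X.rk y := X.rk_strict.monotone h

theorem RankedPoset.eq_of_le_of_rk_le {x y : X} (h : x ≤ y) (hr : X.rk y ≤ X.rk x) : x = y := by
  rcases h.eq_or_lt with h | h
  · exact h
  · exact absurd (X.rk_strict h) (by omega)

/-- The elements of `a` of rank `k` that are maximal in `a`. -/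
def IsTopAt (k : ℕ) (a : X.Down) (x : X) : Prop := x ∈ a ∧ X.rk x = k ∧ ∀ z ∈ a, x ≤ z → z = x

/-- The lower set generated by a set. -/
def downOf (s : Set X) : X.Down := ⟨{x | ∃ y ∈ s, x ≤ y}, fun _ _ hab ⟨y, hy, h⟩ => ⟨y, hy, hab.trans h⟩⟩

/-- The component of rank `k` of a lower set. -/
def RankedPoset.comp (X : RankedPoset.{u} d) (k : ℕ) (a : X.Down) : X.Down :=
  downOf {x | IsTopAt k a x}

theorem mem_comp {k : ℕ} {a : X.Down} {x : X} :
    x ∈ X.comp k a ↔ ∃ y, IsTopAt k a y ∧ x ≤ y := Iff.rfl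

/-- The least lower set that covers a together with b is the one generated by the set-theoretic
difference. -/
theorem mem_sdiff_iff {a b : X.Down} {x : X} : x ∈ a \ b ↔ ∃ y, (y ∈ a ∧ y ∉ b) ∧ x ≤ y := by
  have : a \ b = downOf {y | y ∈ a ∧ y ∉ b} := by
    apply le_antisymm
    · rw [sdiff_le_iff]
      intro x hx
      by_cases h : x ∈ b
      · exact Or.inl h
      · exact Or.inr ⟨x, ⟨hx, h⟩, le_rfl⟩
    · rintro x ⟨y, ⟨hy, hyb⟩, hxy⟩
      apply (a \ b).lower hxy
      rcases (le_sup_sdiff : a ≤ b ⊔ a \ b) hy with h | h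
      · exact absurd h hyb
      · exact h
  rw [this]; rfl

theorem exists_top_above {a : X.Down} {x : X} (hx : x ∈ a) : ∃ k y, IsTopAt k a y ∧ x ≤ y := by
  -- Climbing inside a raises the rank, which is bounded by d, so the climb stops.
  suffices H : ∀ n, ∀ x ∈ a, d - X.rk x ≤ n → ∃ k y, IsTopAt k a y ∧ x ≤ y from H _ x hx le_rfl
  intro n
  induction n with
  | zero =>
    intro x hx h
    refine ⟨_, x, ⟨hx, rfl, fun z _ hxz => (RankedPoset.eq_of_le_of_rk_le hxz ?_).symm⟩, le_rfl⟩
    have := X.rk_le z; omega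
  | succ n ih =>
    intro x hx h
    by_cases hm : ∀ z ∈ a, x ≤ z → z = x
    · exact ⟨_, x, ⟨hx, rfl, hm⟩, le_rfl⟩
    · push Not at hm
      obtain ⟨z, hz, hxz, hne⟩ := hm
      have h1 := X.rk_strict (lt_of_le_of_ne hxz hne.symm)
      obtain ⟨k, y, hy, hzy⟩ := ih z hz (by have := X.rk_le z; omega)
      exact ⟨k, y, hy, hxz.trans hzy⟩

theorem comp_le (k : ℕ) (a : X.Down) : X.comp k a ≤ a := by
  rintro x ⟨y, hy, hxy⟩
  exact a.lower hxy hy.1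

theorem exists_mem_comp {a : X.Down} {x : X} (hx : x ∈ a) : ∃ k ≤ d, x ∈ X.comp k a := by
  obtain ⟨k, y, hy, hxy⟩ := exists_top_above hx
  exact ⟨k, hy.2.1 ▸ X.rk_le y, y, hy, hxy⟩

theorem comp_eq_bot_of_lt {k : ℕ} (hk : d < k) (a : X.Down) : X.comp k a = ⊥ := by
  rw [eq_bot_iff]
  rintro x ⟨y, hy, -⟩
  have := X.rk_le y; have := hy.2.1; omega

/-- Every element of `a` lies below an element of `a` of rank `k`. -/
def Pure (k : ℕ) (a : X.Down) : Prop := ∀ x ∈ a, ∃ y ∈ a, x ≤ y ∧ X.rk y = k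

theorem Pure.rk_le {k : ℕ} {a : X.Down} (h : Pure k a) {x : X} (hx : x ∈ a) : X.rk x ≤ k := by
  obtain ⟨y, -, hxy, hk⟩ := h x hx
  exact hk ▸ RankedPoset.rk_mono hxy

theorem isTopAt_of_rk_le {k : ℕ} {a : X.Down} (h : ∀ x ∈ a, X.rk x ≤ k) {x : X} (hx : x ∈ a)
    (hk : X.rk x = k) : IsTopAt k a x :=
  ⟨hx, hk, fun z hz hxz => (RankedPoset.eq_of_le_of_rk_le hxz (hk ▸ h z hz)).symm⟩

theorem comp_eq_self_iff {k : ℕ} {a : X.Down} : X.comp k a = a ↔ Pure k a := by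
  constructor
  · intro h x hx
    rw [← h] at hx
    obtain ⟨y, hy, hxy⟩ := hx
    exact ⟨y, hy.1, hxy, hy.2.1⟩
  · intro h
    apply le_antisymm (comp_le k a)
    intro x hx
    obtain ⟨y, hy, hxy, hk⟩ := h x hx
    exact ⟨y, isTopAt_of_rk_le (fun z hz => h.rk_le hz) hy hk, hxy⟩

theorem pure_comp (k : ℕ) (a : X.Down) : Pure k (X.comp k a) := by
  rintro x ⟨y, hy, hxy⟩
  exact ⟨y, ⟨y, hy, le_rfl⟩, hxy, hy.2.1⟩

theorem pure_downOf {k : ℕ} {s : Set X} (h : ∀ x ∈ s, X.rk x = k) : Pure k (downOf s) := by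
  rintro x ⟨y, hy, hxy⟩
  exact ⟨y, ⟨y, hy, le_rfl⟩, hxy, h y hy⟩

theorem Pure.sup {k : ℕ} {a b : X.Down} (ha : Pure k a) (hb : Pure k b) : Pure k (a ⊔ b) := by
  rintro x (hx | hx)
  · obtain ⟨y, hy, h⟩ := ha x hx
    exact ⟨y, Or.inl hy, h⟩
  · obtain ⟨y, hy, h⟩ := hb x hx
    exact ⟨y, Or.inr hy, h⟩

theorem pure_bot (k : ℕ) : Pure k (⊥ : X.Down) := fun _ hx => hx.elim

theorem Pure.sdiff {k : ℕ} {a : X.Down} (ha : Pure k a) (b : X.Down) : Pure k (a \ b) := by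
  intro x hx
  rw [mem_sdiff_iff] at hx
  obtain ⟨y, ⟨hy, hyb⟩, hxy⟩ := hx
  obtain ⟨z, hz, hyz, hk⟩ := ha y hy
  exact ⟨z, mem_sdiff_iff.2 ⟨z, ⟨hz, fun h => hyb (b.lower hyz h)⟩, le_rfl⟩, hxy.trans hyz, hk⟩

theorem ne_bot_iff {a : X.Down} : a ≠ ⊥ ↔ ∃ x, x ∈ a := by
  constructor
  · intro h
    by_contra! h'
    exact h (eq_bot_iff.2 fun x hx => (h' x hx).elim)
  · rintro ⟨x, hx⟩ rfl
    exact hx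

theorem mem_finset_sup {ι : Type*} {s : Finset ι} {f : ι → X.Down} {x : X} :
    x ∈ s.sup f ↔ ∃ i ∈ s, x ∈ f i := by
  classical
  induction s using Finset.induction_on with
  | empty => simp only [Finset.sup_empty, Finset.notMem_empty, false_and, exists_false, iff_false]; exact fun h => h
  | insert a s _ ih => rw [Finset.sup_insert, LowerSet.mem_sup_iff, ih]; simp

/-- The sc-dimension of `a` is less than `k`, in terms of ranks. -/
theorem sup_comp_eq_iff {k : ℕ} {a : X.Down} :
    ((Finset.range k).sup fun i => X.comp i a) = a ↔ ∀ x ∈ a, X.rk x < k := by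
  constructor
  · intro h x hx
    rw [← h, mem_finset_sup] at hx
    obtain ⟨i, hi, y, hy, hxy⟩ := hx
    have := RankedPoset.rk_mono hxy
    have := hy.2.1
    have := Finset.mem_range.1 hi
    omega
  · intro h
    apply le_antisymm (Finset.sup_le fun i _ => comp_le i a)
    intro x hx
    obtain ⟨j, y, hy, hxy⟩ := exists_top_above hx
    exact mem_finset_sup.2 ⟨j, Finset.mem_range.2 (hy.2.1 ▸ h y hy.1), y, hy, hxy⟩

end Down

/-! ### The laws of subscaled lattices -/

section Laws

variable {L : Type u} [CoheytingAlgebra L]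

/-- When b ≤ a, one has b ∨ (a - b) = a, so b ≪ a forbids a - b < a. Conversely a ≤ b ∨ c gives a -
b ≤ c. The right-hand side needs no quantifier, which makes the last law universal. -/
theorem muchBelow_iff {a b : L} : MuchBelow b a ↔ b ≤ a ∧ a \ b = a ∧ a ≠ ⊥ := by
  constructor
  · rintro ⟨h, h'⟩
    refine ⟨h.le, ?_, (bot_le.trans_lt h).ne'⟩
    by_contra hne
    have := h' _ (lt_of_le_of_ne sdiff_le hne)
    rw [sup_sdiff_self_right, sup_eq_right.2 h.le] at this
    exact lt_irrefl _ this
  · rintro ⟨h, h', h0⟩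
    have key : ∀ c, c < a → b ⊔ c < a := by
      intro c hc
      refine lt_of_le_of_ne (sup_le h hc.le) fun he => ?_
      have : a \ b ≤ c := sdiff_le_iff.2 he.ge
      rw [h'] at this
      exact absurd hc (not_lt_of_ge this)
    refine ⟨?_, key⟩
    have := key ⊥ (bot_lt_iff_ne_bot.2 h0)
    rwa [sup_bot_eq] at this

/-- The sc-dimension of `a` is less than `k`. -/
def ScLt (C : ℕ → L → L) (k : ℕ) (a : L) : Prop := ((Finset.range k).sup fun i => C i a) = a

/-- The laws of `d`-subscaled lattices, for operations `Cⁱ` indexed by all natural numbers. -/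
structure Laws (d : ℕ) (C : ℕ → L → L) : Prop where
  comp_eq_bot : ∀ k a, d < k → C k a = ⊥
  sup_comp : ∀ a, ScLt C (d + 1) a
  comp_comp : ∀ k a, C k (C k a) = C k a
  comp_sup_eq_bot : ∀ k l a, k ≤ l → C l ((Finset.range k).sup fun i => C i a) = ⊥
  comp_sup : ∀ k a b, ScLt C (k + 1) a → ScLt C (k + 1) b → C k (a ⊔ b) = C k a ⊔ C k b
  comp_inf : ∀ i j a, i ≠ j → ScLt C (min i j) (C i a ⊓ C j a)
  comp_sdiff : ∀ k a b, ScLt C (k + 1) b → C k a \ b = C k a \ C k b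
  muchBelow : ∀ k a b, b ≤ a → a \ b = a → a ≠ ⊥ → ScLt C (k + 1) a → ScLt C k b

theorem scLt_down {d : ℕ} {X : RankedPoset.{u} d} {k : ℕ} {a : X.Down} :
    ScLt X.comp k a ↔ ∀ x ∈ a, X.rk x < k := sup_comp_eq_iff

/-- The generators of the chosen components are maximal in a, hence they are exactly the maximal
elements of the union, with unchanged ranks. -/
theorem comp_finset_sup_comp {d : ℕ} {X : RankedPoset.{u} d} (s : Finset ℕ) (k : ℕ) (a : X.Down) :
    X.comp k (s.sup fun i => X.comp i a) = if k ∈ s then X.comp k a else ⊥ := by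
  split_ifs with h
  · ext x
    constructor
    · rintro ⟨y, ⟨hy, hk, hm⟩, hxy⟩
      obtain ⟨i, hi, z, hz, hyz⟩ := mem_finset_sup.1 hy
      have : z = y := hm z (mem_finset_sup.2 ⟨i, hi, z, hz, le_rfl⟩) hyz
      subst this
      have hik : i = k := hz.2.1.symm.trans hk
      subst hik
      exact ⟨z, hz, hxy⟩
    · rintro ⟨y, hy, hxy⟩
      refine ⟨y, ⟨mem_finset_sup.2 ⟨k, h, y, hy, le_rfl⟩, hy.2.1, fun z hz hyz => hy.2.2 z ?_ hyz⟩, hxy⟩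
      obtain ⟨i, hi, hz⟩ := mem_finset_sup.1 hz
      exact comp_le i a hz
  · rw [eq_bot_iff]
    rintro x ⟨y, ⟨hy, hk, hm⟩, hxy⟩
    obtain ⟨i, hi, z, hz, hyz⟩ := mem_finset_sup.1 hy
    have : z = y := hm z (mem_finset_sup.2 ⟨i, hi, z, hz, le_rfl⟩) hyz
    subst this
    have hik : i = k := hz.2.1.symm.trans hk
    exact absurd (hik ▸ hi) h

theorem comp_sup_of_scLt {d : ℕ} {X : RankedPoset.{u} d} {k : ℕ} {a b : X.Down}
    (ha : ∀ x ∈ a, X.rk x < k + 1) (hb : ∀ x ∈ b, X.rk x < k + 1) :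
    X.comp k (a ⊔ b) = X.comp k a ⊔ X.comp k b := by
  have hab : ∀ x ∈ a ⊔ b, X.rk x ≤ k := by
    rintro x (h | h)
    · exact Nat.lt_succ_iff.1 (ha x h)
    · exact Nat.lt_succ_iff.1 (hb x h)
  ext x
  constructor
  · rintro ⟨y, ⟨hy | hy, hk, hm⟩, hxy⟩
    · exact Or.inl ⟨y, ⟨hy, hk, fun z hz => hm z (Or.inl hz)⟩, hxy⟩
    · exact Or.inr ⟨y, ⟨hy, hk, fun z hz => hm z (Or.inr hz)⟩, hxy⟩
  · rintro (⟨y, hy, hxy⟩ | ⟨y, hy, hxy⟩)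
    · exact ⟨y, isTopAt_of_rk_le hab (Or.inl hy.1) hy.2.1, hxy⟩
    · exact ⟨y, isTopAt_of_rk_le hab (Or.inr hy.1) hy.2.1, hxy⟩

theorem rk_lt_of_muchBelow {d : ℕ} {X : RankedPoset.{u} d} {a b : X.Down} (h : a \ b = a)
    (hba : b ≤ a) {x : X} (hx : x ∈ b) : ∃ y ∈ a, y ∉ b ∧ x < y := by
  have hxa : x ∈ a \ b := by rw [h]; exact hba hx
  rw [mem_sdiff_iff] at hxa
  obtain ⟨y, ⟨hy, hyb⟩, hxy⟩ := hxa
  exact ⟨y, hy, hyb, lt_of_le_of_ne hxy fun he => hyb (he ▸ hx)⟩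

theorem laws_down {d : ℕ} (X : RankedPoset.{u} d) : Laws d X.comp where
  comp_eq_bot k a h := comp_eq_bot_of_lt h a
  sup_comp a := scLt_down.2 fun x _ => Nat.lt_succ_of_le (X.rk_le x)
  comp_comp k a := comp_eq_self_iff.2 (pure_comp k a)
  comp_sup_eq_bot k l a h := by
    rw [comp_finset_sup_comp, if_neg (by simpa using h)]
  comp_sup k a b ha hb := comp_sup_of_scLt (scLt_down.1 ha) (scLt_down.1 hb)
  comp_inf i j a hij := by
    rw [scLt_down]
    rintro x ⟨⟨y, hy, hxy⟩, ⟨z, hz, hxz⟩⟩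
    -- If x were one of the two maximal elements above it, the two would coincide and i = j. So x is
    -- strictly below both.
    have h1 : x ≠ y := by
      rintro rfl
      have := hy.2.2 z hz.1 hxz
      subst this
      exact hij (hy.2.1.symm.trans hz.2.1)
    have h2 : x ≠ z := by
      rintro rfl
      have := hz.2.2 y hy.1 hxy
      subst this
      exact hij (hy.2.1.symm.trans hz.2.1)
    have h3 := X.rk_strict (lt_of_le_of_ne hxy h1)
    have h4 := X.rk_strict (lt_of_le_of_ne hxz h2)
    rw [hy.2.1] at h3
    rw [hz.2.1] at h4
    exact lt_min h3 h4
  comp_sdiff k a b hb := by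
    rw [scLt_down] at hb
    ext x
    rw [SetLike.mem_coe, SetLike.mem_coe, mem_sdiff_iff, mem_sdiff_iff]
    constructor
    · rintro ⟨y, ⟨hy, hyb⟩, hxy⟩
      exact ⟨y, ⟨hy, fun h => hyb (comp_le k b h)⟩, hxy⟩
    · rintro ⟨y, ⟨⟨z, hz, hyz⟩, hyb⟩, hxy⟩
      refine ⟨z, ⟨⟨z, hz, le_rfl⟩, fun h => hyb ?_⟩, hxy.trans hyz⟩
      exact ⟨z, isTopAt_of_rk_le (fun w hw => Nat.lt_succ_iff.1 (hb w hw)) h hz.2.1, hyz⟩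
  muchBelow k a b hba h _ ha := by
    rw [scLt_down] at ha ⊢
    intro x hx
    obtain ⟨y, hy, -, hxy⟩ := rk_lt_of_muchBelow h hba hx
    have := X.rk_strict hxy
    have := ha y hy
    omega

/-- An injective map preserving the operations of subscaled lattices. -/
structure IsEmb {L : Type u} {L' : Type v} [CoheytingAlgebra L] [CoheytingAlgebra L']
    (C : ℕ → L → L) (C' : ℕ → L' → L') (f : L → L') : Prop where
  inj : Function.Injective f
  bot : f ⊥ = ⊥
  top : f ⊤ = ⊤
  sup : ∀ a b, f (a ⊔ b) = f a ⊔ f b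
  inf : ∀ a b, f (a ⊓ b) = f a ⊓ f b
  sdiff : ∀ a b, f (a \ b) = f a \ f b
  comp : ∀ k a, f (C k a) = C' k (f a)

namespace IsEmb

variable {L' : Type v} [CoheytingAlgebra L'] {C : ℕ → L → L} {C' : ℕ → L' → L'} {f : L → L'}

theorem le_iff (h : IsEmb C C' f) {a b : L} : f a ≤ f b ↔ a ≤ b := by
  rw [← sup_eq_right, ← h.sup, h.inj.eq_iff, sup_eq_right]

theorem finset_sup (h : IsEmb C C' f) {ι : Type*} (s : Finset ι) (g : ι → L) :
    f (s.sup g) = s.sup fun i => f (g i) := by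
  classical
  induction s using Finset.induction_on with
  | empty => simpa using h.bot
  | insert a s _ ih => rw [Finset.sup_insert, Finset.sup_insert, h.sup, ih]

theorem scLt_iff (h : IsEmb C C' f) {k : ℕ} {a : L} : ScLt C' k (f a) ↔ ScLt C k a := by
  unfold ScLt
  rw [← h.inj.eq_iff, h.finset_sup]
  simp only [h.comp]

theorem eq_bot_iff (h : IsEmb C C' f) {a : L} : f a = ⊥ ↔ a = ⊥ := by
  rw [← h.bot, h.inj.eq_iff]

/-- The laws are universal, so they descend along embeddings. -/
theorem laws (h : IsEmb C C' f) {d : ℕ} (hl : Laws d C') : Laws d C where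
  comp_eq_bot k a hk := h.inj (by rw [h.comp, h.bot, hl.comp_eq_bot k _ hk])
  sup_comp a := h.scLt_iff.1 (hl.sup_comp _)
  comp_comp k a := h.inj (by rw [h.comp, h.comp, hl.comp_comp])
  comp_sup_eq_bot k l a hkl := h.inj (by
    rw [h.comp, h.finset_sup, h.bot]; simp only [h.comp]; exact hl.comp_sup_eq_bot k l _ hkl)
  comp_sup k a b ha hb := h.inj (by
    rw [h.comp, h.sup, h.sup, h.comp, h.comp, hl.comp_sup _ _ _ (h.scLt_iff.2 ha) (h.scLt_iff.2 hb)])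
  comp_inf i j a hij := h.scLt_iff.1 (by
    rw [h.inf, h.comp, h.comp]; exact hl.comp_inf i j _ hij)
  comp_sdiff k a b hb := h.inj (by
    rw [h.sdiff, h.sdiff, h.comp, h.comp, hl.comp_sdiff _ _ _ (h.scLt_iff.2 hb)])
  muchBelow k a b hba hab ha hk := h.scLt_iff.1 (hl.muchBelow k (f a) (f b) (h.le_iff.2 hba)
    (by rw [← h.sdiff, hab]) (fun h0 => ha (h.eq_bot_iff.1 h0)) (h.scLt_iff.2 hk))

end IsEmb

end Laws

/-! ### Good maps of ranked posets -/

/-- The monotone surjections of ranked posets whose inverse image map is an embedding of subscaled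
lattices. -/
structure GoodMap {d : ℕ} {X : RankedPoset.{u} d} {Y : RankedPoset.{v} d} (f : X → Y) : Prop where
  mono : Monotone f
  surj : Function.Surjective f
  lift : ∀ x y, f x ≤ y → ∃ x', x ≤ x' ∧ f x' = y ∧ X.rk x' = Y.rk y

section GoodMap

variable {d : ℕ} {X : RankedPoset.{u} d} {Y : RankedPoset.{v} d} {Z : RankedPoset.{w} d}

/-- The inverse image of a lower set by a monotone map. -/
def pull {f : X → Y} (hf : Monotone f) (a : Y.Down) : X.Down :=
  ⟨f ⁻¹' a, fun _ _ h hx => a.lower (hf h) hx⟩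

theorem mem_pull {f : X → Y} {hf : Monotone f} {a : Y.Down} {x : X} : x ∈ pull hf a ↔ f x ∈ a :=
  Iff.rfl

theorem GoodMap.rk_le {f : X → Y} (hf : GoodMap f) (x : X) : X.rk x ≤ Y.rk (f x) := by
  obtain ⟨x', h, -, hr⟩ := hf.lift x _ le_rfl
  exact hr ▸ RankedPoset.rk_mono h

theorem GoodMap.comp {f : X → Y} {g : Y → Z} (hg : GoodMap g) (hf : GoodMap f) :
    GoodMap (g ∘ f) where
  mono := hg.mono.comp hf.mono
  surj := hg.surj.comp hf.surj
  lift x z h := by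
    obtain ⟨y, h1, h2, h3⟩ := hg.lift (f x) z h
    obtain ⟨x', h4, h5, h6⟩ := hf.lift x y h1
    exact ⟨x', h4, by simp [h5, h2], h6.trans h3⟩

/-- Since a good map never lowers the rank, a lift of equal rank of a maximal element of a is
maximal in the inverse image. Conversely a maximal element of the inverse image is its own lift, so
its image is maximal in a and has the same rank. -/
theorem GoodMap.pull_comp {f : X → Y} (hf : GoodMap f) (k : ℕ) (a : Y.Down) :
    pull hf.mono (Y.comp k a) = X.comp k (pull hf.mono a) := by
  ext x
  constructor
  · rintro ⟨m, ⟨hm, hk, hmax⟩, hxm⟩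
    obtain ⟨x', hx', rfl, hr⟩ := hf.lift x m hxm
    refine ⟨x', ⟨hm, hr.trans hk, fun z hz hxz => ?_⟩, hx'⟩
    have := hmax (f z) hz (hf.mono hxz)
    exact (RankedPoset.eq_of_le_of_rk_le hxz (by rw [hr, ← this]; exact hf.rk_le z)).symm
  · rintro ⟨m, ⟨hm, hk, hmax⟩, hxm⟩
    refine ⟨f m, ⟨hm, ?_, fun y hy hmy => ?_⟩, hf.mono hxm⟩
    · obtain ⟨x', hx', he, hr⟩ := hf.lift m _ le_rfl
      have : x' = m := hmax x' (by rw [mem_pull, he]; exact hm) hx'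
      rw [← hr, this, hk]
    · obtain ⟨x', hx', he, hr⟩ := hf.lift m y hmy
      have : x' = m := hmax x' (by rw [mem_pull, he]; exact hy) hx'
      rw [← he, this]

theorem GoodMap.pull_sdiff {f : X → Y} (hf : GoodMap f) (a b : Y.Down) :
    pull hf.mono (a \ b) = pull hf.mono a \ pull hf.mono b := by
  ext x
  rw [SetLike.mem_coe, SetLike.mem_coe, mem_pull, mem_sdiff_iff, mem_sdiff_iff]
  constructor
  · rintro ⟨y, ⟨hy, hyb⟩, hxy⟩
    obtain ⟨x', hx', rfl, -⟩ := hf.lift x y hxy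
    exact ⟨x', ⟨hy, hyb⟩, hx'⟩
  · rintro ⟨x', ⟨hy, hyb⟩, hxx⟩
    exact ⟨f x', ⟨hy, hyb⟩, hf.mono hxx⟩

theorem GoodMap.isEmb {f : X → Y} (hf : GoodMap f) : IsEmb Y.comp X.comp (pull hf.mono) where
  inj a b h := by
    ext y
    obtain ⟨x, rfl⟩ := hf.surj y
    exact (SetLike.ext_iff.1 h x)
  bot := rfl
  top := rfl
  sup _ _ := rfl
  inf _ _ := rfl
  sdiff := hf.pull_sdiff
  comp := hf.pull_comp

theorem Pure.pull {f : X → Y} (hf : GoodMap f) {k : ℕ} {a : Y.Down} (ha : Pure k a) :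
    Pure k (pull hf.mono a) := by
  rw [← comp_eq_self_iff, ← hf.pull_comp, comp_eq_self_iff.2 ha]

end GoodMap

/-! ### Prime filters -/

section PrimeFilters

open Order

variable {L : Type u} [CoheytingAlgebra L]

theorem prime_mem_sup {p : PFilter L} (hp : p.IsPrime) {a b : L} (h : a ⊔ b ∈ p) : a ∈ p ∨ b ∈ p := by
  by_contra! hn
  have : a ⊔ b ∈ hp.compl_ideal.toIdeal :=
    Ideal.sup_mem (s := hp.compl_ideal.toIdeal) hn.1 hn.2
  exact this h

theorem prime_bot_notMem {p : PFilter L} (hp : p.IsPrime) : (⊥ : L) ∉ p := by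
  have : (⊥ : L) ∈ hp.compl_ideal.toIdeal := Ideal.bot_mem _
  exact this

theorem prime_mem_finset_sup {p : PFilter L} (hp : p.IsPrime) {ι : Type*} {s : Finset ι} {f : ι → L}
    (h : s.sup f ∈ p) : ∃ i ∈ s, f i ∈ p := by
  classical
  induction s using Finset.induction_on with
  | empty => exact absurd h (prime_bot_notMem hp)
  | insert a s _ ih =>
    rw [Finset.sup_insert] at h
    rcases prime_mem_sup hp h with h | h
    · exact ⟨a, by simp, h⟩
    · obtain ⟨i, hi, h⟩ := ih h
      exact ⟨i, by simp [hi], h⟩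

theorem exists_prime_of_disjoint (I : Ideal L) {a : L} (ha : a ∉ I) :
    ∃ q : PFilter L, q.IsPrime ∧ a ∈ q ∧ ∀ x ∈ q, x ∉ I := by
  have hd : Disjoint (PFilter.principal a : Set L) (I : Set L) := by
    rw [Set.disjoint_left]
    intro x hx hxI
    exact ha (I.lower (PFilter.mem_principal.1 hx) hxI)
  obtain ⟨J, hJ, hIJ, hdis⟩ := DistribLattice.prime_ideal_of_disjoint_filter_ideal hd
  refine ⟨hJ.toPrimePair.F, hJ.toPrimePair.F_isPrime, ?_, fun x hx hxI => ?_⟩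
  · exact Set.disjoint_left.1 hdis (PFilter.mem_principal.2 le_rfl)
  · exact (show x ∈ (J : Set L)ᶜ from hx) (hIJ hxI)

theorem exists_prime_of_not_le {a b : L} (h : ¬ a ≤ b) : ∃ q : PFilter L, q.IsPrime ∧ a ∈ q ∧ b ∉ q := by
  obtain ⟨q, hq, ha, hb⟩ := exists_prime_of_disjoint (Ideal.principal b) (a := a) h
  exact ⟨q, hq, ha, fun h => hb b h (Ideal.mem_principal.2 le_rfl)⟩

/-- If a ≤ j ∨ b with j outside p, then a - b ≤ j would be outside p as well. So a avoids the ideal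
generated by b and the complement of p, and a prime filter separates them. -/
theorem exists_prime_le_of_sdiff_mem {p : PFilter L} (hp : p.IsPrime) {a b : L} (h : a \ b ∈ p) :
    ∃ q : PFilter L, q.IsPrime ∧ q ≤ p ∧ a ∈ q ∧ b ∉ q := by
  have ha : a ∉ hp.compl_ideal.toIdeal ⊔ Ideal.principal b := by
    rw [Lattice.mem_ideal_sup_principal]
    rintro ⟨j, hj, haj⟩
    exact hj (PFilter.mem_of_le (sdiff_le_iff.2 (by rwa [sup_comm])) h)
  obtain ⟨q, hq, haq, hd⟩ := exists_prime_of_disjoint _ ha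
  refine ⟨q, hq, fun x hx => ?_, haq, fun hb => hd b hb ?_⟩
  · by_contra hxp
    exact hd x hx (le_sup_left (a := hp.compl_ideal.toIdeal) (b := Ideal.principal b) hxp)
  · exact le_sup_right (a := hp.compl_ideal.toIdeal) (b := Ideal.principal b) (Ideal.mem_principal.2 le_rfl)

/-- Prime filters, ordered by reverse inclusion. -/
abbrev Spec (L : Type u) [CoheytingAlgebra L] : Type u := {p : PFilter L // p.IsPrime}ᵒᵈ

/-- The prime filter of a point of the spectrum. -/
def Spec.filter (p : Spec L) : PFilter L := (OrderDual.ofDual p).1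

theorem Spec.prime (p : Spec L) : p.filter.IsPrime := (OrderDual.ofDual p).2

/-- The point of the spectrum given by a prime filter. -/
def Spec.of (q : PFilter L) (hq : q.IsPrime) : Spec L := OrderDual.toDual ⟨q, hq⟩

theorem Spec.le_iff {p q : Spec L} : p ≤ q ↔ q.filter ≤ p.filter := Iff.rfl

/-- Take z in the filter of p but not in that of q, then y = a - z and x = z ∧ y; here y - x = y - z
= y. The resulting x ≪ y makes the rank drop from q to p. -/
theorem Spec.exists_much_below {p q : Spec L} (h : p < q) {a : L} (ha : a ∈ q.filter) :
    ∃ x ∈ p.filter, ∃ y ∈ q.filter, y ≤ a ∧ x ≤ y ∧ y \ x = y ∧ y ≠ ⊥ := by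
  obtain ⟨z, hz, hzq⟩ : ∃ z ∈ p.filter, z ∉ q.filter := by
    by_contra! hc
    exact not_le_of_gt h (Spec.le_iff.2 hc)
  have hle : q.filter ≤ p.filter := Spec.le_iff.1 h.le
  have hy : a \ z ∈ q.filter := by
    rcases prime_mem_sup q.prime (PFilter.mem_of_le (le_sup_sdiff : a ≤ z ⊔ a \ z) ha) with h | h
    · exact absurd h hzq
    · exact h
  refine ⟨z ⊓ (a \ z), PFilter.inf_mem hz (hle hy), a \ z, hy, sdiff_le, inf_le_right, ?_, ?_⟩
  · rw [sdiff_inf_self_right]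
    exact sdiff_idem
  · intro h0
    exact prime_bot_notMem q.prime (h0 ▸ hy)

end PrimeFilters

/-! ### The spectral representation -/

namespace Laws

open Order

variable {L : Type u} [CoheytingAlgebra L] {d : ℕ} {C : ℕ → L → L}

theorem comp_le (h : Laws d C) (k : ℕ) (a : L) : C k a ≤ a := by
  by_cases hk : d < k
  · rw [h.comp_eq_bot k a hk]; exact bot_le
  · conv_rhs => rw [← h.sup_comp a]
    exact Finset.le_sup (f := fun i => C i a) (Finset.mem_range.2 (by omega))

theorem scLt_of_le (h : Laws d C) {k l : ℕ} (hkl : k ≤ l) {a : L} (ha : ScLt C k a) : ScLt C l a := by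
  apply le_antisymm (Finset.sup_le fun i _ => h.comp_le i a)
  conv_lhs => rw [← ha]
  exact Finset.sup_mono (Finset.range_mono hkl)

/-- If b ≤ a, the law for joins gives Cˡa = Cˡa ∨ Cˡb whenever l bounds both sc-dimensions; for l ≥
k the left side vanishes, hence so does Cˡb. Thus the components of b are peeled off from the top,
one at a time. -/
theorem scLt_anti (h : Laws d C) {k : ℕ} {a b : L} (hba : b ≤ a) (ha : ScLt C k a) : ScLt C k b := by
  suffices H : ∀ j, ScLt C (k + j) b → ScLt C k b from
    H (d + 1) (h.scLt_of_le (by omega) (h.sup_comp b))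
  intro j
  induction j with
  | zero => exact id
  | succ j ih =>
    intro hb
    apply ih
    have h1 := h.comp_sup (k + j) a b (h.scLt_of_le (by omega) ha) hb
    have h2 := h.comp_sup_eq_bot k (k + j) a (by omega)
    rw [show ((Finset.range k).sup fun i => C i a) = a from ha] at h2
    rw [sup_eq_left.2 hba, h2, bot_sup_eq] at h1
    have h3 : ((Finset.range (k + j + 1)).sup fun i => C i b) = b := hb
    rw [Finset.range_add_one, Finset.sup_insert, ← h1, bot_sup_eq] at h3
    exact h3

theorem scLt_zero {a : L} : ScLt C 0 a ↔ a = ⊥ := by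
  unfold ScLt
  rw [Finset.range_zero, Finset.sup_empty]
  exact eq_comm

theorem scLt_comp (h : Laws d C) (k : ℕ) (a : L) : ScLt C (k + 1) (C k a) := by
  apply le_antisymm (Finset.sup_le fun i _ => h.comp_le i _)
  conv_lhs => rw [← h.comp_comp k a]
  exact Finset.le_sup (f := fun i => C i (C k a)) (Finset.self_mem_range_succ k)

theorem comp_eq_bot_of_scLt (h : Laws d C) {k : ℕ} {a : L} (ha : ScLt C k a) : C k a = ⊥ := by
  have := h.comp_sup_eq_bot k k a le_rfl
  rwa [show ((Finset.range k).sup fun i => C i a) = a from ha] at this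

theorem exists_comp_mem (h : Laws d C) (p : Spec L) {a : L} (ha : a ∈ p.filter) :
    ∃ k ≤ d, C k a ∈ p.filter := by
  have h1 : ((Finset.range (d + 1)).sup fun i => C i a) = a := h.sup_comp a
  rw [← h1] at ha
  obtain ⟨i, hi, h⟩ := prime_mem_finset_sup p.prime ha
  exact ⟨i, by have := Finset.mem_range.1 hi; omega, h⟩

theorem exists_scLt (h : Laws d C) (p : Spec L) : ∃ k, ∃ a ∈ p.filter, ScLt C (k + 1) a :=
  ⟨d, ⊤, PFilter.top_mem, h.sup_comp ⊤⟩

open Classical in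
/-- The rank of a prime filter: the least sc-dimension of its elements. -/
noncomputable def specRk (h : Laws d C) (p : Spec L) : ℕ := Nat.find (h.exists_scLt p)

theorem exists_mem_specRk (h : Laws d C) (p : Spec L) : ∃ a ∈ p.filter, ScLt C (h.specRk p + 1) a := by
  classical
  exact Nat.find_spec (h.exists_scLt p)

theorem specRk_le (h : Laws d C) {p : Spec L} {a : L} (ha : a ∈ p.filter) {k : ℕ}
    (hk : ScLt C (k + 1) a) : h.specRk p ≤ k := by
  classical
  exact Nat.find_min' (h.exists_scLt p) ⟨a, ha, hk⟩

theorem specRk_lt (h : Laws d C) {p : Spec L} {a : L} (ha : a ∈ p.filter) {k : ℕ}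
    (hk : ScLt C k a) : h.specRk p < k := by
  cases k with
  | zero => exact absurd ((scLt_zero.1 hk) ▸ ha) (prime_bot_notMem p.prime)
  | succ k => exact Nat.lt_succ_of_le (h.specRk_le ha hk)

theorem specRk_strict (h : Laws d C) : StrictMono h.specRk := by
  intro p q hpq
  obtain ⟨a, ha, hk⟩ := h.exists_mem_specRk q
  obtain ⟨x, hx, y, hy, hya, hxy, hyx, h0⟩ := Spec.exists_much_below hpq ha
  exact h.specRk_lt hx (h.muchBelow _ y x hxy hyx h0 (h.scLt_anti hya hk))

/-- The spectrum as a ranked poset. -/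
noncomputable def spec (h : Laws d C) : RankedPoset.{u} d where
  carrier := Spec L
  rk := h.specRk
  rk_strict := h.specRk_strict
  rk_le _ := h.specRk_le PFilter.top_mem (h.sup_comp ⊤)

/-- The lower set of prime filters containing an element. -/
def specMap (h : Laws d C) (a : L) : h.spec.Down :=
  ⟨{p : Spec L | a ∈ p.filter}, fun (_ : Spec L) _ hba ha => hba ha⟩

/-- A member b of p of sc-dimension less than k would give Cᵏa - b = Cᵏa, hence a prime filter
strictly inside p that contains Cᵏa and not b, against maximality. -/
theorem rk_of_isTop (h : Laws d C) {a : L} {p : Spec L} {k : ℕ} (hk : C k a ∈ p.filter)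
    (hp : ∀ q : Spec L, C k a ∈ q.filter → p ≤ q → q = p) : h.specRk p = k := by
  apply le_antisymm (h.specRk_le hk (h.scLt_comp k a))
  by_contra! hlt
  obtain ⟨b, hb, hbk⟩ := h.exists_mem_specRk p
  have hbk' : ScLt C k b := h.scLt_of_le hlt hbk
  have h1 := h.comp_sdiff k a b (h.scLt_of_le (Nat.le_succ k) hbk')
  rw [h.comp_eq_bot_of_scLt hbk', sdiff_bot] at h1
  have h2 : C k a \ b ∈ p.filter := by rw [h1]; exact hk
  obtain ⟨q, hq, hqp, haq, hbq⟩ := exists_prime_le_of_sdiff_mem p.prime h2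
  have := hp (Spec.of q hq) haq hqp
  rw [← this] at hb
  exact hbq hb

/-- A maximal point of Cᵏa has rank k. If it were not maximal in a, some Cˡa with l > k would also
belong to it, and Cᵏa ∧ Cˡa, of sc-dimension less than k, would lower its rank. Conversely a maximal
point of a contains some Cˡa, and l must be its rank. -/
theorem specMap_comp (h : Laws d C) (k : ℕ) (a : L) :
    h.specMap (C k a) = h.spec.comp k (h.specMap a) := by
  ext p
  constructor
  · intro hp
    obtain ⟨i, (q : Spec L), hq, hpq⟩ := exists_top_above (a := h.specMap (C k a)) hp
    have hqk : C k a ∈ q.filter := hq.1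
    have hrk : h.specRk q = k := h.rk_of_isTop hqk fun r hr hqr => hq.2.2 r hr hqr
    refine ⟨q, ⟨PFilter.mem_of_le (h.comp_le k a) hqk, hrk, fun (z : Spec L) hz hqz => ?_⟩, hpq⟩
    by_contra hne
    obtain ⟨j, (t : Spec L), ht, hzt⟩ := exists_top_above (a := h.specMap a) hz
    obtain ⟨l, -, hl⟩ := h.exists_comp_mem t ht.1
    have hl' : h.specRk t = l := h.rk_of_isTop hl fun r hr htr =>
      ht.2.2 r (PFilter.mem_of_le (h.comp_le l a) hr) htr
    have hlt : q < t := lt_of_lt_of_le (lt_of_le_of_ne hqz fun e => hne e.symm) hzt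
    have hkl : k < l := hrk ▸ hl' ▸ h.specRk_strict hlt
    have hmem : C k a ⊓ C l a ∈ q.filter := PFilter.inf_mem hqk (Spec.le_iff.1 hlt.le hl)
    have := h.specRk_lt hmem (h.comp_inf k l a hkl.ne)
    rw [hrk, min_eq_left hkl.le] at this
    exact lt_irrefl _ this
  · rintro ⟨(q : Spec L), ⟨hq, hk, hm⟩, hpq⟩
    obtain ⟨l, -, hl⟩ := h.exists_comp_mem q hq
    have hl' : h.specRk q = l := h.rk_of_isTop hl fun r hr htr =>
      hm r (PFilter.mem_of_le (h.comp_le l a) hr) htr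
    have : l = k := hl'.symm.trans hk
    subst this
    exact (h.specMap (C l a)).lower hpq hl

theorem isEmb_specMap (h : Laws d C) : IsEmb C h.spec.comp h.specMap where
  inj a b hab := by
    by_contra hne
    wlog hle : ¬ a ≤ b generalizing a b
    · exact this b a hab.symm (Ne.symm hne) fun hba => hne (le_antisymm (not_not.1 hle) hba)
    obtain ⟨q, hq, ha, hb⟩ := exists_prime_of_not_le hle
    have : Spec.of q hq ∈ h.specMap b := hab ▸ (show Spec.of q hq ∈ h.specMap a from ha)
    exact hb this
  bot := eq_bot_iff.2 fun (p : Spec L) hp => (prime_bot_notMem p.prime hp).elim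
  top := eq_top_iff.2 fun (p : Spec L) _ => (PFilter.top_mem : ⊤ ∈ p.filter)
  sup a b := by
    ext (p : Spec L)
    constructor
    · exact fun hp => prime_mem_sup p.prime hp
    · rintro (hp | hp)
      · exact PFilter.mem_of_le le_sup_left hp
      · exact PFilter.mem_of_le le_sup_right hp
  inf a b := by
    ext (p : Spec L)
    exact PFilter.inf_mem_iff
  sdiff a b := by
    ext p
    rw [SetLike.mem_coe, SetLike.mem_coe, mem_sdiff_iff]
    constructor
    · intro hp
      change Spec L at p
      obtain ⟨q, hq, hqp, ha, hb⟩ := exists_prime_le_of_sdiff_mem (Spec.prime p) hp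
      exact ⟨Spec.of q hq, ⟨ha, hb⟩, hqp⟩
    · rintro ⟨(q : Spec L), ⟨ha, hb⟩, hpq⟩
      apply hpq
      rcases prime_mem_sup q.prime (PFilter.mem_of_le (le_sup_sdiff : a ≤ b ⊔ a \ b) ha) with h | h
      · exact absurd h hb
      · exact h
  comp := h.specMap_comp

end Laws

/-! ### Super scaled lattices -/

/-- The axioms of super scaled lattices that are not universal. -/
structure SuperLaws {L : Type u} [CoheytingAlgebra L] (C : ℕ → L → L) : Prop where
  scal : ∀ (k : ℕ) (a : L), C (k + 1) a = a → a ≠ ⊥ → ∃ c : L, c ≤ a ∧ c ≠ ⊥ ∧ C k c = c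
  cat : ∀ r q p : ℕ, r ≤ q → q ≤ p → ∀ c a : L, c ≤ a → C p a = a → C r c = c →
    ∃ b : L, C q b = b ∧ c ≤ b ∧ b ≤ a
  split : ∀ b₁ b₂ a : L, b₁ ⊔ b₂ ≤ a → a \ (b₁ ⊔ b₂) = a → a ≠ ⊥ →
    ∃ a₁ a₂ : L, a₁ ≠ ⊥ ∧ a₂ ≠ ⊥ ∧ b₁ ≤ a₁ ∧ b₂ ≤ a₂ ∧ a₁ = a \ a₂ ∧ a₂ = a \ a₁ ∧ a₁ ⊓ a₂ = b₁ ⊓ b₂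

/-! ### Solving one round of instances of the super scaled axioms -/

section Step

variable {d : ℕ}

/-- The instances of the super scaled axioms for lower sets of `X` have solutions among the lower
sets of `Y`. -/
structure Solves {X Y : RankedPoset.{u} d} (f : Y → X) (hf : Monotone f) : Prop where
  scal : ∀ k (a : X.Down), Pure (k + 1) a → a ≠ ⊥ → ∃ c : Y.Down, c ≤ pull hf a ∧ c ≠ ⊥ ∧ Pure k c
  cat : ∀ r q p, r ≤ q → q ≤ p → ∀ c a : X.Down, c ≤ a → Pure p a → Pure r c →
    ∃ b : Y.Down, Pure q b ∧ pull hf c ≤ b ∧ b ≤ pull hf a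
  split : ∀ b₁ b₂ a : X.Down, b₁ ⊔ b₂ ≤ a → a \ (b₁ ⊔ b₂) = a → a ≠ ⊥ →
    ∃ a₁ a₂ : Y.Down, a₁ ≠ ⊥ ∧ a₂ ≠ ⊥ ∧ pull hf b₁ ≤ a₁ ∧ pull hf b₂ ≤ a₂ ∧
      a₁ = pull hf a \ a₂ ∧ a₂ = pull hf a \ a₁ ∧ a₁ ⊓ a₂ = pull hf b₁ ⊓ pull hf b₂

/-- The points of `X`, and new points of rank `rk` below `top`, above the lower set `low`. -/
inductive Dense (X : RankedPoset.{u} d) : Type u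
  | old (x : X)
  | new (low : X.Down) (top : X) (rk : ℕ) (hlow : ∀ x ∈ low, x < top ∧ X.rk x < rk)
      (htop : rk < X.rk top)

namespace Dense

variable {X : RankedPoset.{u} d}

/-- The projection of new points to the points right above. -/
def proj : Dense X → X
  | old x => x
  | new _ a _ _ _ => a

/-- The rank function. -/
def rank : Dense X → ℕ
  | old x => X.rk x
  | new _ _ q _ _ => q

/-- The order relation. -/
def le : Dense X → Dense X → Prop
  | s, old y => s.proj ≤ y
  -- Apart from itself, a new point lies above exactly the points that project into its lower set
  -- `low`.
  | old x, new h _ _ _ _ => x ∈ h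
  | new h a q i j, new h' a' q' i' j' => new h a q i j = new h' a' q' i' j' ∨ a ∈ h'

theorem le_refl (s : Dense X) : le s s := by
  cases s
  · exact _root_.le_refl _
  · exact Or.inl rfl

theorem proj_mono {s t : Dense X} (h : le s t) : s.proj ≤ t.proj := by
  match s, t, h with
  | s, old y, h => exact h
  | old x, new h a q i j, hx => exact (i x hx).1.le
  | new h a q i j, new h' a' q' i' j', hs =>
    rcases hs with hs | hs
    · rw [hs]
    · exact (i' a hs).1.le

theorem le_trans {s t r : Dense X} (hst : le s t) (htr : le t r) : le s r := by
  match r, t, htr with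
  | old z, t, htr => exact (proj_mono hst).trans htr
  | new h a q i j, old y, hy =>
    have : s.proj ∈ h := h.lower hst hy
    cases s
    · exact this
    · exact Or.inr this
  | new h a q i j, new h' a' q' i' j', hy =>
    rcases hy with hy | hy
    · rw [← hy]; exact hst
    · have : s.proj ∈ h := h.lower (proj_mono hst) hy
      cases s
      · exact this
      · exact Or.inr this

theorem rank_lt {s t : Dense X} (hst : le s t) (hne : s ≠ t) : s.rank < t.rank := by
  match s, t, hst with
  | old x, old y, h => exact X.rk_strict (lt_of_le_of_ne h fun e => hne (e ▸ rfl))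
  | new h a q i j, old y, hy => exact j.trans_le (RankedPoset.rk_mono hy)
  | old x, new h a q i j, hx => exact (i x hx).2
  | new h a q i j, new h' a' q' i' j', hs =>
    rcases hs with hs | hs
    · exact absurd hs hne
    · exact j.trans (i' a hs).2

end Dense

/-- The extension of a ranked poset by all possible points right below a given one. -/
def densify (X : RankedPoset.{u} d) : RankedPoset.{u} d where
  carrier := Dense X
  order :=
    { le := Dense.le
      le_refl := Dense.le_refl
      le_trans := fun _ _ _ => Dense.le_trans
      le_antisymm := fun s t hst hts => by
        by_contra hne
        exact lt_asymm (Dense.rank_lt hst hne) (Dense.rank_lt hts (Ne.symm hne)) }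
  rk := Dense.rank
  rk_strict := fun s t h => Dense.rank_lt h.1 fun e => h.2 (e ▸ Dense.le_refl s)
  rk_le s := by
    cases s with
    | old x => exact X.rk_le x
    | new h a q i j => exact j.le.trans (X.rk_le a)

/-- The projection of `densify X` onto `X`. -/
def densifyProj (X : RankedPoset.{u} d) : densify X → X := Dense.proj

theorem goodMap_densifyProj (X : RankedPoset.{u} d) : GoodMap (densifyProj X) where
  mono _ _ h := Dense.proj_mono h
  surj x := ⟨Dense.old x, rfl⟩
  lift _ y h := ⟨Dense.old y, h, rfl, rfl⟩

theorem densify_scal {X : RankedPoset.{u} d} (k : ℕ) (a : X.Down) (ha : Pure (k + 1) a) (h0 : a ≠ ⊥) :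
    ∃ c : (densify X).Down, c ≤ pull (goodMap_densifyProj X).mono a ∧ c ≠ ⊥ ∧ Pure k c := by
  obtain ⟨x, hx⟩ := ne_bot_iff.1 h0
  obtain ⟨y, hy, -, hk⟩ := ha x hx
  -- A new minimal point of rank k just below a point of `a` of rank k + 1.
  let s : densify X := Dense.new ⊥ y k (fun _ h => h.elim) (by omega)
  refine ⟨downOf {s}, ?_, ne_bot_iff.2 ⟨s, s, rfl, le_rfl⟩, pure_downOf (by rintro _ rfl; rfl)⟩
  rintro t ⟨_, rfl, hts⟩
  exact a.lower ((goodMap_densifyProj X).mono hts) hy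

theorem densify_cat {X : RankedPoset.{u} d} (r q p : ℕ) (hrq : r ≤ q) (hqp : q ≤ p) (c a : X.Down)
    (hca : c ≤ a) (ha : Pure p a) (hc : Pure r c) :
    ∃ b : (densify X).Down, Pure q b ∧ pull (goodMap_densifyProj X).mono c ≤ b ∧
      b ≤ pull (goodMap_densifyProj X).mono a := by
  have hf := goodMap_densifyProj X
  rcases hrq.eq_or_lt with rfl | hrq
  · exact ⟨pull hf.mono c, hc.pull hf, le_rfl, fun x hx => hca hx⟩
  rcases hqp.eq_or_lt with rfl | hqp
  · exact ⟨pull hf.mono a, ha.pull hf, fun x hx => hca hx, le_rfl⟩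
  -- The witness is generated by all points of rank q over a, old and new; only the inclusion of c
  -- needs a construction.
  refine ⟨downOf {s : densify X | s.rank = q ∧ densifyProj X s ∈ a}, pure_downOf fun s hs => hs.1, ?_, ?_⟩
  · intro s hs
    obtain ⟨m, hm, hsm, hrk⟩ := hc _ hs
    obtain ⟨n, hn, hmn, hrk'⟩ := ha m (hca hm)
    -- A point of rank q inserted between m, of rank r < q, and n, of rank p > q.
    let t : densify X := Dense.new (LowerSet.Iic m) n q (fun x hx => by
      have hxm : x ≤ m := hx
      refine ⟨lt_of_le_of_lt hxm (lt_of_le_of_ne hmn ?_), ?_⟩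
      · rintro rfl; omega
      · have := RankedPoset.rk_mono hxm; omega) (by omega)
    refine ⟨t, ⟨rfl, hn⟩, ?_⟩
    have h1 : s ≤ (show densify X from Dense.old m) := hsm
    have h2 : (show densify X from Dense.old m) ≤ t := (le_refl m : m ≤ m)
    exact h1.trans h2
  · rintro s ⟨t, ⟨-, ht⟩, hst⟩
    exact a.lower (hf.mono hst) ht

/-! ### Splitting all lower sets -/

/-- An instance of the splitting axiom. -/
structure SplitTask (X : RankedPoset.{u} d) : Type u where
  (b₁ b₂ a : X.Down)
  le : b₁ ⊔ b₂ ≤ a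

/-- The sides `u`, `v` are allowed for the point `x`. -/
def SplitTask.Allowed {X : RankedPoset.{u} d} (t : SplitTask X) (x : X) (u v : Prop) : Prop :=
  (u ∨ v ↔ x ∈ t.a) ∧ (u ∧ v ↔ x ∈ t.b₁ ∧ x ∈ t.b₂) ∧ (x ∈ t.b₁ → u) ∧ (x ∈ t.b₂ → v)

/-- Outside b₁ ∧ b₂ a point of a needs only one side, and the hypotheses guarantee that this side
can be taken among those offered by u and v. -/
theorem SplitTask.exists_allowed {X : RankedPoset.{u} d} (t : SplitTask X) (x : X) (u v : Prop)
    (h : x ∈ t.a → u ∨ v) (h₁ : x ∈ t.b₁ → u) (h₂ : x ∈ t.b₂ → v) :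
    ∃ u' v', t.Allowed x u' v' ∧ (u' → u) ∧ (v' → v) := by
  have h1 : x ∈ t.b₁ → x ∈ t.a := fun h => t.le (Or.inl h)
  have h2 : x ∈ t.b₂ → x ∈ t.a := fun h => t.le (Or.inr h)
  unfold SplitTask.Allowed
  by_cases hb1 : x ∈ t.b₁
  · by_cases hb2 : x ∈ t.b₂
    · exact ⟨True, True, by tauto⟩
    · exact ⟨True, False, by tauto⟩
  · by_cases hb2 : x ∈ t.b₂
    · exact ⟨False, True, by tauto⟩
    · by_cases ha : x ∈ t.a
      · rcases h ha with hu | hv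
        · exact ⟨True, False, by tauto⟩
        · exact ⟨False, True, by tauto⟩
      · exact ⟨False, False, by tauto⟩

/-- A point of `X` with sides for all instances of the splitting axiom. -/
structure SplitPoint (X : RankedPoset.{u} d) : Type u where
  pt : X
  (u v : SplitTask X → Prop)
  allowed : ∀ t : SplitTask X, t.Allowed pt (u t) (v t)

namespace SplitPoint

variable {X : RankedPoset.{u} d}

instance : PartialOrder (SplitPoint X) where
  le s t := s.pt ≤ t.pt ∧ (∀ i, t.u i → s.u i) ∧ (∀ i, t.v i → s.v i)
  le_refl s := ⟨le_rfl, fun _ => id, fun _ => id⟩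
  le_trans s t r h h' := ⟨h.1.trans h'.1, fun i hi => h.2.1 i (h'.2.1 i hi),
    fun i hi => h.2.2 i (h'.2.2 i hi)⟩
  le_antisymm := by
    rintro ⟨x, u, v, h⟩ ⟨x', u', v', h'⟩ ⟨h1, h2, h3⟩ ⟨h4, h5, h6⟩
    obtain rfl : x = x' := le_antisymm h1 h4
    obtain rfl : u = u' := funext fun i => propext ⟨h5 i, h2 i⟩
    obtain rfl : v = v' := funext fun i => propext ⟨h6 i, h3 i⟩
    rfl

/-- The disjunction and the conjunction determine the two truth values up to exchange, so no strict
implication is possible. -/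
theorem sides_eq {u v u' v' A B : Prop} (h₁ : u ∨ v ↔ A) (h₂ : u ∧ v ↔ B) (h₃ : u' ∨ v' ↔ A)
    (h₄ : u' ∧ v' ↔ B) (h₅ : u' → u) (h₆ : v' → v) : (u → u') ∧ (v → v') := by
  rw [← h₁] at h₃
  rw [← h₂] at h₄
  clear h₁ h₂
  by_cases u <;> by_cases v <;> by_cases u' <;> by_cases v' <;> simp_all

theorem sides_of_pt_eq {s t : SplitPoint X} (h : s ≤ t) (he : s.pt = t.pt) : t ≤ s := by
  obtain ⟨-, h2, h3⟩ := h
  have key : ∀ i, (s.u i → t.u i) ∧ (s.v i → t.v i) := fun i => by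
    have hs := s.allowed i
    have ht := t.allowed i
    rw [← he] at ht
    exact sides_eq hs.1 hs.2.1 ht.1 ht.2.1 (h2 i) (h3 i)
  exact ⟨he.ge, fun i => (key i).1, fun i => (key i).2⟩

/-- Going up can only lose sides. Membership of y in a, b₁ or b₂ passes down to the point of s, so
the sides of s contain an allowed choice for y, task by task. -/
theorem exists_above (s : SplitPoint X) (y : X) (h : s.pt ≤ y) : ∃ t : SplitPoint X, s ≤ t ∧ t.pt = y := by
  have : ∀ i : SplitTask X, ∃ u v, i.Allowed y u v ∧ (u → s.u i) ∧ (v → s.v i) := fun i => by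
    have hs := s.allowed i
    unfold SplitTask.Allowed at hs
    exact i.exists_allowed y _ _ (fun hy => hs.1.2 (i.a.lower h hy))
      (fun hy => hs.2.2.1 (i.b₁.lower h hy)) (fun hy => hs.2.2.2 (i.b₂.lower h hy))
  choose u v huv using this
  exact ⟨⟨y, u, v, fun i => (huv i).1⟩, ⟨h, fun i => (huv i).2.1, fun i => (huv i).2.2⟩, rfl⟩

theorem exists_over (x : X) : ∃ s : SplitPoint X, s.pt = x := by
  have : ∀ i : SplitTask X, ∃ u v, i.Allowed x u v ∧ (u → True) ∧ (v → True) := fun i =>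
    i.exists_allowed x _ _ (fun _ => Or.inl trivial) (fun _ => trivial) (fun _ => trivial)
  choose u v huv using this
  exact ⟨⟨x, u, v, fun i => (huv i).1⟩, rfl⟩

open Classical in
theorem exists_update (s : SplitPoint X) (t : SplitTask X) {u v : Prop} (h : t.Allowed s.pt u v) :
    ∃ s' : SplitPoint X, s'.pt = s.pt ∧ (s'.u t ↔ u) ∧ (s'.v t ↔ v) ∧
      ∀ i, i ≠ t → s'.u i = s.u i ∧ s'.v i = s.v i := by
  refine ⟨⟨s.pt, Function.update s.u t u, Function.update s.v t v, fun i => ?_⟩, rfl, by simp, by simp,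
    fun i hi => by simp [hi]⟩
  by_cases hi : i = t
  · subst hi; simpa using h
  · simp only [Function.update_of_ne hi]; exact s.allowed i

end SplitPoint

/-- The poset in which all lower sets of `X` are split. -/
def splitAll (X : RankedPoset.{u} d) : RankedPoset.{u} d where
  carrier := SplitPoint X
  rk s := X.rk s.pt
  rk_strict _ _ h := X.rk_strict (lt_of_le_of_ne h.le.1 fun he =>
    h.not_ge (SplitPoint.sides_of_pt_eq h.le he))
  rk_le s := X.rk_le s.pt

/-- The projection of `splitAll X` onto `X`. -/
def splitProj (X : RankedPoset.{u} d) : splitAll X → X := SplitPoint.pt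

theorem goodMap_splitProj (X : RankedPoset.{u} d) : GoodMap (splitProj X) where
  mono _ _ h := h.1
  surj := SplitPoint.exists_over
  lift s y h := by
    obtain ⟨t, ht, rfl⟩ := SplitPoint.exists_above s y h
    exact ⟨t, ht, rfl, rfl⟩

/-- The two parts consist of the copies that carry the first, respectively the second, side for the
given task. Since a - (b₁ ∨ b₂) = a, each of their points lies below a copy outside b₁ ∨ b₂ with
just that one side, so each part is generated by its difference with the other. -/
theorem splitAll_split {X : RankedPoset.{u} d} (b₁ b₂ a : X.Down) (hle : b₁ ⊔ b₂ ≤ a)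
    (hsd : a \ (b₁ ⊔ b₂) = a) (h0 : a ≠ ⊥) :
    ∃ a₁ a₂ : (splitAll X).Down, a₁ ≠ ⊥ ∧ a₂ ≠ ⊥ ∧ pull (goodMap_splitProj X).mono b₁ ≤ a₁ ∧
      pull (goodMap_splitProj X).mono b₂ ≤ a₂ ∧ a₁ = pull (goodMap_splitProj X).mono a \ a₂ ∧
      a₂ = pull (goodMap_splitProj X).mono a \ a₁ ∧
      a₁ ⊓ a₂ = pull (goodMap_splitProj X).mono b₁ ⊓ pull (goodMap_splitProj X).mono b₂ := by
  let t : SplitTask X := ⟨b₁, b₂, a, hle⟩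
  let a₁ : (splitAll X).Down := ⟨{s : SplitPoint X | s.u t}, fun _ _ h hs => h.2.1 t hs⟩
  let a₂ : (splitAll X).Down := ⟨{s : SplitPoint X | s.v t}, fun _ _ h hs => h.2.2 t hs⟩
  have key : ∀ s : SplitPoint X, (s.u t ∨ s.v t ↔ s.pt ∈ a) ∧
    (s.u t ∧ s.v t ↔ s.pt ∈ b₁ ∧ s.pt ∈ b₂) ∧ (s.pt ∈ b₁ → s.u t) ∧ (s.pt ∈ b₂ → s.v t) :=
    fun s => s.allowed t
  have hall : ∀ y ∈ a, y ∉ b₁ ⊔ b₂ → ∀ u v : Prop, (u ∨ v) → ¬ (u ∧ v) → t.Allowed y u v := by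
    intro y hy hyb u v h1 h2
    have hyb1 : y ∉ b₁ := fun h => hyb (Or.inl h)
    have hyb2 : y ∉ b₂ := fun h => hyb (Or.inr h)
    change (u ∨ v ↔ y ∈ a) ∧ (u ∧ v ↔ y ∈ b₁ ∧ y ∈ b₂) ∧ (y ∈ b₁ → u) ∧ (y ∈ b₂ → v)
    tauto
  -- Climb to a point of a outside b₁ ∨ b₂ and reset the sides there for this task alone, keeping
  -- them within the sides of s.
  have above : ∀ s : SplitPoint X, ∀ u v : Prop, s.pt ∈ a → (u ∨ v) → ¬ (u ∧ v) → (u → s.u t) →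
      (v → s.v t) → ∃ s' : SplitPoint X, s ≤ s' ∧ s'.pt ∈ a ∧ (s'.u t ↔ u) ∧ (s'.v t ↔ v) := by
    intro s u v hs huv hnot hu hv
    rw [← hsd, mem_sdiff_iff] at hs
    obtain ⟨y, ⟨hy, hyb⟩, hsy⟩ := hs
    obtain ⟨s', hs', rfl⟩ := s.exists_above y hsy
    obtain ⟨s'', h1, h2, h3, h4⟩ := s'.exists_update t (hall _ hy hyb u v huv hnot)
    refine ⟨s'', ⟨h1 ▸ hsy, fun i hi => ?_, fun i hi => ?_⟩, h1 ▸ hy, h2, h3⟩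
    · by_cases e : i = t
      · subst e; exact hu (h2.1 hi)
      · exact hs'.2.1 i ((h4 i e).1 ▸ hi)
    · by_cases e : i = t
      · subst e; exact hv (h3.1 hi)
      · exact hs'.2.2 i ((h4 i e).2 ▸ hi)
  have both : ∀ u v : Prop, (u ∨ v) → ¬ (u ∧ v) → ∃ s : SplitPoint X, (s.u t ↔ u) ∧ (s.v t ↔ v) := by
    intro u v huv hnot
    obtain ⟨x, hx⟩ := ne_bot_iff.1 h0
    rw [← hsd, mem_sdiff_iff] at hx
    obtain ⟨y, ⟨hy, hyb⟩, -⟩ := hx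
    obtain ⟨s, rfl⟩ := SplitPoint.exists_over y
    obtain ⟨s', -, h⟩ := s.exists_update t (hall _ hy hyb u v huv hnot)
    exact ⟨s', h.1, h.2.1⟩
  refine ⟨a₁, a₂, ?_, ?_, ?_, ?_, ?_, ?_, ?_⟩
  · obtain ⟨s', h, -⟩ := both True False (by tauto) (by tauto)
    exact ne_bot_iff.2 ⟨s', h.2 trivial⟩
  · obtain ⟨s', -, h⟩ := both False True (by tauto) (by tauto)
    exact ne_bot_iff.2 ⟨s', h.2 trivial⟩
  · intro (s : SplitPoint X) hs; exact (key s).2.2.1 hs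
  · intro (s : SplitPoint X) hs; exact (key s).2.2.2 hs
  · ext s
    rw [SetLike.mem_coe, SetLike.mem_coe, mem_sdiff_iff]
    change SplitPoint X at s
    constructor
    · intro (hs : s.u t)
      obtain ⟨s', h1, h2, h3, h4⟩ := above s True False ((key s).1.1 (Or.inl hs)) (by tauto)
        (by tauto) (fun _ => hs) (by tauto)
      exact ⟨s', ⟨h2, fun h => h4.1 h⟩, h1⟩
    · rintro ⟨(s' : SplitPoint X), ⟨h1, h2⟩, h3⟩
      exact a₁.lower h3 (((key s').1.2 h1).resolve_right h2)
  · ext s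
    rw [SetLike.mem_coe, SetLike.mem_coe, mem_sdiff_iff]
    change SplitPoint X at s
    constructor
    · intro (hs : s.v t)
      obtain ⟨s', h1, h2, h3, h4⟩ := above s False True ((key s).1.1 (Or.inr hs)) (by tauto)
        (by tauto) (by tauto) (fun _ => hs)
      exact ⟨s', ⟨h2, fun h => h3.1 h⟩, h1⟩
    · rintro ⟨(s' : SplitPoint X), ⟨h1, h2⟩, h3⟩
      exact a₂.lower h3 (((key s').1.2 h1).resolve_left h2)
  · ext (s : SplitPoint X)
    exact (key s).2.1

end Step

/-! ### Towers of ranked posets -/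

section Tower

variable {d : ℕ}

theorem pull_mono {X Y : RankedPoset.{u} d} {f : X → Y} (hf : Monotone f) {a b : Y.Down} (h : a ≤ b) :
    pull hf a ≤ pull hf b := fun _ hx => h hx

/-- A ranked poset in which all instances of the super scaled axioms for `X` have solutions. -/
def superStep (X : RankedPoset.{u} d) : RankedPoset.{u} d := splitAll (densify X)

/-- The projection of `superStep X` onto `X`. -/
def superProj (X : RankedPoset.{u} d) : superStep X → X := densifyProj X ∘ splitProj (densify X)

theorem goodMap_superProj (X : RankedPoset.{u} d) : GoodMap (superProj X) :=
  (goodMap_densifyProj X).comp (goodMap_splitProj (densify X))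

theorem solves_superProj (X : RankedPoset.{u} d) : Solves (superProj X) (goodMap_superProj X).mono := by
  have hf := goodMap_splitProj (densify X)
  have hg := goodMap_densifyProj X
  refine ⟨fun k a ha h0 => ?_, fun r q p hrq hqp c a hca ha hc => ?_, fun b₁ b₂ a hle hsd h0 => ?_⟩
  · obtain ⟨c, h1, h2, h3⟩ := densify_scal k a ha h0
    exact ⟨pull hf.mono c, pull_mono hf.mono h1, fun h => h2 (hf.isEmb.eq_bot_iff.1 h), h3.pull hf⟩
  · obtain ⟨b, h1, h2, h3⟩ := densify_cat r q p hrq hqp c a hca ha hc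
    exact ⟨pull hf.mono b, h1.pull hf, pull_mono hf.mono h2, pull_mono hf.mono h3⟩
  · exact splitAll_split (pull hg.mono b₁) (pull hg.mono b₂) (pull hg.mono a) (pull_mono hg.mono hle)
      ((hg.pull_sdiff a (b₁ ⊔ b₂)).symm.trans (by rw [hsd]))
      fun h => h0 (hg.isEmb.eq_bot_iff.1 h)

/-- The points of the inverse limit of a tower. -/
def Thread (X : ℕ → RankedPoset.{u} d) (π : ∀ n, X (n + 1) → X n) : Type u :=
  {x : ∀ n, X n // ∀ n, π n (x (n + 1)) = x n}

variable {X : ℕ → RankedPoset.{u} d} {π : ∀ n, X (n + 1) → X n}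

instance : PartialOrder (Thread X π) := Subtype.partialOrder _

theorem Thread.le_iff {x y : Thread X π} : x ≤ y ↔ ∀ n, x.1 n ≤ y.1 n := Iff.rfl

theorem Thread.rk_antitone (hπ : ∀ n, GoodMap (π n)) (x : Thread X π) :
    Antitone fun n => (X n).rk (x.1 n) :=
  antitone_nat_of_succ_le fun n => by
    have := (hπ n).rk_le (x.1 (n + 1))
    rwa [x.2 n] at this

/-- The rank of a thread: the limit of the ranks of its members. -/
noncomputable def Thread.rank (x : Thread X π) : ℕ := sInf (Set.range fun n => (X n).rk (x.1 n))

theorem Thread.exists_rank_eq (hπ : ∀ n, GoodMap (π n)) (x : Thread X π) :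
    ∃ n, ∀ m ≥ n, (X m).rk (x.1 m) = x.rank := by
  obtain ⟨n, hn⟩ := Nat.sInf_mem (Set.range_nonempty fun n => (X n).rk (x.1 n))
  refine ⟨n, fun m hm => le_antisymm ?_ (Nat.sInf_le ⟨m, rfl⟩)⟩
  exact (Thread.rk_antitone hπ x hm).trans hn.le

theorem Thread.ne_of_le (x y : Thread X π) {n m : ℕ} (hnm : n ≤ m) (h : x.1 n ≠ y.1 n) : x.1 m ≠ y.1 m := by
  induction m, hnm using Nat.le_induction with
  | base => exact h
  | succ m _ ih => exact fun he => ih (by rw [← x.2 m, ← y.2 m, he])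

/-- The inverse limit of a tower of good maps. -/
noncomputable def limit (X : ℕ → RankedPoset.{u} d) (π : ∀ n, X (n + 1) → X n) (hπ : ∀ n, GoodMap (π n)) :
    RankedPoset.{u} d where
  carrier := Thread X π
  rk := Thread.rank
  rk_strict x y hxy := by
    obtain ⟨n, hn⟩ := Function.ne_iff.1 fun h => hxy.ne (Subtype.ext h)
    obtain ⟨i, hi⟩ := x.exists_rank_eq hπ
    obtain ⟨j, hj⟩ := y.exists_rank_eq hπ
    have hm := Thread.ne_of_le x y (le_max_left n (max i j)) hn
    rw [← hi (max n (max i j)) (by simp), ← hj (max n (max i j)) (by simp)]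
    exact (X _).rk_strict (lt_of_le_of_ne (Thread.le_iff.1 hxy.le _) hm)
  rk_le x := by
    obtain ⟨i, hi⟩ := x.exists_rank_eq hπ
    rw [← hi i le_rfl]
    exact (X i).rk_le _

/-- Lifting stage by stage with equal rank gives a thread of constant rank. Without this constancy
the rank of the limit could fall below that of y. -/
theorem exists_thread_zero (hπ : ∀ n, GoodMap (π n)) (x : Thread X π) (y : X 0) (h : x.1 0 ≤ y) :
    ∃ t : Thread X π, x ≤ t ∧ t.1 0 = y ∧ ∀ n, (X n).rk (t.1 n) = (X 0).rk y := by
  have step : ∀ n (z : {z : X n // x.1 n ≤ z ∧ (X n).rk z = (X 0).rk y}),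
      ∃ z' : {z : X (n + 1) // x.1 (n + 1) ≤ z ∧ (X (n + 1)).rk z = (X 0).rk y}, π n z'.1 = z.1 := by
    rintro n ⟨z, h1, h2⟩
    obtain ⟨z', h3, h4, h5⟩ := (hπ n).lift (x.1 (n + 1)) z (by rw [x.2 n]; exact h1)
    exact ⟨⟨z', h3, h5.trans h2⟩, h4⟩
  choose F hF using step
  let s : ∀ n, {z : X n // x.1 n ≤ z ∧ (X n).rk z = (X 0).rk y} := fun n =>
    Nat.rec ⟨y, h, rfl⟩ (fun n z => F n z) n
  exact ⟨⟨fun n => (s n).1, fun n => hF n (s n)⟩, fun n => (s n).2.1, rfl, fun n => (s n).2.2⟩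

/-- Dropping the first stage reduces n + 1 to n; the dropped coordinate is the image of the next
one. -/
theorem exists_thread (X : ℕ → RankedPoset.{u} d) (π : ∀ n, X (n + 1) → X n) (hπ : ∀ n, GoodMap (π n))
    (n : ℕ) (x : Thread X π) (y : X n) (h : x.1 n ≤ y) :
    ∃ t : Thread X π, x ≤ t ∧ t.1 n = y ∧ ∀ m ≥ n, (X m).rk (t.1 m) = (X n).rk y := by
  induction n generalizing X with
  | zero =>
    obtain ⟨t, h1, h2, h3⟩ := exists_thread_zero hπ x y h
    exact ⟨t, h1, h2, fun m _ => h3 m⟩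
  | succ n ih =>
    obtain ⟨t, h1, h2, h3⟩ := ih (fun n => X (n + 1)) (fun n => π (n + 1)) (fun n => hπ (n + 1))
      ⟨fun n => x.1 (n + 1), fun n => x.2 (n + 1)⟩ y h
    refine ⟨⟨fun n => Nat.casesOn n (π 0 (t.1 0)) t.1, fun n => ?_⟩, fun n => ?_, h2, fun m hm => ?_⟩
    · cases n with
      | zero => rfl
      | succ n => exact t.2 n
    · cases n with
      | zero =>
        have := (hπ 0).mono (h1 0)
        exact (x.2 0).symm.le.trans this
      | succ n => exact h1 n
    · cases m with
      | zero => omega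
      | succ m => exact h3 m (by omega)

theorem exists_thread_over (hπ : ∀ n, GoodMap (π n)) (n : ℕ) (y : X n) : ∃ t : Thread X π, t.1 n = y := by
  suffices H : ∃ t : Thread X π, t.1 n ≤ y by
    obtain ⟨t, ht⟩ := H
    obtain ⟨t', -, h, -⟩ := exists_thread X π hπ n t y ht
    exact ⟨t', h⟩
  induction n generalizing X with
  | zero =>
    have step : ∀ n (z : X n), ∃ z' : X (n + 1), π n z' = z := fun n z => (hπ n).surj z
    choose F hF using step
    let s : ∀ n, X n := fun n => Nat.rec y (fun n z => F n z) n
    exact ⟨⟨s, fun n => hF n (s n)⟩, le_rfl⟩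
  | succ n ih =>
    obtain ⟨t, ht⟩ := ih (X := fun n => X (n + 1)) (π := fun n => π (n + 1)) (fun n => hπ (n + 1)) y
    refine ⟨⟨fun n => Nat.casesOn n (π 0 (t.1 0)) t.1, fun n => ?_⟩, ht⟩
    cases n with
    | zero => rfl
    | succ n => exact t.2 n

/-- The projection of the limit of a tower. -/
def limitProj (hπ : ∀ n, GoodMap (π n)) (n : ℕ) : limit X π hπ → X n := fun x => x.1 n

theorem goodMap_limitProj (hπ : ∀ n, GoodMap (π n)) (n : ℕ) : GoodMap (limitProj hπ n) where
  mono _ _ h := h n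
  surj y := exists_thread_over hπ n y
  lift x y h := by
    obtain ⟨t, h1, h2, h3⟩ := exists_thread X π hπ n x y h
    refine ⟨t, h1, h2, ?_⟩
    obtain ⟨i, hi⟩ := Thread.exists_rank_eq hπ t
    exact (hi (max i n) (le_max_left _ _)).symm.trans (h3 _ (le_max_right _ _))

end Tower

/-! ### The embedding into a super scaled lattice -/

section Closed

variable {d : ℕ} {X : RankedPoset.{u} d}

/-- Sets of lower sets that are closed under the operations. -/
structure IsClosedSet (N : Set X.Down) : Prop where
  bot : ⊥ ∈ N
  top : ⊤ ∈ N
  sup : ∀ a ∈ N, ∀ b ∈ N, a ⊔ b ∈ N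
  inf : ∀ a ∈ N, ∀ b ∈ N, a ⊓ b ∈ N
  sdiff : ∀ a ∈ N, ∀ b ∈ N, a \ b ∈ N
  comp : ∀ k, ∀ a ∈ N, X.comp k a ∈ N

/-- The co-Heyting algebra structure on a closed set of lower sets. -/
abbrev IsClosedSet.algebra {N : Set X.Down} (h : IsClosedSet N) : CoheytingAlgebra N :=
  letI : Max N := ⟨fun a b => ⟨a.1 ⊔ b.1, h.sup _ a.2 _ b.2⟩⟩
  letI : Min N := ⟨fun a b => ⟨a.1 ⊓ b.1, h.inf _ a.2 _ b.2⟩⟩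
  letI : Bot N := ⟨⟨⊥, h.bot⟩⟩
  letI : Top N := ⟨⟨⊤, h.top⟩⟩
  letI : SDiff N := ⟨fun a b => ⟨a.1 \ b.1, h.sdiff _ a.2 _ b.2⟩⟩
  letI : HNot N := ⟨fun a => ⟨￢a.1, by rw [← top_sdiff']; exact h.sdiff _ h.top _ a.2⟩⟩
  Function.Injective.coheytingAlgebra (fun a : N => a.1) Subtype.val_injective Iff.rfl Iff.rfl
    (fun _ _ => rfl) (fun _ _ => rfl) rfl rfl (fun _ => rfl) (fun _ _ => rfl)

/-- The components on a closed set of lower sets. -/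
def IsClosedSet.compOn {N : Set X.Down} (h : IsClosedSet N) (k : ℕ) (a : N) : N :=
  ⟨X.comp k a.1, h.comp k _ a.2⟩

theorem IsClosedSet.isEmb {N : Set X.Down} (h : IsClosedSet N) :
    letI := h.algebra
    IsEmb h.compOn X.comp (fun a : N => a.1) :=
  letI := h.algebra
  { inj := Subtype.val_injective
    bot := rfl
    top := rfl
    sup := fun _ _ => rfl
    inf := fun _ _ => rfl
    sdiff := fun _ _ => rfl
    comp := fun _ _ => rfl }

end Closed

/-! ### The direct limit of the lattices along a tower -/

section Limit

variable {d : ℕ} {X : ℕ → RankedPoset.{u} d} {π : ∀ n, X (n + 1) → X n}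

/-- The lower sets of the limit that come from a member of the tower. -/
def limitSet (hπ : ∀ n, GoodMap (π n)) : Set (limit X π hπ).Down :=
  {a | ∃ n, ∃ b : (X n).Down, a = pull (goodMap_limitProj hπ n).mono b}

theorem exists_pull_of_le (hπ : ∀ n, GoodMap (π n)) {n m : ℕ} (h : n ≤ m) (b : (X n).Down) :
    ∃ c : (X m).Down, pull (goodMap_limitProj hπ n).mono b = pull (goodMap_limitProj hπ m).mono c := by
  induction m, h using Nat.le_induction with
  | base => exact ⟨b, rfl⟩
  | succ m _ ih =>
    obtain ⟨c, hc⟩ := ih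
    refine ⟨pull (hπ m).mono c, hc.trans ?_⟩
    ext (x : Thread X π)
    change x.1 m ∈ c ↔ π m (x.1 (m + 1)) ∈ c
    rw [x.2 m]

theorem exists_common (hπ : ∀ n, GoodMap (π n)) (s : Finset (limit X π hπ).Down) (hs : ↑s ⊆ limitSet hπ) :
    ∃ n, ∀ a ∈ s, ∃ b : (X n).Down, a = pull (goodMap_limitProj hπ n).mono b := by
  classical
  induction s using Finset.induction_on with
  | empty => exact ⟨0, by simp⟩
  | insert a s _ ih =>
    rw [Finset.coe_insert, Set.insert_subset_iff] at hs
    obtain ⟨n, hn⟩ := ih hs.2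
    obtain ⟨m, b, rfl⟩ := hs.1
    refine ⟨max n m, fun c hc => ?_⟩
    rcases Finset.mem_insert.1 hc with rfl | hc
    · exact exists_pull_of_le hπ (le_max_right n m) b
    · obtain ⟨b', rfl⟩ := hn c hc
      exact exists_pull_of_le hπ (le_max_left n m) b'

theorem exists_common_pair (hπ : ∀ n, GoodMap (π n)) {a b : (limit X π hπ).Down} (ha : a ∈ limitSet hπ)
    (hb : b ∈ limitSet hπ) : ∃ n, ∃ a' b' : (X n).Down,
      a = pull (goodMap_limitProj hπ n).mono a' ∧ b = pull (goodMap_limitProj hπ n).mono b' := by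
  classical
  obtain ⟨n, hn⟩ := exists_common hπ {a, b} (by
    intro x hx
    rcases (by simpa using hx : x = a ∨ x = b) with rfl | rfl <;> assumption)
  obtain ⟨a', ha'⟩ := hn a (by simp)
  obtain ⟨b', hb'⟩ := hn b (by simp)
  exact ⟨n, a', b', ha', hb'⟩

theorem isClosedSet_limitSet (hπ : ∀ n, GoodMap (π n)) : IsClosedSet (limitSet hπ) where
  bot := ⟨0, ⊥, rfl⟩
  top := ⟨0, ⊤, rfl⟩
  sup a ha b hb := by
    obtain ⟨n, a, b, rfl, rfl⟩ := exists_common_pair hπ ha hb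
    exact ⟨n, a ⊔ b, rfl⟩
  inf a ha b hb := by
    obtain ⟨n, a, b, rfl, rfl⟩ := exists_common_pair hπ ha hb
    exact ⟨n, a ⊓ b, rfl⟩
  sdiff a ha b hb := by
    obtain ⟨n, a, b, rfl, rfl⟩ := exists_common_pair hπ ha hb
    exact ⟨n, a \ b, ((goodMap_limitProj hπ n).pull_sdiff a b).symm⟩
  comp k a ha := by
    obtain ⟨n, a, rfl⟩ := ha
    exact ⟨n, (X n).comp k a, ((goodMap_limitProj hπ n).pull_comp k a).symm⟩

/-- An instance of an axiom has finitely many parameters, so it lives at some stage n, and its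
solution at stage n + 1 persists in the limit. -/
theorem superLaws_limit (hπ : ∀ n, GoodMap (π n)) (hs : ∀ n, Solves (π n) (hπ n).mono) :
    letI := (isClosedSet_limitSet hπ).algebra
    SuperLaws (isClosedSet_limitSet hπ).compOn := by
  let _ := (isClosedSet_limitSet hπ).algebra
  have hcl := isClosedSet_limitSet hπ
  have hemb : IsEmb hcl.compOn (limit X π hπ).comp (fun a : limitSet hπ => a.1) := hcl.isEmb
  have hp : ∀ n, GoodMap (limitProj hπ n) := goodMap_limitProj hπ
  -- The embeddings of the stages into the direct limit; `hEs` says that they are compatible.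
  let E : ∀ n, (X n).Down → limitSet hπ := fun n a => ⟨pull (hp n).mono a, n, a, rfl⟩
  have hE : ∀ n, IsEmb (X n).comp hcl.compOn (E n) := fun n =>
    { inj := fun a b h => (hp n).isEmb.inj (congrArg Subtype.val h)
      bot := rfl
      top := rfl
      sup := fun _ _ => rfl
      inf := fun _ _ => rfl
      sdiff := fun a b => Subtype.ext ((hp n).pull_sdiff a b)
      comp := fun k a => Subtype.ext ((hp n).pull_comp k a) }
  have hEs : ∀ n (a : (X n).Down), E (n + 1) (pull (hπ n).mono a) = E n a := by
    intro n a
    apply Subtype.ext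
    ext (x : Thread X π)
    change π n (x.1 (n + 1)) ∈ a ↔ x.1 n ∈ a
    rw [x.2 n]
  have two : ∀ a b : limitSet hπ, ∃ n a' b', a = E n a' ∧ b = E n b' := by
    rintro ⟨a, ha⟩ ⟨b, hb⟩
    obtain ⟨n, a', b', rfl, rfl⟩ := exists_common_pair hπ ha hb
    exact ⟨n, a', b', rfl, rfl⟩
  have three : ∀ a b c : limitSet hπ, ∃ n a' b' c', a = E n a' ∧ b = E n b' ∧ c = E n c' := by
    classical
    intro a b c
    obtain ⟨n, hn⟩ := exists_common hπ {a.1, b.1, c.1} (by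
      intro x hx
      rcases (by simpa using hx : x = a.1 ∨ x = b.1 ∨ x = c.1) with rfl | rfl | rfl
      exacts [a.2, b.2, c.2])
    obtain ⟨a', ha'⟩ := hn a.1 (by simp)
    obtain ⟨b', hb'⟩ := hn b.1 (by simp)
    obtain ⟨c', hc'⟩ := hn c.1 (by simp)
    exact ⟨n, a', b', c', Subtype.ext ha', Subtype.ext hb', Subtype.ext hc'⟩
  have pure_iff : ∀ n k (a : (X n).Down), hcl.compOn k (E n a) = E n a ↔ Pure k a := by
    intro n k a
    rw [← (hE n).comp, (hE n).inj.eq_iff, comp_eq_self_iff]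
  refine ⟨fun k a ha h0 => ?_, fun r q p hrq hqp c a hca ha hc => ?_, fun b₁ b₂ a hle hsd h0 => ?_⟩
  · obtain ⟨n, a, -, rfl, -⟩ := two a a
    rw [pure_iff] at ha
    obtain ⟨c, h1, h2, h3⟩ := (hs n).scal k a ha fun h => h0 ((hE n).eq_bot_iff.2 h)
    refine ⟨E (n + 1) c, ?_, fun h => h2 ((hE _).eq_bot_iff.1 h), (pure_iff _ _ _).2 h3⟩
    rw [← hEs n a]
    exact (hE _).le_iff.2 h1
  · obtain ⟨n, a, c, rfl, rfl⟩ := two a c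
    rw [pure_iff] at ha hc
    obtain ⟨b, h1, h2, h3⟩ := (hs n).cat r q p hrq hqp c a ((hE n).le_iff.1 hca) ha hc
    refine ⟨E (n + 1) b, (pure_iff _ _ _).2 h1, ?_, ?_⟩
    · rw [← hEs n c]; exact (hE _).le_iff.2 h2
    · rw [← hEs n a]; exact (hE _).le_iff.2 h3
  · obtain ⟨n, a, b₁, b₂, rfl, rfl, rfl⟩ := three a b₁ b₂
    rw [← (hE n).sup] at hle hsd
    rw [← (hE n).sdiff, (hE n).inj.eq_iff] at hsd
    obtain ⟨a₁, a₂, h1, h2, h3, h4, h5, h6, h7⟩ := (hs n).split b₁ b₂ a ((hE n).le_iff.1 hle) hsd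
      fun h => h0 ((hE n).eq_bot_iff.2 h)
    refine ⟨E (n + 1) a₁, E (n + 1) a₂, fun h => h1 ((hE _).eq_bot_iff.1 h),
      fun h => h2 ((hE _).eq_bot_iff.1 h), ?_, ?_, ?_, ?_, ?_⟩
    · rw [← hEs n b₁]; exact (hE _).le_iff.2 h3
    · rw [← hEs n b₂]; exact (hE _).le_iff.2 h4
    · rw [← hEs n a, ← (hE _).sdiff, ← h5]
    · rw [← hEs n a, ← (hE _).sdiff, ← h6]
    · rw [← hEs n b₁, ← hEs n b₂, ← (hE _).inf, ← (hE _).inf, h7]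

end Limit

theorem IsEmb.trans {L : Type u} {L' : Type v} {L'' : Type w} [CoheytingAlgebra L] [CoheytingAlgebra L']
    [CoheytingAlgebra L''] {C : ℕ → L → L} {C' : ℕ → L' → L'} {C'' : ℕ → L'' → L''} {f : L → L'}
    {g : L' → L''} (hg : IsEmb C' C'' g) (hf : IsEmb C C' f) : IsEmb C C'' (g ∘ f) where
  inj := hg.inj.comp hf.inj
  bot := by simp [hf.bot, hg.bot]
  top := by simp [hf.top, hg.top]
  sup a b := by simp [hf.sup, hg.sup]
  inf a b := by simp [hf.inf, hg.inf]
  sdiff a b := by simp [hf.sdiff, hg.sdiff]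
  comp k a := by simp [hf.comp, hg.comp]

/-- Every subscaled lattice embeds into a super scaled one. -/
theorem Laws.exists_super {d : ℕ} {L : Type u} [CoheytingAlgebra L] {C : ℕ → L → L} (h : Laws d C) :
    ∃ (N : Type u) (_ : CoheytingAlgebra N) (C' : ℕ → N → N) (f : L → N),
      IsEmb C C' f ∧ Laws d C' ∧ SuperLaws C' := by
  let X : ℕ → RankedPoset.{u} d := fun n => Nat.rec h.spec (fun _ Y => superStep Y) n
  let π : ∀ n, X (n + 1) → X n := fun n => superProj (X n)
  have hπ : ∀ n, GoodMap (π n) := fun n => goodMap_superProj (X n)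
  have hs : ∀ n, Solves (π n) (hπ n).mono := fun n => solves_superProj (X n)
  have hcl := isClosedSet_limitSet hπ
  let _ := hcl.algebra
  have hp := goodMap_limitProj hπ 0
  refine ⟨limitSet hπ, inferInstance, hcl.compOn, fun a => ⟨pull hp.mono (h.specMap a), 0, _, rfl⟩, ?_,
    hcl.isEmb.laws (laws_down _), superLaws_limit hπ hs⟩
  have he := hp.isEmb.trans h.isEmb_specMap
  exact
    { inj := fun a b hab => he.inj (congrArg Subtype.val hab)
      bot := Subtype.ext he.bot
      top := Subtype.ext he.top
      sup := fun a b => Subtype.ext (he.sup a b)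
      inf := fun a b => Subtype.ext (he.inf a b)
      sdiff := fun a b => Subtype.ext (he.sdiff a b)
      comp := fun k a => Subtype.ext (he.comp k a) }

/-! ### Definable good maps -/

section Definable

variable {d : ℕ} {X : RankedPoset.{u} d}

/-- Closed sets of lower sets that satisfy the axioms of super scaled lattices. -/
structure SuperSet (N : Set X.Down) : Prop extends IsClosedSet N where
  scal : ∀ k, ∀ a ∈ N, Pure (k + 1) a → a ≠ ⊥ → ∃ c ∈ N, c ≤ a ∧ c ≠ ⊥ ∧ Pure k c
  cat : ∀ r q p, r ≤ q → q ≤ p → ∀ c ∈ N, ∀ a ∈ N, c ≤ a → Pure p a → Pure r c →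
    ∃ b ∈ N, Pure q b ∧ c ≤ b ∧ b ≤ a
  split : ∀ b₁ ∈ N, ∀ b₂ ∈ N, ∀ a ∈ N, b₁ ⊔ b₂ ≤ a → a \ (b₁ ⊔ b₂) = a → a ≠ ⊥ →
    ∃ a₁ ∈ N, ∃ a₂ ∈ N, a₁ ≠ ⊥ ∧ a₂ ≠ ⊥ ∧ b₁ ≤ a₁ ∧ b₂ ≤ a₂ ∧ a₁ = a \ a₂ ∧ a₂ = a \ a₁ ∧
      a₁ ⊓ a₂ = b₁ ⊓ b₂

theorem IsClosedSet.finset_sup {N : Set X.Down} (h : IsClosedSet N) {ι : Type*} (s : Finset ι)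
    (f : ι → X.Down) (hf : ∀ i ∈ s, f i ∈ N) : s.sup f ∈ N :=
  Finset.sup_induction h.bot h.sup hf

theorem IsEmb.isClosedSet {L : Type v} [CoheytingAlgebra L] {C : ℕ → L → L} {φ : L → X.Down}
    (h : IsEmb C X.comp φ) : IsClosedSet (Set.range φ) where
  bot := ⟨⊥, h.bot⟩
  top := ⟨⊤, h.top⟩
  sup := by rintro _ ⟨a, rfl⟩ _ ⟨b, rfl⟩; exact ⟨a ⊔ b, h.sup a b⟩
  inf := by rintro _ ⟨a, rfl⟩ _ ⟨b, rfl⟩; exact ⟨a ⊓ b, h.inf a b⟩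
  sdiff := by rintro _ ⟨a, rfl⟩ _ ⟨b, rfl⟩; exact ⟨a \ b, h.sdiff a b⟩
  comp := by rintro k _ ⟨a, rfl⟩; exact ⟨C k a, h.comp k a⟩

theorem IsEmb.pure_iff {L : Type v} [CoheytingAlgebra L] {C : ℕ → L → L} {φ : L → X.Down}
    (h : IsEmb C X.comp φ) {k : ℕ} {a : L} : Pure k (φ a) ↔ C k a = a := by
  rw [← comp_eq_self_iff, ← h.comp, h.inj.eq_iff]

theorem IsEmb.superSet {L : Type v} [CoheytingAlgebra L] {C : ℕ → L → L} {φ : L → X.Down}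
    (h : IsEmb C X.comp φ) (hs : SuperLaws C) : SuperSet (Set.range φ) where
  toIsClosedSet := h.isClosedSet
  scal := by
    rintro k _ ⟨a, rfl⟩ ha h0
    obtain ⟨c, h1, h2, h3⟩ := hs.scal k a (h.pure_iff.1 ha) fun e => h0 (h.eq_bot_iff.2 e)
    exact ⟨φ c, ⟨c, rfl⟩, h.le_iff.2 h1, fun e => h2 (h.eq_bot_iff.1 e), h.pure_iff.2 h3⟩
  cat := by
    rintro r q p hrq hqp _ ⟨c, rfl⟩ _ ⟨a, rfl⟩ hca ha hc
    obtain ⟨b, h1, h2, h3⟩ := hs.cat r q p hrq hqp c a (h.le_iff.1 hca) (h.pure_iff.1 ha)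
      (h.pure_iff.1 hc)
    exact ⟨φ b, ⟨b, rfl⟩, h.pure_iff.2 h1, h.le_iff.2 h2, h.le_iff.2 h3⟩
  split := by
    rintro _ ⟨b₁, rfl⟩ _ ⟨b₂, rfl⟩ _ ⟨a, rfl⟩ hle hsd h0
    rw [← h.sup] at hle hsd
    rw [← h.sdiff, h.inj.eq_iff] at hsd
    obtain ⟨a₁, a₂, h1, h2, h3, h4, h5, h6, h7⟩ := hs.split b₁ b₂ a (h.le_iff.1 hle) hsd
      fun e => h0 (h.eq_bot_iff.2 e)
    refine ⟨φ a₁, ⟨a₁, rfl⟩, φ a₂, ⟨a₂, rfl⟩, fun e => h1 (h.eq_bot_iff.1 e),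
      fun e => h2 (h.eq_bot_iff.1 e), h.le_iff.2 h3, h.le_iff.2 h4, ?_, ?_, ?_⟩
    · rw [← h.sdiff, ← h5]
    · rw [← h.sdiff, ← h6]
    · rw [← h.inf, h7, h.inf]

/-- Good maps for which the inverse images of principal lower sets belong to `N`. -/
structure DefMap (N : Set X.Down) {Q : RankedPoset.{v} d} (ψ : X → Q) : Prop extends GoodMap ψ where
  mem : ∀ q, pull mono (LowerSet.Iic q) ∈ N

theorem pure_Iic {Q : RankedPoset.{v} d} (q : Q) : Pure (Q.rk q) (LowerSet.Iic q) :=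
  fun _ hx => ⟨q, (le_refl q : q ≤ q), hx, rfl⟩

/-- In a finite poset every lower set is a finite union of principal ones. -/
theorem DefMap.pull_mem {N : Set X.Down} (hN : IsClosedSet N) {Q : RankedPoset.{v} d} [Finite Q]
    {ψ : X → Q} (h : DefMap N ψ) (S : Q.Down) : pull h.mono S ∈ N := by
  classical
  have := Fintype.ofFinite Q
  have hS : pull h.mono S =
      (Finset.univ.filter fun q => q ∈ S).sup fun q => pull h.mono (LowerSet.Iic q) := by
    ext x
    rw [SetLike.mem_coe, SetLike.mem_coe, mem_finset_sup]
    constructor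
    · exact fun hx => ⟨ψ x, Finset.mem_filter.2 ⟨Finset.mem_univ _, hx⟩, (le_refl (ψ x) : ψ x ≤ ψ x)⟩
    · rintro ⟨q, hq, hx⟩
      exact S.lower hx (Finset.mem_filter.1 hq).2
  rw [hS]
  exact hN.finset_sup _ _ fun q _ => h.mem q

/-- A map such that the inverse images of principal lower sets are non-empty pure lower sets of the
right dimension is good. -/
theorem goodMap_of_pure {Q : RankedPoset.{v} d} {ψ : X → Q} (D : Q → X.Down)
    (hD : ∀ x q, x ∈ D q ↔ ψ x ≤ q) (hp : ∀ q, Pure (Q.rk q) (D q)) (h0 : ∀ q, D q ≠ ⊥) :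
    GoodMap ψ := by
  have hrk : ∀ x, X.rk x ≤ Q.rk (ψ x) := fun x => (hp _).rk_le ((hD x _).2 le_rfl)
  -- Purity gives a point of rank `Q.rk q` above x; its image is below q and of rank at least that,
  -- hence equal to q.
  have key : ∀ x q, ψ x ≤ q → ∃ x', x ≤ x' ∧ ψ x' = q ∧ X.rk x' = Q.rk q := by
    intro x q hq
    obtain ⟨x', h1, h2, h3⟩ := hp q x ((hD x q).2 hq)
    exact ⟨x', h2, RankedPoset.eq_of_le_of_rk_le ((hD x' q).1 h1) (h3 ▸ hrk x'), h3⟩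
  refine ⟨fun x y hxy => ?_, fun q => ?_, key⟩
  · exact (hD x _).1 ((D (ψ y)).lower hxy ((hD y _).2 le_rfl))
  · obtain ⟨x, hx⟩ := ne_bot_iff.1 (h0 q)
    obtain ⟨x', -, h, -⟩ := key x q ((hD x q).1 hx)
    exact ⟨x', h⟩

theorem defMap_of_pure {N : Set X.Down} {Q : RankedPoset.{v} d} {ψ : X → Q} (D : Q → X.Down)
    (hD : ∀ x q, x ∈ D q ↔ ψ x ≤ q) (hp : ∀ q, Pure (Q.rk q) (D q)) (h0 : ∀ q, D q ≠ ⊥)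
    (hN : ∀ q, D q ∈ N) : DefMap N ψ where
  toGoodMap := goodMap_of_pure D hD hp h0
  mem q := by
    have : pull (goodMap_of_pure D hD hp h0).mono (LowerSet.Iic q) = D q := by
      ext x; exact (hD x q).symm
    rw [this]; exact hN q

/-! ### Local finiteness -/

/-- The types of the colours of the points of a ranked poset. -/
def ColourType (T : Type u) : ℕ → Type u
  | 0 => T
  | n + 1 => T × Set (ColourType T n)

/-- The colour of a point, taking into account the colours of the points above it. -/
def colour {T : Type u} (c : X → T) : ∀ n, X → ColourType T n
  | 0, x => c x
  | n + 1, x => (c x, {t | ∃ z, x < z ∧ colour c n z = t})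

theorem finite_colourType (T : Type u) [Finite T] (n : ℕ) : Finite (ColourType T n) := by
  induction n with
  | zero => exact inferInstanceAs (Finite T)
  | succ n ih => exact inferInstanceAs (Finite (T × Set (ColourType T n)))

theorem colour_fst {T : Type u} {c : X → T} {n : ℕ} {x y : X} (h : colour c n x = colour c n y) :
    c x = c y := by
  cases n with
  | zero => exact h
  | succ n => exact congrArg Prod.fst h

theorem exists_colour {T : Type u} {c : X → T} {n : ℕ} {x y : X}
    (h : colour c (n + 1) x = colour c (n + 1) y) {z : X} (hz : x < z) :
    ∃ z', y < z' ∧ colour c n z' = colour c n z := by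
  have h2 : ({t | ∃ z, x < z ∧ colour c n z = t} : Set (ColourType T n)) =
      {t | ∃ z, y < z ∧ colour c n z = t} := congrArg Prod.snd h
  have : colour c n z ∈ ({t | ∃ z, x < z ∧ colour c n z = t} : Set (ColourType T n)) := ⟨z, hz, rfl⟩
  rw [h2] at this
  exact this

theorem colour_succ_eq {T : Type u} {c : X → T} {n : ℕ} {x y : X} (h : c x = c y)
    (h₁ : ∀ z, x < z → ∃ z', y < z' ∧ colour c n z' = colour c n z)
    (h₂ : ∀ z, y < z → ∃ z', x < z' ∧ colour c n z' = colour c n z) :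
    colour c (n + 1) x = colour c (n + 1) y := by
  refine Prod.ext h (Set.ext fun t => ?_)
  constructor
  · rintro ⟨z, hz, rfl⟩
    exact h₁ z hz
  · rintro ⟨z, hz, rfl⟩
    exact h₂ z hz

/-- A chain rising strictly from x has at most d - rk x steps, so a colour of depth n ≥ d - rk x
already knows all that lies above x. -/
theorem colour_stable {T : Type u} {c : X → T} (hc : ∀ x y, c x = c y → X.rk x = X.rk y) (n : ℕ)
    (x y : X) (hx : d ≤ X.rk x + n) (h : colour c n x = colour c n y) :
    colour c (n + 1) x = colour c (n + 1) y := by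
  induction n generalizing x y with
  | zero =>
    have hy := hc x y h
    refine colour_succ_eq h (fun z hz => ?_) (fun z hz => ?_)
    · have := X.rk_strict hz; have := X.rk_le z; omega
    · have := X.rk_strict hz; have := X.rk_le z; omega
  | succ n ih =>
    have hy := hc x y (colour_fst h)
    refine colour_succ_eq (colour_fst h) (fun z hz => ?_) (fun z hz => ?_)
    · obtain ⟨z', h1, h2⟩ := exists_colour h hz
      exact ⟨z', h1, (ih z z' (by have := X.rk_strict hz; omega) h2.symm).symm⟩
    · obtain ⟨z', h1, h2⟩ := exists_colour h.symm hz
      exact ⟨z', h1, (ih z z' (by have := X.rk_strict hz; omega) h2.symm).symm⟩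

/-- A finite set of lower sets is contained in a finite closed set. -/
theorem exists_finite_closed (s : Set X.Down) (hs : s.Finite) :
    ∃ F : Set X.Down, F.Finite ∧ s ⊆ F ∧ IsClosedSet F := by
  have := hs.to_subtype
  -- The initial colour records which of the given sets contain the point, and its rank.
  let c : X → (s → Prop) × Fin (d + 1) :=
    fun x => (fun a => x ∈ a.1, ⟨X.rk x, Nat.lt_succ_of_le (X.rk_le x)⟩)
  have hc : ∀ x y, c x = c y → X.rk x = X.rk y := fun x y h => by
    have := congrArg (fun t => t.2.1) h
    exact this
  have := finite_colourType ((s → Prop) × Fin (d + 1)) d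
  let τ := colour c d
  have hrk : ∀ x y, τ x = τ y → X.rk x = X.rk y := fun x y h => hc x y (colour_fst h)
  -- Equality of colours is a bisimulation for the order; this is what closure under differences and
  -- components needs.
  have step : ∀ x y, τ x = τ y → ∀ z, x ≤ z → ∃ z', y ≤ z' ∧ τ z' = τ z := by
    intro x y h z hz
    rcases hz.eq_or_lt with rfl | hz
    · exact ⟨y, le_rfl, h.symm⟩
    · obtain ⟨z', h1, h2⟩ := exists_colour (colour_stable hc d x y (by omega) h) hz
      exact ⟨z', h1.le, h2⟩
  -- Lower sets that are unions of colour classes. There are finitely many colours, hence finitely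
  -- many such sets.
  let F : Set X.Down := {a | ∀ x y, τ x = τ y → x ∈ a → y ∈ a}
  refine ⟨F, ?_, ?_, ?_⟩
  · have hinj : Set.InjOn (fun a : X.Down => τ '' (a : Set X)) F := by
      intro a ha b hb hab
      ext x
      have hab : τ '' (a : Set X) = τ '' (b : Set X) := hab
      constructor
      · intro hx
        obtain ⟨y, hy, hxy⟩ : τ x ∈ τ '' (b : Set X) := hab ▸ ⟨x, hx, rfl⟩
        exact hb y x hxy hy
      · intro hx
        obtain ⟨y, hy, hxy⟩ : τ x ∈ τ '' (a : Set X) := hab ▸ ⟨x, hx, rfl⟩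
        exact ha y x hxy hy
    exact Set.Finite.of_finite_image (Set.toFinite _) hinj
  · intro a ha x y hxy hx
    have := congrArg (fun t => t.1 ⟨a, ha⟩) (colour_fst hxy)
    exact (show (x ∈ a) = (y ∈ a) from this) ▸ hx
  · refine ⟨?_, ?_, ?_, ?_, ?_, ?_⟩
    · exact fun _ _ _ h => h.elim
    · exact fun _ _ _ _ => trivial
    · exact fun a ha b hb x y hxy hx => hx.imp (ha x y hxy) (hb x y hxy)
    · exact fun a ha b hb x y hxy hx => ⟨ha x y hxy hx.1, hb x y hxy hx.2⟩
    · intro a ha b hb x y hxy hx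
      rw [mem_sdiff_iff] at hx ⊢
      obtain ⟨z, ⟨hz, hzb⟩, hxz⟩ := hx
      obtain ⟨z', h1, h2⟩ := step x y hxy z hxz
      exact ⟨z', ⟨ha z z' h2.symm hz, fun h => hzb (hb z' z h2 h)⟩, h1⟩
    · rintro k a ha x y hxy ⟨z, ⟨hz, hk, hm⟩, hxz⟩
      obtain ⟨z', h1, h2⟩ := step x y hxy z hxz
      refine ⟨z', ⟨ha z z' h2.symm hz, (hrk z' z h2).trans hk, fun w hw hzw => ?_⟩, h1⟩
      obtain ⟨w', h3, h4⟩ := step z' z h2 w hzw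
      have h5 := hm w' (ha w w' h4.symm hw) h3
      subst h5
      refine (RankedPoset.eq_of_le_of_rk_le hzw ?_).symm
      rw [← hrk w' w h4, hrk z' w' h2]

theorem exists_finite_closed_subset {N : Set X.Down} (hN : IsClosedSet N) (s : Set X.Down)
    (hs : s.Finite) (hsN : s ⊆ N) : ∃ F : Set X.Down, F.Finite ∧ s ⊆ F ∧ F ⊆ N ∧ IsClosedSet F := by
  obtain ⟨F, h1, h2, h3⟩ := exists_finite_closed s hs
  refine ⟨F ∩ N, h1.inter_of_left N, fun a ha => ⟨h2 ha, hsN ha⟩, Set.inter_subset_right, ?_⟩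
  exact ⟨⟨h3.bot, hN.bot⟩, ⟨h3.top, hN.top⟩,
    fun a ha b hb => ⟨h3.sup a ha.1 b hb.1, hN.sup a ha.2 b hb.2⟩,
    fun a ha b hb => ⟨h3.inf a ha.1 b hb.1, hN.inf a ha.2 b hb.2⟩,
    fun a ha b hb => ⟨h3.sdiff a ha.1 b hb.1, hN.sdiff a ha.2 b hb.2⟩,
    fun k a ha => ⟨h3.comp k a ha.1, hN.comp k a ha.2⟩⟩

theorem exists_least {F : Set X.Down} (hF : F.Finite) (hc : IsClosedSet F) (x : X) :
    ∃ c ∈ F, x ∈ c ∧ ∀ c' ∈ F, x ∈ c' → c ≤ c' := by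
  obtain ⟨c, hcm, hmin⟩ := (hF.inter_of_left {c | x ∈ c}).exists_minimal ⟨⊤, hc.top, trivial⟩
  refine ⟨c, hcm.1, hcm.2, fun c' h1 h2 => ?_⟩
  exact (hmin ⟨hc.inf c hcm.1 c' h1, hcm.2, h2⟩ inf_le_left).trans inf_le_right

/-- Finitely many members of a closed set come from a definable map to a finite ranked poset. -/
theorem exists_defMap {N : Set X.Down} (hN : IsClosedSet N) (s : Set X.Down) (hs : s.Finite)
    (hsN : s ⊆ N) : ∃ (Q : RankedPoset.{u} d) (ψ : X → Q) (h : DefMap N ψ), Finite Q ∧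
      ∀ a ∈ s, ∃ S : Q.Down, a = pull h.mono S := by
  obtain ⟨F, hF, hsF, hFN, hc⟩ := exists_finite_closed_subset hN s hs hsN
  -- The finite poset consists of the smallest members `c x` of `F` around the points, ordered by
  -- inclusion.
  choose c hcF hcx hcmin using exists_least hF hc
  -- x lies in some component of `c x`, which belongs to `F`, so by minimality that component is all
  -- of `c x`. This defines the rank.
  have hpure : ∀ q : Set.range c, ∃ k, Pure k q.1 := by
    rintro ⟨_, x, rfl⟩
    obtain ⟨k, -, hk⟩ := exists_mem_comp (hcx x)
    exact ⟨k, comp_eq_self_iff.1 (le_antisymm (comp_le k _) (hcmin x _ (hc.comp k _ (hcF x)) hk))⟩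
  choose r hr using hpure
  have hne : ∀ q : Set.range c, q.1 ≠ ⊥ := by
    rintro ⟨_, x, rfl⟩
    exact ne_bot_iff.2 ⟨x, hcx x⟩
  have hrank : ∀ q : Set.range c, ∃ x ∈ q.1, X.rk x = r q := fun q => by
    obtain ⟨x, hx⟩ := ne_bot_iff.1 (hne q)
    obtain ⟨y, hy, -, h⟩ := hr q x hx
    exact ⟨y, hy, h⟩
  let Q : RankedPoset.{u} d :=
    { carrier := Set.range c
      rk := r
      rk_strict := by
        rintro q ⟨_, y, rfl⟩ hlt
        obtain ⟨x, hx, hxr⟩ := hrank q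
        have hle : q.1 ≤ c y := hlt.le
        have hqF : q.1 ∈ F := by
          obtain ⟨z, hz⟩ := q.2
          rw [← hz]; exact hcF z
        have hy : y ∉ q.1 := fun h => not_le_of_gt hlt (hcmin y _ hqF h)
        -- The difference belongs to `F` and contains y, so minimality leaves no room. A generator
        -- of top rank in `q` then has a point of `c y` strictly above it.
        have hsd : c y \ q.1 = c y := le_antisymm sdiff_le
          (hcmin y _ (hc.sdiff _ (hcF y) _ hqF) (mem_sdiff_iff.2 ⟨y, ⟨hcx y, hy⟩, le_rfl⟩))
        obtain ⟨z, hz, -, hxz⟩ := rk_lt_of_muchBelow hsd hle hx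
        have h1 := X.rk_strict hxz
        have h2 := (hr ⟨c y, y, rfl⟩).rk_le hz
        rw [hxr] at h1
        exact h1.trans_le h2
      rk_le := fun q => by
        obtain ⟨x, -, hx⟩ := hrank q
        rw [← hx]
        exact X.rk_le x }
  let ψ : X → Q := fun x => (⟨c x, x, rfl⟩ : Set.range c)
  have hmemF : ∀ q : Q, q.1 ∈ F := by
    rintro ⟨_, z, rfl⟩; exact hcF z
  have hD : ∀ x (q : Q), x ∈ q.1 ↔ ψ x ≤ q := fun x q =>
    ⟨fun h => hcmin x _ (hmemF q) h, fun h => h (hcx x)⟩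
  have hψ : DefMap N ψ := defMap_of_pure (fun q : Q => q.1) hD hr hne fun q => hFN (hmemF q)
  refine ⟨Q, ψ, hψ, ?_, fun a ha => ⟨⟨{q | q.1 ≤ a}, fun _ _ h h' _ hx => h' (h hx)⟩, ?_⟩⟩
  · have : Finite F := hF
    exact Finite.of_injective (fun q : Q => (⟨q.1, hmemF q⟩ : F)) fun q q' h =>
      Subtype.ext (congrArg (fun t : F => t.1) h)
  · ext x
    exact ⟨fun h => hcmin x a (hsF ha) h, fun h => h (hcx x)⟩

end Definable

/-! ### Lifting definable maps along good maps -/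

section Lifting

variable {d : ℕ}

/-- A pair of points of a ranked poset such that the first may be merged into the second. -/
structure Collapsible (Q : RankedPoset.{u} d) (x g : Q) : Prop where
  ne : x ≠ g
  not_le : ¬ g ≤ x
  rk_le : Q.rk x ≤ Q.rk g
  lt_or : x < g ∨ Q.rk x = Q.rk g
  le_of_lt : ∀ z, x < z → g ≤ z
  lt_of_lt : ∀ z, g < z → x < z

/-- Choose p maximal among the points with several preimages. By the lifting property, everything
over a point strictly above p lies above the whole fibre of p, so the order above a fibre point is
unclear only within the fibre. -/
theorem GoodMap.exists_collapsible {P Q : RankedPoset.{u} d} [Finite Q] {π : Q → P} (hπ : GoodMap π)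
    (hinj : ¬ Function.Injective π) : ∃ x g : Q, π x = π g ∧ Collapsible Q x g := by
  have : Finite P := Finite.of_surjective π hπ.surj
  have hne : {p : P | ∃ x y : Q, x ≠ y ∧ π x = p ∧ π y = p}.Nonempty := by
    simp only [Function.Injective, not_forall] at hinj
    obtain ⟨x, y, h, hn⟩ := hinj
    exact ⟨π x, x, y, hn, rfl, h.symm⟩
  obtain ⟨p, ⟨x₀, y₀, hxy₀, hx₀, hy₀⟩, hmax⟩ := (Set.toFinite _).exists_maximal hne
  have above : ∀ y z : Q, π y = p → p < π z → y < z := by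
    intro y z hy hz
    obtain ⟨y', h1, h2, -⟩ := hπ.lift y (π z) (hy ▸ hz.le)
    have : y' = z := by
      by_contra hn
      exact not_le_of_gt hz (hmax ⟨y', z, hn, h2, rfl⟩ hz.le)
    subst this
    exact lt_of_le_of_ne h1 fun e => hz.ne (by rw [← hy, e])
  have fib : ∀ y z : Q, π y = p → y < z → π z = p ∨ p < π z := by
    intro y z hy hyz
    rcases (hπ.mono hyz.le).eq_or_lt with h | h
    · exact Or.inl (h.symm.trans hy)
    · exact Or.inr (hy ▸ h)
  have rkle : ∀ y : Q, π y = p → Q.rk y ≤ P.rk p := fun y hy => hy ▸ hπ.rk_le y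
  have topp : ∀ y : Q, π y = p → ∃ z, y ≤ z ∧ π z = p ∧ Q.rk z = P.rk p := fun y hy =>
    hπ.lift y p hy.le
  obtain ⟨g, -, hg, hgr⟩ := topp x₀ hx₀
  -- Two fibre points of full rank have the same points strictly above them, namely those over
  -- points strictly above p.
  by_cases hcase : ∃ x, x ≠ g ∧ π x = p ∧ Q.rk x = P.rk p
  · obtain ⟨x, hxg, hx, hxr⟩ := hcase
    have up : ∀ y z : Q, π y = p → Q.rk y = P.rk p → y < z → p < π z := fun y z hy hr hyz =>
      (fib y z hy hyz).resolve_left fun h => by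
        have := Q.rk_strict hyz; have := rkle z h; omega
    refine ⟨x, g, hx.trans hg.symm, hxg, fun h => hxg ?_, by omega, Or.inr (by omega), fun z hz => ?_,
      fun z hz => ?_⟩
    · exact (RankedPoset.eq_of_le_of_rk_le h (by omega)).symm
    · exact (above g z hg (up x z hx hxr hz)).le
    · exact above x z hx (up g z hg hgr hz)
  -- Now g is the only fibre point of full rank, so every other one lies below it; a maximal one
  -- among those has nothing in the fibre above it but g.
  · push Not at hcase
    have hne2 : {x : Q | π x = p ∧ x ≠ g}.Nonempty := by
      by_cases h : x₀ = g
      · exact ⟨y₀, hy₀, fun e => hxy₀ (h.trans e.symm)⟩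
      · exact ⟨x₀, hx₀, h⟩
    obtain ⟨x, ⟨hx, hxg⟩, hxmax⟩ := (Set.toFinite _).exists_maximal hne2
    have hlt : x < g := by
      obtain ⟨z, h1, h2, h3⟩ := topp x hx
      have : z = g := by
        by_contra hn
        exact hcase z hn h2 h3
      exact lt_of_le_of_ne (this ▸ h1) hxg
    refine ⟨x, g, hx.trans hg.symm, hxg, not_le_of_gt hlt, (Q.rk_strict hlt).le, Or.inl hlt,
      fun z hz => ?_, fun z hz => hlt.trans hz⟩
    rcases fib x z hx hz with h | h
    · by_cases hzg : z = g
      · exact hzg.ge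
      · exact absurd (hxmax ⟨h, hzg⟩ hz.le) (not_le_of_gt hz)
    · exact (above g z hg h).le

/-- The ranked poset obtained by merging `x` into `g`. -/
def collapse (Q : RankedPoset.{u} d) (x g : Q) (h : Collapsible Q x g) : RankedPoset.{u} d where
  carrier := {q : Q // q ≠ x}
  order :=
    -- What was below x is now below g and everything above g.
    { le := fun y z => y.1 ≤ z.1 ∨ (y.1 ≤ x ∧ g ≤ z.1)
      lt := fun y z => (y.1 ≤ z.1 ∨ (y.1 ≤ x ∧ g ≤ z.1)) ∧ ¬ (z.1 ≤ y.1 ∨ (z.1 ≤ x ∧ g ≤ y.1))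
      lt_iff_le_not_ge := fun _ _ => Iff.rfl
      le_refl := fun y => Or.inl le_rfl
      le_trans := by
        rintro y z t (h1 | ⟨h1, h2⟩) (h3 | ⟨h3, h4⟩)
        · exact Or.inl (h1.trans h3)
        · exact Or.inr ⟨h1.trans h3, h4⟩
        · exact Or.inr ⟨h1, h2.trans h3⟩
        · exact absurd (h2.trans h3) h.not_le
      le_antisymm := by
        rintro y z (h1 | ⟨h1, h2⟩) (h3 | ⟨h3, h4⟩)
        · exact Subtype.ext (le_antisymm h1 h3)
        · exact absurd (h4.trans (h1.trans h3)) h.not_le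
        · exact absurd (h2.trans (h3.trans h1)) h.not_le
        · exact absurd (h2.trans h3) h.not_le }
  rk q := Q.rk q.1
  rk_strict := by
    rintro y z ⟨h1 | ⟨h1, h2⟩, h3⟩
    · exact Q.rk_strict (lt_of_le_of_ne h1 fun e => h3 (Or.inl e.ge))
    · have := Q.rk_strict (lt_of_le_of_ne h1 y.2)
      have := RankedPoset.rk_mono h2
      have := h.rk_le
      change Q.rk y.1 < Q.rk z.1
      omega
  rk_le q := Q.rk_le q.1

theorem GoodMap.collapse {P Q : RankedPoset.{u} d} {π : Q → P} (hπ : GoodMap π) {x g : Q}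
    (hc : Collapsible Q x g) (hxg : π x = π g) :
    GoodMap (fun q : collapse Q x g hc => π q.1) where
  mono := by
    rintro y z (h | ⟨h1, h2⟩)
    · exact hπ.mono h
    · exact (hπ.mono h1).trans (hxg ▸ hπ.mono h2)
  surj p := by
    obtain ⟨q, rfl⟩ := hπ.surj p
    by_cases h : q = x
    · exact ⟨⟨g, hc.ne.symm⟩, by rw [h]; exact hxg.symm⟩
    · exact ⟨⟨q, h⟩, rfl⟩
  lift y p h := by
    obtain ⟨y', h1, h2, h3⟩ := hπ.lift y.1 p h
    -- If the lift is the removed point x, then g replaces it: the rank of x is already that of p,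
    -- and the rank of g lies between the two.
    by_cases hx : y' = x
    · subst hx
      refine ⟨⟨g, hc.ne.symm⟩, Or.inr ⟨h1, le_rfl⟩, hxg.symm.trans h2, ?_⟩
      have h4 : Q.rk g ≤ P.rk p := by rw [← h2, hxg]; exact hπ.rk_le g
      have := hc.rk_le
      exact le_antisymm h4 (h3 ▸ this)
    · exact ⟨⟨y', hx⟩, Or.inl h1, h2, h3⟩

/-! ### Undoing the merging of two points -/

variable {X : RankedPoset.{u} d} {N : Set X.Down}

theorem SuperSet.exists_pure_le (hN : SuperSet N) {p : ℕ} {a : X.Down} (ha : a ∈ N) (hp : Pure p a)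
    (h0 : a ≠ ⊥) {q : ℕ} (hq : q ≤ p) : ∃ c ∈ N, c ≤ a ∧ c ≠ ⊥ ∧ Pure q c := by
  induction p, hq using Nat.le_induction generalizing a with
  | base => exact ⟨a, ha, le_rfl, h0, hp⟩
  | succ p _ ih =>
    obtain ⟨c, h1, h2, h3, h4⟩ := hN.scal p a ha hp h0
    obtain ⟨b, h5, h6, h7⟩ := ih h1 h4 h3
    exact ⟨b, h5, h6.trans h2, h7⟩

theorem pure_finset_sup {ι : Type*} {k : ℕ} (s : Finset ι) (f : ι → X.Down) (h : ∀ i ∈ s, Pure k (f i)) :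
    Pure k (s.sup f) :=
  Finset.sup_induction (pure_bot k) (fun _ ha _ hb => ha.sup hb) h

/-- Catenarity encloses each component of h, of rank i < q, in a q-pure member below a; the join of
these contains h. A non-zero q-pure member from scaling is added in case h is empty. -/
theorem SuperSet.exists_pure_between (hN : SuperSet N) {p q : ℕ} {a h : X.Down} (ha : a ∈ N)
    (hp : Pure p a) (h0 : a ≠ ⊥) (hh : h ∈ N) (hha : h ≤ a) (hq : q ≤ p) (hlt : ∀ x ∈ h, X.rk x < q) :
    ∃ z ∈ N, Pure q z ∧ h ≤ z ∧ z ≤ a ∧ z ≠ ⊥ := by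
  obtain ⟨z₀, h1, h2, h3, h4⟩ := hN.exists_pure_le ha hp h0 hq
  have hb : ∀ i : ℕ, ∃ b ∈ N, i < q → (Pure q b ∧ X.comp i h ≤ b ∧ b ≤ a) := fun i => by
    by_cases hi : i < q
    · obtain ⟨b, h5, h6⟩ := hN.cat i q p hi.le hq _ (hN.comp i h hh) a ha ((comp_le i h).trans hha) hp
        (pure_comp i h)
      exact ⟨b, h5, fun _ => h6⟩
    · exact ⟨⊥, hN.bot, fun h => absurd h hi⟩
  choose b hbN hb using hb
  refine ⟨z₀ ⊔ (Finset.range q).sup b, hN.sup _ h1 _ (hN.finset_sup _ _ fun i _ => hbN i), ?_, ?_, ?_, ?_⟩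
  · exact h4.sup (pure_finset_sup _ _ fun i hi => (hb i (Finset.mem_range.1 hi)).1)
  · conv_lhs => rw [← sup_comp_eq_iff.2 hlt]
    refine le_sup_of_le_right (Finset.sup_le fun i hi => ?_)
    exact (hb i (Finset.mem_range.1 hi)).2.1.trans (Finset.le_sup hi)
  · exact sup_le h2 (Finset.sup_le fun i hi => (hb i (Finset.mem_range.1 hi)).2.2)
  · exact fun h => h3 (eq_bot_iff.2 (h ▸ le_sup_left))

/-- The lower sets needed to lift a definable map along the merging of `x` into `g`. -/
theorem SuperSet.exists_parts (hN : SuperSet N) {Q : RankedPoset.{u} d} [Finite Q] {x g : Q}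
    (hc : Collapsible Q x g) {ψ : X → collapse Q x g hc} (hψ : DefMap N ψ) :
    ∃ zx ∈ N, ∃ zg ∈ N, Pure (Q.rk x) zx ∧ Pure (Q.rk g) zg ∧ zx ≠ ⊥ ∧ zg ≠ ⊥ ∧
      (∀ t, (ψ t).1 < x → t ∈ zx) ∧ (∀ t, (ψ t).1 < g → t ∈ zg) ∧
      (∀ t ∈ zx, (ψ t).1 = g ∨ (ψ t).1 < x) ∧ (∀ t ∈ zg, (ψ t).1 = g ∨ (ψ t).1 < g) ∧
      (∀ t, (ψ t).1 = g → t ∈ zx ∨ t ∈ zg) ∧ (x < g → zx ≤ zg) ∧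
      (¬ x < g → ∀ t, (ψ t).1 = g → t ∈ zx → t ∉ zg) := by
  have : Finite (collapse Q x g hc) := inferInstanceAs (Finite {q : Q // q ≠ x})
  let g' : collapse Q x g hc := ⟨g, hc.ne.symm⟩
  -- In the quotient, below g are g itself, the points below g in Q and those below x in Q. The last
  -- two families are to be attached to different parts.
  let Sx : (collapse Q x g hc).Down := ⟨{y | y.1 < x}, by
    rintro z y (h | ⟨h, -⟩) hz
    · exact lt_of_le_of_lt h hz
    · exact lt_of_le_of_ne h y.2⟩
  let Sg : (collapse Q x g hc).Down := ⟨{y | y.1 < g}, by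
    rintro z y (h | ⟨-, h⟩) hz
    · exact lt_of_le_of_lt h hz
    · exact absurd h (not_le_of_gt hz)⟩
  let G : X.Down := pull hψ.mono (LowerSet.Iic g')
  let Lx : X.Down := pull hψ.mono Sx
  let Lg : X.Down := pull hψ.mono Sg
  have hG : G ∈ N := hψ.mem g'
  have hLx : Lx ∈ N := hψ.pull_mem hN.toIsClosedSet Sx
  have hLg : Lg ∈ N := hψ.pull_mem hN.toIsClosedSet Sg
  have hGp : Pure (Q.rk g) G := (pure_Iic g').pull hψ.toGoodMap
  have hrkx : ∀ t ∈ Lx, X.rk t < Q.rk x := fun t ht =>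
    (hψ.rk_le t).trans_lt (Q.rk_strict (show (ψ t).1 < x from ht))
  have hrkg : ∀ t ∈ Lg, X.rk t < Q.rk g := fun t ht =>
    (hψ.rk_le t).trans_lt (Q.rk_strict (show (ψ t).1 < g from ht))
  have hrkLx : ∀ t ∈ Lx, X.rk t < Q.rk g := fun t ht => (hrkx t ht).trans_le hc.rk_le
  have memG : ∀ t, t ∈ G ↔ (ψ t).1 = g ∨ t ∈ Lg ∨ t ∈ Lx := by
    intro t
    constructor
    · rintro (h | ⟨h, -⟩)
      · rcases h.eq_or_lt with h | h
        · exact Or.inl h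
        · exact Or.inr (Or.inl h)
      · exact Or.inr (Or.inr (lt_of_le_of_ne h (ψ t).2))
    · rintro (h | h | h)
      · exact Or.inl h.le
      · exact Or.inl (le_of_lt h)
      · exact Or.inr ⟨le_of_lt h, le_rfl⟩
  have hG0 : G ≠ ⊥ := by
    obtain ⟨t, ht⟩ := hψ.surj g'
    exact ne_bot_iff.2 ⟨t, (le_of_eq ht : ψ t ≤ g')⟩
  have hle : Lx ⊔ Lg ≤ G := by
    rintro t (h | h)
    · exact (memG t).2 (Or.inr (Or.inr h))
    · exact (memG t).2 (Or.inr (Or.inl h))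
  -- `G` is generated by points of rank `Q.rk g`, and all points of `Lx` and `Lg` have smaller rank.
  have hsd : G \ (Lx ⊔ Lg) = G := by
    refine le_antisymm sdiff_le fun t ht => ?_
    obtain ⟨y, h1, h2, h3⟩ := hGp t ht
    refine mem_sdiff_iff.2 ⟨y, ⟨h1, ?_⟩, h2⟩
    rintro (h | h)
    · exact (hrkLx y h).ne h3
    · exact (hrkg y h).ne h3
  obtain ⟨A, hA, B, hB, hA0, hB0, hxA, hgB, hAB, hBA, hinf⟩ :=
    hN.split Lx hLx Lg hLg G hG hle hsd hG0
  have hAp : Pure (Q.rk g) A := hAB ▸ hGp.sdiff B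
  have hBp : Pure (Q.rk g) B := hBA ▸ hGp.sdiff A
  have hAG : A ≤ G := hAB ▸ sdiff_le
  have hBG : B ≤ G := hBA ▸ sdiff_le
  have hinf' : ∀ t, t ∈ A → t ∈ B → t ∈ Lx ∧ t ∈ Lg := fun t h1 h2 => by
    have : t ∈ A ⊓ B := ⟨h1, h2⟩
    rw [hinf] at this
    exact this
  have hcover : ∀ t, (ψ t).1 = g → t ∈ A ∨ t ∈ B := fun t ht => by
    have h1 : G ≤ B ⊔ G \ B := le_sup_sdiff
    rw [← hAB] at h1
    exact (h1 ((memG t).2 (Or.inl ht))).symm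
  have hAsub : ∀ t ∈ A, (ψ t).1 = g ∨ (ψ t).1 < x := fun t ht => by
    rcases (memG t).1 (hAG ht) with h | h | h
    · exact Or.inl h
    · exact Or.inr (hinf' t ht (hgB h)).1
    · exact Or.inr h
  have hBsub : ∀ t ∈ B, (ψ t).1 = g ∨ (ψ t).1 < g := fun t ht => by
    rcases (memG t).1 (hBG ht) with h | h | h
    · exact Or.inl h
    · exact Or.inr h
    · exact Or.inr (hinf' t (hxA h) ht).2
  -- If x < g, the part over x must have dimension `Q.rk x` and lie inside the part over g: it is
  -- carved out of `A`, and all of `G` serves for g. Otherwise the ranks agree and the two halves of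
  -- the splitting are the parts.
  by_cases hlt : x < g
  · obtain ⟨z, hz, hzp, hLz, hzA, hz0⟩ := hN.exists_pure_between hA hAp hA0 hLx hxA hc.rk_le hrkx
    refine ⟨z, hz, G, hG, hzp, hGp, hz0, hG0, fun t ht => hLz ht, fun t ht => (memG t).2 (Or.inr (Or.inl ht)),
      fun t ht => hAsub t (hzA ht), fun t ht => ?_, fun t ht => Or.inr ((memG t).2 (Or.inl ht)),
      fun _ => hzA.trans hAG, fun h => absurd hlt h⟩
    rcases (memG t).1 ht with h | h | h
    · exact Or.inl h
    · exact Or.inr h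
    · exact Or.inr (lt_trans (show (ψ t).1 < x from h) hlt)
  · refine ⟨A, hA, B, hB, ?_, hBp, hA0, hB0, fun t ht => hxA ht, fun t ht => hgB ht, hAsub, hBsub, hcover,
      fun h => absurd h hlt, fun _ t ht hA hB => ?_⟩
    · rw [hc.lt_or.resolve_left hlt]; exact hAp
    · have h1 : (ψ t).1 < g := (hinf' t hA hB).2
      exact h1.ne ht

/-- Lifting a definable map along the merging of `x` into `g`. -/
theorem SuperSet.lift_collapse (hN : SuperSet N) {Q : RankedPoset.{u} d} [Finite Q] {x g : Q}
    (hc : Collapsible Q x g) {ψ : X → collapse Q x g hc} (hψ : DefMap N ψ) :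
    ∃ ψ' : X → Q, DefMap N ψ' ∧ ∀ t, ψ' t = (ψ t).1 ∨ (ψ' t = x ∧ (ψ t).1 = g) := by
  classical
  obtain ⟨zx, hzx, zg, hzg, hpx, hpg, hx0, hg0, h1, h2, h3, h4, h5, h6, h7⟩ := hN.exists_parts hc hψ
  let ψ' : X → Q := fun t => if (ψ t).1 = g ∧ t ∈ zx then x else (ψ t).1
  have hpos : ∀ t, (ψ t).1 = g → t ∈ zx → ψ' t = x := fun t h h' => if_pos ⟨h, h'⟩
  have hneg : ∀ t, ¬ ((ψ t).1 = g ∧ t ∈ zx) → ψ' t = (ψ t).1 := fun t h => if_neg h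
  -- The intended inverse images of the principal lower sets. Only those of x and g change, because
  -- any other point lies above x exactly when it lies above g.
  let D : Q → X.Down := fun q =>
    if hq : q = x then zx else if q = g then zg else pull hψ.mono (LowerSet.Iic (⟨q, hq⟩ : collapse Q x g hc))
  have hDx : D x = zx := dif_pos rfl
  have hDg : D g = zg := by simp only [D, dif_neg hc.ne.symm, if_true]
  have hDq : ∀ q (h : q ≠ x), q ≠ g → D q = pull hψ.mono (LowerSet.Iic (⟨q, h⟩ : collapse Q x g hc)) :=
    fun q h h' => by simp only [D, dif_neg h, if_neg h']
  have hmem : ∀ t q, t ∈ D q ↔ ψ' t ≤ q := by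
    intro t q
    by_cases hqx : q = x
    · subst hqx
      rw [hDx]
      constructor
      · intro ht
        rcases h3 t ht with h | h
        · rw [hpos t h ht]
        · rw [hneg t fun e => hc.not_le (e.1 ▸ h.le)]
          exact h.le
      · intro ht
        by_cases hcase : (ψ t).1 = g ∧ t ∈ zx
        · exact hcase.2
        · rw [hneg t hcase] at ht
          exact h1 t (lt_of_le_of_ne ht (ψ t).2)
    by_cases hqg : q = g
    · subst hqg
      rw [hDg]
      constructor
      · intro ht
        by_cases hcase : (ψ t).1 = q ∧ t ∈ zx
        · rw [hpos t hcase.1 hcase.2]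
          by_contra hn
          exact h7 (fun h => hn h.le) t hcase.1 hcase.2 ht
        · rw [hneg t hcase]
          rcases h4 t ht with h | h
          · exact h.le
          · exact h.le
      · intro ht
        by_cases hcase : (ψ t).1 = q ∧ t ∈ zx
        · rw [hpos t hcase.1 hcase.2] at ht
          exact h6 (lt_of_le_of_ne ht hc.ne) hcase.2
        · rw [hneg t hcase] at ht
          rcases ht.eq_or_lt with h | h
          · exact (h5 t h).resolve_left fun h' => hcase ⟨h, h'⟩
          · exact h2 t h
    rw [hDq q hqx hqg]
    constructor
    · intro ht
      by_cases hcase : (ψ t).1 = g ∧ t ∈ zx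
      · rw [hpos t hcase.1 hcase.2]
        have hgq : g ≤ q := by
          rcases ht with h | ⟨-, h⟩
          · rw [← hcase.1]; exact h
          · exact h
        exact (hc.lt_of_lt q (lt_of_le_of_ne hgq (Ne.symm hqg))).le
      · rw [hneg t hcase]
        rcases ht with h | ⟨h, hgq⟩
        · exact h
        · exact h.trans (hc.lt_of_lt q (lt_of_le_of_ne hgq (Ne.symm hqg))).le
    · intro ht
      by_cases hcase : (ψ t).1 = g ∧ t ∈ zx
      · rw [hpos t hcase.1 hcase.2] at ht
        refine Or.inl ?_
        rw [hcase.1]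
        exact hc.le_of_lt q (lt_of_le_of_ne ht (Ne.symm hqx))
      · rw [hneg t hcase] at ht
        exact Or.inl ht
  refine ⟨ψ', defMap_of_pure D hmem (fun q => ?_) (fun q => ?_) (fun q => ?_), fun t => ?_⟩
  · by_cases hqx : q = x
    · rw [hqx, hDx]; exact hpx
    by_cases hqg : q = g
    · rw [hqg, hDg]; exact hpg
    rw [hDq q hqx hqg]
    exact (pure_Iic (⟨q, hqx⟩ : collapse Q x g hc)).pull hψ.toGoodMap
  · by_cases hqx : q = x
    · rw [hqx, hDx]; exact hx0
    by_cases hqg : q = g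
    · rw [hqg, hDg]; exact hg0
    rw [hDq q hqx hqg]
    obtain ⟨t, ht⟩ := hψ.surj ⟨q, hqx⟩
    exact ne_bot_iff.2 ⟨t, (le_of_eq ht : ψ t ≤ _)⟩
  · by_cases hqx : q = x
    · rw [hqx, hDx]; exact hzx
    by_cases hqg : q = g
    · rw [hqg, hDg]; exact hzg
    rw [hDq q hqx hqg]
    exact hψ.mem _
  · by_cases hcase : (ψ t).1 = g ∧ t ∈ zx
    · exact Or.inr ⟨hpos t hcase.1 hcase.2, hcase.1⟩
    · exact Or.inl (hneg t hcase)

/-- Definable maps lift along good maps of finite ranked posets. -/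
theorem SuperSet.exists_lift (hN : SuperSet N) {P : RankedPoset.{u} d} {ψ : X → P} (hψ : DefMap N ψ)
    (n : ℕ) (Q : RankedPoset.{u} d) [Finite Q] (hn : Nat.card Q = n) {π : Q → P} (hπ : GoodMap π) :
    ∃ ψ' : X → Q, DefMap N ψ' ∧ ∀ t, π (ψ' t) = ψ t := by
  induction n generalizing Q with
  | zero =>
    obtain ⟨ψ', h⟩ : ∃ ψ' : X → Q, ∀ t, π (ψ' t) = ψ t :=
      ⟨fun t => (hπ.surj (ψ t)).choose, fun t => (hπ.surj (ψ t)).choose_spec⟩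
    have hQ : IsEmpty Q := (Nat.card_eq_zero.1 hn).resolve_right fun h => h.not_finite ‹_›
    exact ⟨ψ', defMap_of_pure (fun q => hQ.elim q) (fun _ q => hQ.elim q) (fun q => hQ.elim q)
      (fun q => hQ.elim q) (fun q => hQ.elim q), h⟩
  | succ n ih =>
    -- An injective good map is an isomorphism of ranked posets. Otherwise it factors through a
    -- merging of two points, which leaves one point fewer.
    by_cases hinj : Function.Injective π
    · let e := Equiv.ofBijective π ⟨hinj, hπ.surj⟩
      have he : ∀ p, π (e.symm p) = p := fun p => e.apply_symm_apply p
      have hle : ∀ q q' : Q, π q ≤ π q' → q ≤ q' ∧ Q.rk q' = P.rk (π q') := fun q q' h => by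
        obtain ⟨q'', h1, h2, h3⟩ := hπ.lift q _ h
        rw [hinj h2] at h1 h3
        exact ⟨h1, h3⟩
      refine ⟨fun t => e.symm (ψ t), defMap_of_pure (fun q => pull hψ.mono (LowerSet.Iic (π q)))
        (fun t q => ⟨fun h => ?_, fun h => ?_⟩) (fun q => ?_) (fun q => ?_) fun q => hψ.mem _, fun t => he _⟩
      · exact (hle _ _ ((he (ψ t)).trans_le h)).1
      · exact (he (ψ t)).ge.trans (hπ.mono h)
      · rw [(hle q q le_rfl).2]
        exact (pure_Iic (π q)).pull hψ.toGoodMap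
      · obtain ⟨t, ht⟩ := hψ.surj (π q)
        exact ne_bot_iff.2 ⟨t, (le_of_eq ht : ψ t ≤ _)⟩
    · obtain ⟨x, g, hxg, hc⟩ := hπ.exists_collapsible hinj
      have : Finite (collapse Q x g hc) := inferInstanceAs (Finite {q : Q // q ≠ x})
      have hcard : Nat.card (collapse Q x g hc) = n := by
        classical
        have := Fintype.ofFinite Q
        have h : Nat.card {q : Q // q ≠ x} = n := by
          rw [Nat.card_eq_fintype_card] at hn ⊢
          rw [Fintype.card_subtype_compl, Fintype.card_subtype_eq, hn]
          rfl
        exact h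
      obtain ⟨ψ₁, h1, h2⟩ := ih (collapse Q x g hc) hcard (hπ.collapse hc hxg)
      obtain ⟨ψ₂, h3, h4⟩ := hN.lift_collapse hc h1
      refine ⟨ψ₂, h3, fun t => ?_⟩
      rw [← h2 t]
      rcases h4 t with h | ⟨h, h'⟩
      · rw [h]
      · rw [h, hxg, ← h']

end Lifting

/-! ### Back and forth -/

section BackAndForth

variable {d : ℕ} {X : RankedPoset.{u} d} {Y : RankedPoset.{u} d}

theorem DefMap.weaken {N N' : Set X.Down} (h : N ⊆ N') {Q : RankedPoset.{v} d} {ψ : X → Q} (hψ : DefMap N ψ) :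
    DefMap N' ψ where
  toGoodMap := hψ.toGoodMap
  mem q := h (hψ.mem q)

/-- A definable map may be refined so that a given element comes from the target. -/
theorem DefMap.exists_refinement {N : Set X.Down} (hN : IsClosedSet N) {Q : RankedPoset.{u} d} [Finite Q]
    {ψ : X → Q} (hψ : DefMap N ψ) {b : X.Down} (hb : b ∈ N) :
    ∃ (R : RankedPoset.{u} d) (θ : X → R) (hθ : DefMap N θ) (π : R → Q), Finite R ∧ GoodMap π ∧
      (∀ t, π (θ t) = ψ t) ∧ ∃ S : R.Down, b = pull hθ.mono S := by
  -- Coding b together with all inverse images of principal lower sets forces ψ to factor through θ.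
  obtain ⟨R, θ, hθ, hR, hs⟩ := exists_defMap hN
    (insert b (Set.range fun q => pull hψ.mono (LowerSet.Iic q))) ((Set.finite_range _).insert b) (by
      rintro _ (rfl | ⟨q, rfl⟩)
      · exact hb
      · exact hψ.mem q)
  obtain ⟨S, hS⟩ := hs b (Set.mem_insert _ _)
  have hT : ∀ q, ∃ T : R.Down, ∀ t, ψ t ≤ q ↔ θ t ∈ T := fun q => by
    obtain ⟨T, hT⟩ := hs _ (Set.mem_insert_of_mem _ ⟨q, rfl⟩)
    exact ⟨T, fun t => SetLike.ext_iff.1 hT t⟩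
  choose T hT using hT
  have hmono : ∀ t t', θ t ≤ θ t' → ψ t ≤ ψ t' := fun t t' h =>
    (hT _ t).2 ((T _).lower h ((hT _ t').1 le_rfl))
  have heq : ∀ t t', θ t = θ t' → ψ t = ψ t' := fun t t' h =>
    le_antisymm (hmono t t' h.le) (hmono t' t h.ge)
  let σ : R → X := fun r => (hθ.surj r).choose
  have hσ : ∀ r, θ (σ r) = r := fun r => (hθ.surj r).choose_spec
  have hπ : ∀ t, ψ (σ (θ t)) = ψ t := fun t => heq _ _ (hσ _)
  refine ⟨R, θ, hθ, fun r => ψ (σ r), hR, ⟨fun r r' h => hmono _ _ (by rwa [hσ, hσ]), fun q => ?_,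
    fun r q h => ?_⟩, hπ, S, hS⟩
  · obtain ⟨t, rfl⟩ := hψ.surj q
    exact ⟨θ t, hπ t⟩
  · obtain ⟨t, h1, h2, h3⟩ := hψ.lift (σ r) q h
    -- This squeezes the rank of `θ t`: it is the rank of t', at least the rank `Q.rk q` of t, and
    -- at most `Q.rk q` since ψ t' = q.
    obtain ⟨t', h4, h5, h6⟩ := hθ.lift t (θ t) le_rfl
    have h7 : ψ t' = q := (heq _ _ h5).trans h2
    refine ⟨θ t, (hσ r).symm.le.trans (hθ.mono h1), (hπ t).trans h2, ?_⟩
    have h8 := hψ.rk_le t'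
    rw [h7] at h8
    have h9 := RankedPoset.rk_mono h4
    omega

/-- A definable map for one representation of a lattice yields one for any other representation. -/
theorem DefMap.exists_transfer {L : Type u} [CoheytingAlgebra L] {C : ℕ → L → L} {φ : L → X.Down}
    {θ : L → Y.Down} (hφ : IsEmb C X.comp φ) (hθ : IsEmb C Y.comp θ) {Q : RankedPoset.{u} d} [Finite Q]
    {ψ : X → Q} (hψ : DefMap (Set.range φ) ψ) :
    ∃ (ψ' : Y → Q) (hψ' : DefMap (Set.range θ) ψ'),
      ∀ a S, φ a = pull hψ.mono S → θ a = pull hψ'.mono S := by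
  classical
  have := Fintype.ofFinite Q
  -- The elements `m q` of L name the inverse images of the principal lower sets; relations among
  -- them hold in every representation of L.
  choose m hm using hψ.mem
  have hmem : ∀ t q, t ∈ φ (m q) ↔ ψ t ≤ q := fun t q => SetLike.ext_iff.1 (hm q) t
  have hsup : ∀ (a : L) (S : Q.Down), φ a = pull hψ.mono S →
      a = (Finset.univ.filter fun q => q ∈ S).sup m := by
    intro a S h
    apply hφ.inj
    rw [hφ.finset_sup, h]
    ext t
    rw [SetLike.mem_coe, SetLike.mem_coe, mem_finset_sup]
    constructor
    · exact fun ht => ⟨ψ t, Finset.mem_filter.2 ⟨Finset.mem_univ _, ht⟩, (hmem t _).2 le_rfl⟩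
    · rintro ⟨q, hq, ht⟩
      exact S.lower ((hmem t q).1 ht) (Finset.mem_filter.1 hq).2
  have memθ : ∀ (a : L) (S : Q.Down), φ a = pull hψ.mono S → ∀ t, t ∈ θ a ↔ ∃ q ∈ S, t ∈ θ (m q) := by
    intro a S h t
    rw [hsup a S h, hθ.finset_sup, mem_finset_sup]
    simp
  have hmono : ∀ q q', q ≤ q' → θ (m q) ≤ θ (m q') := fun q q' h => by
    rw [hθ.le_iff, ← hφ.le_iff]
    exact fun t ht => (hmem t q').2 (((hmem t q).1 ht).trans h)
  -- The meet of `m q` and `m q'` is the join of the `m p` with p below both. Hence a minimal q with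
  -- t in `θ (m q)` is the least one, and it is the image of t.
  have hleast : ∀ t : Y, ∃ q, ∀ q', t ∈ θ (m q') ↔ q ≤ q' := by
    intro t
    have hne : {q | t ∈ θ (m q)}.Nonempty := by
      obtain ⟨q, -, hq⟩ := (memθ ⊤ ⊤ hφ.top t).1 (by rw [hθ.top]; trivial)
      exact ⟨q, hq⟩
    obtain ⟨q, hq, hmin⟩ := (Set.toFinite {q | t ∈ θ (m q)}).exists_minimal hne
    refine ⟨q, fun q' => ⟨fun hq' => ?_, fun h => hmono q q' h hq⟩⟩
    have hinf : φ (m q ⊓ m q') = pull hψ.mono (LowerSet.Iic q ⊓ LowerSet.Iic q') := by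
      rw [hφ.inf, hm, hm]; rfl
    obtain ⟨p, hp, htp⟩ := (memθ _ _ hinf t).1 (by rw [hθ.inf]; exact ⟨hq, hq'⟩)
    have h1 : p ≤ q := hp.1
    have h2 : p ≤ q' := hp.2
    exact (hmin htp h1).trans h2
  choose ψ' hψ' using hleast
  refine ⟨ψ', defMap_of_pure (fun q => θ (m q)) hψ' (fun q => ?_) (fun q h => ?_) (fun q => ⟨_, rfl⟩), ?_⟩
  · rw [hθ.pure_iff, ← hφ.pure_iff, hm]
    exact (pure_Iic q).pull hψ.toGoodMap
  · rw [hθ.eq_bot_iff, ← hφ.eq_bot_iff] at h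
    obtain ⟨t, ht⟩ := hψ.surj q
    exact ne_bot_iff.2 ⟨t, (hmem t q).2 ht.le⟩ h
  · intro a S h
    ext t
    refine (memθ a S h t).trans ⟨?_, fun ht => ⟨ψ' t, ht, (hψ' t _).2 le_rfl⟩⟩
    rintro ⟨q, hq, ht⟩
    exact S.lower ((hψ' t q).1 ht) hq

end BackAndForth

/-! ### Structures for the language of subscaled lattices -/

section Structures

variable {I : Set ℕ}

/-- The interpretation of the function symbols. -/
def opMap {L : Type u} [CoheytingAlgebra L] (C : ℕ → L → L) : ∀ {n : ℕ}, Func I n → (Fin n → L) → L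
  | _, Func.zero, _ => ⊥
  | _, Func.one, _ => ⊤
  | _, Func.sup, x => x 0 ⊔ x 1
  | _, Func.inf, x => x 0 ⊓ x 1
  | _, Func.sdiff, x => x 0 \ x 1
  | _, Func.comp i, x => C i (x 0)

/-- The structure given by a co-Heyting algebra with operations `Cⁱ`. -/
abbrev algStructure (I : Set ℕ) {L : Type u} [CoheytingAlgebra L] (C : ℕ → L → L) : (lang I).Structure L where
  funMap := fun f x => opMap (I := I) C f x
  RelMap := fun r => Empty.elim r

theorem interprets_algStructure {L : Type u} [CoheytingAlgebra L] (C : ℕ → L → L) :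
    letI := algStructure I C
    Interprets L (fun i : I => C i) :=
  letI := algStructure I C
  { zero := rfl
    one := rfl
    sup := fun _ _ => rfl
    inf := fun _ _ => rfl
    sdiff := fun _ _ => rfl
    comp := fun _ _ => rfl }

theorem Interprets.funMap_eq {M : Type u} [(lang I).Structure M] [CoheytingAlgebra M] {C : ℕ → M → M}
    (h : Interprets M fun i : I => C i) {n : ℕ} (f : Func I n) (x : Fin n → M) :
    FirstOrder.Language.Structure.funMap (L := lang I) f x = opMap C f x := by
  have h0 : ∀ x : Fin 0 → M, x = ![] := fun x => Subsingleton.elim _ _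
  have h1 : ∀ x : Fin 1 → M, x = ![x 0] := fun x => funext fun i => by fin_cases i; rfl
  have h2 : ∀ x : Fin 2 → M, x = ![x 0, x 1] := fun x => funext fun i => by fin_cases i <;> rfl
  cases f with
  | zero => rw [h0 x]; exact h.zero
  | one => rw [h0 x]; exact h.one
  | sup => rw [h2 x]; exact h.sup _ _
  | inf => rw [h2 x]; exact h.inf _ _
  | sdiff => rw [h2 x]; exact h.sdiff _ _
  | comp i => rw [h1 x]; exact h.comp _ _

theorem IsEmb.map_opMap {L : Type u} {L' : Type v} [CoheytingAlgebra L] [CoheytingAlgebra L']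
    {C : ℕ → L → L} {C' : ℕ → L' → L'} {f : L → L'} (h : IsEmb C C' f) {n : ℕ} (g : Func I n)
    (x : Fin n → L) : f (opMap C g x) = opMap C' g (f ∘ x) := by
  cases g with
  | zero => exact h.bot
  | one => exact h.top
  | sup => exact h.sup _ _
  | inf => exact h.inf _ _
  | sdiff => exact h.sdiff _ _
  | comp i => exact h.comp _ _

theorem IsEmb.realize_term {M : Type u} [(lang I).Structure M] [CoheytingAlgebra M] {C : ℕ → M → M}
    (h : Interprets M fun i : I => C i) {L : Type v} [CoheytingAlgebra L] {C' : ℕ → L → L} {f : M → L}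
    (hf : IsEmb C C' f) {α : Type w} (t : (lang I).Term α) (x : α → M) :
    letI := algStructure I C'
    f (t.realize x) = t.realize (f ∘ x) := by
  let _ := algStructure I C'
  induction t with
  | var i => rfl
  | func g ts ih =>
    exact ((congrArg f (h.funMap_eq g _)).trans (hf.map_opMap g _)).trans
      (congrArg (opMap C' g) (funext ih))

/-- Embeddings of structures are embeddings of subscaled lattices. -/
theorem Interprets.isEmb {d : ℕ} (hI : Set.Iic d ⊆ I) {M N : Type u} [(lang I).Structure M]
    [(lang I).Structure N] [CoheytingAlgebra M] [CoheytingAlgebra N] {C : ℕ → M → M} {C' : ℕ → N → N}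
    (h : Interprets M fun i : I => C i) (h' : Interprets N fun i : I => C' i) (hl : Laws d C)
    (hl' : Laws d C') (f : M ↪[lang I] N) : IsEmb C C' f := by
  have key : ∀ {n} (g : Func I n) (x : Fin n → M), f (opMap C g x) = opMap C' g (f ∘ x) := by
    intro n g x
    rw [← h.funMap_eq, ← h'.funMap_eq]
    exact f.map_fun g x
  refine ⟨f.injective, key Func.zero ![], key Func.one ![], fun a b => key Func.sup ![a, b],
    fun a b => key Func.inf ![a, b], fun a b => key Func.sdiff ![a, b], fun k a => ?_⟩
  by_cases hk : k ∈ I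
  · exact key (Func.comp ⟨k, hk⟩) ![a]
  · have hk' : d < k := not_le.1 fun h => hk (hI h)
    rw [hl.comp_eq_bot k a hk', hl'.comp_eq_bot k _ hk']
    exact key Func.zero ![]

/-- Embeddings of subscaled lattices are embeddings of structures. -/
def IsEmb.toEmbedding {M N : Type u} [(lang I).Structure M] [(lang I).Structure N] [CoheytingAlgebra M]
    [CoheytingAlgebra N] {C : ℕ → M → M} {C' : ℕ → N → N} (h : Interprets M fun i : I => C i)
    (h' : Interprets N fun i : I => C' i) {f : M → N} (hf : IsEmb C C' f) : M ↪[lang I] N where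
  toFun := f
  inj' := hf.inj
  map_fun' g x := by
    exact ((congrArg f (h.funMap_eq g x)).trans (hf.map_opMap g x)).trans (h'.funMap_eq g (f ∘ x)).symm
  map_rel' r := Empty.elim r

end Structures

/-! ### Elementary equivalence -/

section Equivalence

variable {I : Set ℕ} {d : ℕ}

/-- Tuples that come from the same lower sets of a finite ranked poset. -/
def Similar {X₁ X₂ : RankedPoset.{u} d} {N₁ N₂ : Type u} (φ₁ : N₁ → X₁.Down) (φ₂ : N₂ → X₂.Down)
    {α : Type} (v : α → N₁) (w : α → N₂) : Prop :=
  ∃ (Q : RankedPoset.{u} d) (ψ₁ : X₁ → Q) (h₁ : DefMap (Set.range φ₁) ψ₁) (ψ₂ : X₂ → Q)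
    (h₂ : DefMap (Set.range φ₂) ψ₂) (S : α → Q.Down), Finite Q ∧
    (∀ i, φ₁ (v i) = pull h₁.mono (S i)) ∧ ∀ i, φ₂ (w i) = pull h₂.mono (S i)

theorem Similar.symm {X₁ X₂ : RankedPoset.{u} d} {N₁ N₂ : Type u} {φ₁ : N₁ → X₁.Down}
    {φ₂ : N₂ → X₂.Down} {α : Type} {v : α → N₁} {w : α → N₂} (h : Similar φ₁ φ₂ v w) :
    Similar φ₂ φ₁ w v := by
  obtain ⟨Q, ψ₁, h₁, ψ₂, h₂, S, hQ, hv, hw⟩ := h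
  exact ⟨Q, ψ₂, h₂, ψ₁, h₁, S, hQ, hw, hv⟩

/-- The forth step: refine the first definable map until it codes a, then lift the second one along
the resulting good map of finite posets. Only the side that receives the lift has to be super
scaled. -/
theorem Similar.extend {X₁ X₂ : RankedPoset.{u} d} {N₁ N₂ : Type u} {φ₁ : N₁ → X₁.Down}
    {φ₂ : N₂ → X₂.Down} (hc : IsClosedSet (Set.range φ₁)) (hs : SuperSet (Set.range φ₂)) {α : Type}
    {n : ℕ} {v : α → N₁} {x : Fin n → N₁} {w : α → N₂} {y : Fin n → N₂}
    (h : Similar φ₁ φ₂ (Sum.elim v x) (Sum.elim w y)) (a : N₁) :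
    ∃ b, Similar φ₁ φ₂ (Sum.elim v (Fin.snoc x a)) (Sum.elim w (Fin.snoc y b)) := by
  obtain ⟨Q, ψ₁, h₁, ψ₂, h₂, S, hQ, hv, hw⟩ := h
  obtain ⟨R, θ₁, hθ₁, π, hR, hπ, hcomp, T, hT⟩ := h₁.exists_refinement hc ⟨a, rfl⟩
  obtain ⟨θ₂, hθ₂, hcomp₂⟩ := hs.exists_lift h₂ _ R rfl hπ
  obtain ⟨b, hb⟩ := hθ₂.pull_mem hs.toIsClosedSet T
  refine ⟨b, R, θ₁, hθ₁, θ₂, hθ₂, Sum.elim (fun i => pull hπ.mono (S (Sum.inl i)))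
    (Fin.snoc (fun i => pull hπ.mono (S (Sum.inr i))) T), hR, ?_, ?_⟩
  · have key : ∀ S : Q.Down, pull h₁.mono S = pull hθ₁.mono (pull hπ.mono S) := fun S => by
      ext t; change ψ₁ t ∈ S ↔ π (θ₁ t) ∈ S; rw [hcomp]
    rintro (i | i)
    · exact (hv (Sum.inl i)).trans (key _)
    · refine Fin.lastCases ?_ (fun i => ?_) i
      · simp only [Sum.elim_inr, Fin.snoc_last]; exact hT
      · simp only [Sum.elim_inr, Fin.snoc_castSucc]; exact (hv (Sum.inr i)).trans (key _)
  · have key : ∀ S : Q.Down, pull h₂.mono S = pull hθ₂.mono (pull hπ.mono S) := fun S => by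
      ext t; change ψ₂ t ∈ S ↔ π (θ₂ t) ∈ S; rw [hcomp₂]
    rintro (i | i)
    · exact (hw (Sum.inl i)).trans (key _)
    · refine Fin.lastCases ?_ (fun i => ?_) i
      · simp only [Sum.elim_inr, Fin.snoc_last]; exact hb
      · simp only [Sum.elim_inr, Fin.snoc_castSucc]; exact (hw (Sum.inr i)).trans (key _)

variable {N₁ N₂ : Type u} [(lang I).Structure N₁] [(lang I).Structure N₂] [CoheytingAlgebra N₁]
  [CoheytingAlgebra N₂] {C₁ : ℕ → N₁ → N₁} {C₂ : ℕ → N₂ → N₂} {X₁ X₂ : RankedPoset.{u} d}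
  {φ₁ : N₁ → X₁.Down} {φ₂ : N₂ → X₂.Down}

/-- Both tuples are images of the same tuple of lower sets of the finite poset under embeddings, so
an equality of terms can be tested there. -/
theorem Similar.realize_term_eq (hi₁ : Interprets N₁ fun i : I => C₁ i) (hi₂ : Interprets N₂ fun i : I => C₂ i)
    (he₁ : IsEmb C₁ X₁.comp φ₁) (he₂ : IsEmb C₂ X₂.comp φ₂) {α : Type} {v : α → N₁} {w : α → N₂}
    (h : Similar φ₁ φ₂ v w) (t s : (lang I).Term α) (hts : t.realize v = s.realize v) :
    t.realize w = s.realize w := by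
  obtain ⟨Q, ψ₁, h₁, ψ₂, h₂, S, -, hv, hw⟩ := h
  let _ : (lang I).Structure Q.Down := algStructure I Q.comp
  let _ : (lang I).Structure X₁.Down := algStructure I X₁.comp
  let _ : (lang I).Structure X₂.Down := algStructure I X₂.comp
  have hQ : Interprets Q.Down fun i : I => Q.comp i := interprets_algStructure Q.comp
  have k₁ : ∀ t : (lang I).Term α, φ₁ (t.realize v) = pull h₁.mono (t.realize S) := fun t => by
    rw [he₁.realize_term hi₁, h₁.isEmb.realize_term hQ]
    exact congrArg t.realize (funext hv)
  have k₂ : ∀ t : (lang I).Term α, φ₂ (t.realize w) = pull h₂.mono (t.realize S) := fun t => by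
    rw [he₂.realize_term hi₂, h₂.isEmb.realize_term hQ]
    exact congrArg t.realize (funext hw)
  apply he₂.inj
  rw [k₂, k₂]
  congr 1
  apply h₁.isEmb.inj
  rw [← k₁, ← k₁, hts]

/-- Similar tuples form a back-and-forth system: `Similar.extend`, used in both directions, handles
the quantifier. -/
theorem Similar.realize_iff (hi₁ : Interprets N₁ fun i : I => C₁ i) (hi₂ : Interprets N₂ fun i : I => C₂ i)
    (he₁ : IsEmb C₁ X₁.comp φ₁) (he₂ : IsEmb C₂ X₂.comp φ₂) (hs₁ : SuperLaws C₁) (hs₂ : SuperLaws C₂)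
    {α : Type} {n : ℕ} (φ : (lang I).BoundedFormula α n) {v : α → N₁} {x : Fin n → N₁} {w : α → N₂}
    {y : Fin n → N₂} (h : Similar φ₁ φ₂ (Sum.elim v x) (Sum.elim w y)) :
    φ.Realize v x ↔ φ.Realize w y := by
  induction φ with
  | falsum => exact Iff.rfl
  | equal t s =>
    exact ⟨h.realize_term_eq hi₁ hi₂ he₁ he₂ t s, h.symm.realize_term_eq hi₂ hi₁ he₂ he₁ t s⟩
  | rel r => exact Empty.elim r
  | imp _ _ ih₁ ih₂ =>
    rw [Language.BoundedFormula.realize_imp, Language.BoundedFormula.realize_imp, ih₁ h, ih₂ h]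
  | all _ ih =>
    rw [Language.BoundedFormula.realize_all, Language.BoundedFormula.realize_all]
    constructor
    · intro hall b
      obtain ⟨a, ha⟩ := h.symm.extend he₂.isClosedSet (he₁.superSet hs₁) b
      exact (ih ha.symm).1 (hall a)
    · intro hall a
      obtain ⟨b, hb⟩ := h.extend he₁.isClosedSet (he₂.superSet hs₂) a
      exact (ih hb).2 (hall b)

end Equivalence

/-! ### The classes of structures -/

section Classes

variable {I : Set ℕ} {d : ℕ}

/-- The structures given by subscaled lattices of sc-dimension at most `d`. -/
def HasLaws (I : Set ℕ) (d : ℕ) : StructClass.{u} (lang I) := fun M _ =>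
  ∃ (_ : CoheytingAlgebra M) (C : ℕ → M → M), Interprets M (fun i : I => C i) ∧ Laws d C

/-- The structures given by super scaled lattices of sc-dimension at most `d`. -/
def HasSuperLaws (I : Set ℕ) (d : ℕ) : StructClass.{u} (lang I) := fun M _ =>
  ∃ (_ : CoheytingAlgebra M) (C : ℕ → M → M), Interprets M (fun i : I => C i) ∧ Laws d C ∧ SuperLaws C

theorem HasSuperLaws.hasLaws {M : Type u} [(lang I).Structure M] (h : HasSuperLaws I d M) : HasLaws I d M := by
  obtain ⟨i, C, h1, h2, -⟩ := h
  exact ⟨i, C, h1, h2⟩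

theorem HasLaws.exists_embedding {M : Type u} [(lang I).Structure M] (h : HasLaws I d M) :
    ∃ (N : Type u) (_ : (lang I).Structure N), HasSuperLaws I d N ∧ Nonempty (M ↪[lang I] N) := by
  obtain ⟨_, C, hi, hl⟩ := h
  obtain ⟨N, _, C', f, hf, hl', hs⟩ := hl.exists_super
  let _ := algStructure I C'
  exact ⟨N, algStructure I C', ⟨_, C', interprets_algStructure C', hl', hs⟩,
    ⟨hf.toEmbedding hi (interprets_algStructure C')⟩⟩

/-- A tuple of M is coded by one finite poset over the spectrum of M, and this coding transfers to
the spectra of both extensions. The two images are therefore similar. -/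
theorem HasLaws.realize_iff (hI : Set.Iic d ⊆ I) {M N₁ N₂ : Type u} [(lang I).Structure M]
    [(lang I).Structure N₁] [(lang I).Structure N₂] (h : HasLaws I d M) (h₁ : HasSuperLaws I d N₁)
    (h₂ : HasSuperLaws I d N₂) (f₁ : M ↪[lang I] N₁) (f₂ : M ↪[lang I] N₂) (n : ℕ)
    (φ : (lang I).Formula (Fin n)) (v : Fin n → M) : φ.Realize (f₁ ∘ v) ↔ φ.Realize (f₂ ∘ v) := by
  obtain ⟨_, C, hi, hl⟩ := h
  obtain ⟨_, C₁, hi₁, hl₁, hs₁⟩ := h₁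
  obtain ⟨_, C₂, hi₂, hl₂, hs₂⟩ := h₂
  have hf₁ := hi.isEmb hI hi₁ hl hl₁ f₁
  have hf₂ := hi.isEmb hI hi₂ hl hl₂ f₂
  have he := hl.isEmb_specMap
  have he₁ := hl₁.isEmb_specMap
  have he₂ := hl₂.isEmb_specMap
  obtain ⟨Q, ψ, hψ, hQ, hS⟩ := exists_defMap he.isClosedSet (Set.range fun i => hl.specMap (v i))
    (Set.finite_range _) (by rintro _ ⟨i, rfl⟩; exact ⟨v i, rfl⟩)
  obtain ⟨ψ₁, hψ₁, k₁⟩ := hψ.exists_transfer he (he₁.trans hf₁)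
  obtain ⟨ψ₂, hψ₂, k₂⟩ := hψ.exists_transfer he (he₂.trans hf₂)
  have hS' : ∀ i, ∃ S : Q.Down, hl.specMap (v i) = pull hψ.mono S := fun i => hS _ ⟨i, rfl⟩
  choose S hS' using hS'
  refine Similar.realize_iff hi₁ hi₂ he₁ he₂ hs₁ hs₂ φ ⟨Q, ψ₁, hψ₁.weaken (Set.range_comp_subset_range _ _),
    ψ₂, hψ₂.weaken (Set.range_comp_subset_range _ _), Sum.elim S (fun i => i.elim0), hQ, ?_, ?_⟩
  · rintro (i | i)
    · exact k₁ _ _ (hS' i)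
    · exact i.elim0
  · rintro (i | i)
    · exact k₂ _ _ (hS' i)
    · exact i.elim0

end Classes

/-! ### First-order axioms -/

section Axioms
open FirstOrder.Language

variable {I : Set ℕ} {α : Type}

/-- The term `0`. -/
def tBot : (lang I).Term α := Term.func (L := lang I) Func.zero ![]

/-- The term `1`. -/
def tTop : (lang I).Term α := Term.func (L := lang I) Func.one ![]

/-- The term `t ∨ s`. -/
def tSup (t s : (lang I).Term α) : (lang I).Term α := Term.func (L := lang I) Func.sup ![t, s]

/-- The term `t ∧ s`. -/
def tInf (t s : (lang I).Term α) : (lang I).Term α := Term.func (L := lang I) Func.inf ![t, s]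

/-- The term `t - s`. -/
def tSdiff (t s : (lang I).Term α) : (lang I).Term α := Term.func (L := lang I) Func.sdiff ![t, s]

open Classical in
/-- The term `Cᵏ t`, or `0` when `Cᵏ` is not in the language. -/
noncomputable def tComp (k : ℕ) (t : (lang I).Term α) : (lang I).Term α :=
  if h : k ∈ I then Term.func (L := lang I) (Func.comp ⟨k, h⟩) ![t] else tBot

/-- The term `⋁_{i < k} Cⁱ t`. -/
noncomputable def tComps (t : (lang I).Term α) : ℕ → (lang I).Term α
  | 0 => tBot
  | k + 1 => tSup (tComp k t) (tComps t k)

section Ops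

variable (I) {M : Type u} [(lang I).Structure M]

/-- The element `0` of a structure. -/
def oBot : M := Structure.funMap (L := lang I) Func.zero ![]

/-- The element `1` of a structure. -/
def oTop : M := Structure.funMap (L := lang I) Func.one ![]

/-- The operation `∨` of a structure. -/
def oSup (a b : M) : M := Structure.funMap (L := lang I) Func.sup ![a, b]

/-- The operation `∧` of a structure. -/
def oInf (a b : M) : M := Structure.funMap (L := lang I) Func.inf ![a, b]

/-- The operation `-` of a structure. -/
def oSdiff (a b : M) : M := Structure.funMap (L := lang I) Func.sdiff ![a, b]

open Classical in
/-- The operation `Cᵏ` of a structure, or `0` when `Cᵏ` is not in the language. -/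
noncomputable def oComp (k : ℕ) (a : M) : M :=
  if h : k ∈ I then Structure.funMap (L := lang I) (Func.comp ⟨k, h⟩) ![a] else oBot I

/-- The element `⋁_{i < k} Cⁱ a` of a structure. -/
noncomputable def oComps (a : M) : ℕ → M
  | 0 => oBot I
  | k + 1 => oSup I (oComp I k a) (oComps a k)

variable {I} (v : α → M)

theorem realize_tBot : (tBot : (lang I).Term α).realize v = oBot I := by
  exact congrArg (Structure.funMap (L := lang I) Func.zero) (Subsingleton.elim _ _)

theorem realize_tTop : (tTop : (lang I).Term α).realize v = oTop I := by
  exact congrArg (Structure.funMap (L := lang I) Func.one) (Subsingleton.elim _ _)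

theorem realize_tSup (t s : (lang I).Term α) : (tSup t s).realize v = oSup I (t.realize v) (s.realize v) := by
  refine congrArg (Structure.funMap (L := lang I) Func.sup) (funext fun i => ?_)
  fin_cases i <;> rfl

theorem realize_tInf (t s : (lang I).Term α) : (tInf t s).realize v = oInf I (t.realize v) (s.realize v) := by
  refine congrArg (Structure.funMap (L := lang I) Func.inf) (funext fun i => ?_)
  fin_cases i <;> rfl

theorem realize_tSdiff (t s : (lang I).Term α) :
    (tSdiff t s).realize v = oSdiff I (t.realize v) (s.realize v) := by
  refine congrArg (Structure.funMap (L := lang I) Func.sdiff) (funext fun i => ?_)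
  fin_cases i <;> rfl

theorem realize_tComp (k : ℕ) (t : (lang I).Term α) : (tComp k t).realize v = oComp I k (t.realize v) := by
  unfold tComp oComp
  split_ifs with h
  · refine congrArg (Structure.funMap (L := lang I) (Func.comp ⟨k, h⟩)) (funext fun i => ?_)
    fin_cases i; rfl
  · exact realize_tBot v

theorem realize_tComps (k : ℕ) (t : (lang I).Term α) : (tComps t k).realize v = oComps I (t.realize v) k := by
  induction k with
  | zero => exact realize_tBot v
  | succ k ih => rw [tComps, realize_tSup, realize_tComp, ih, oComps]

end Ops

/-- Names for the axioms of subscaled lattices. -/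
inductive SubAxiom : Type
  | supComm | supAssoc | infComm | infAssoc | supInf | infSup | botSup | supTop | sdiff
  | compBot (k : ℕ) | supComp | compComp (k : ℕ) | compSupBot (k l : ℕ) | compSup (k : ℕ)
  | compInf (i j : ℕ) | compSdiff (k : ℕ) | muchBelow (k : ℕ)

/-- The axioms of subscaled lattices as sentences. -/
noncomputable def SubAxiom.sentence (I : Set ℕ) (d : ℕ) : SubAxiom → (lang I).Sentence
  | supComm => ∀' ∀' (tSup (&0) (&1) =' tSup (&1) (&0))
  | supAssoc => ∀' ∀' ∀' (tSup (tSup (&0) (&1)) (&2) =' tSup (&0) (tSup (&1) (&2)))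
  | infComm => ∀' ∀' (tInf (&0) (&1) =' tInf (&1) (&0))
  | infAssoc => ∀' ∀' ∀' (tInf (tInf (&0) (&1)) (&2) =' tInf (&0) (tInf (&1) (&2)))
  | supInf => ∀' ∀' (tSup (&0) (tInf (&0) (&1)) =' &0)
  | infSup => ∀' ∀' (tInf (&0) (tSup (&0) (&1)) =' &0)
  | botSup => ∀' (tSup tBot (&0) =' &0)
  | supTop => ∀' (tSup (&0) tTop =' tTop)
  | sdiff => ∀' ∀' ∀' ((tSup (tSdiff (&0) (&1)) (&2) =' &2) ⇔
      (tSup (&0) (tSup (&1) (&2)) =' tSup (&1) (&2)))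
  | compBot k => if d < k then ∀' (tComp k (&0) =' tBot) else ⊤
  | supComp => ∀' (tComps (&0) (d + 1) =' &0)
  | compComp k => ∀' (tComp k (tComp k (&0)) =' tComp k (&0))
  | compSupBot k l => if k ≤ l then ∀' (tComp l (tComps (&0) k) =' tBot) else ⊤
  | compSup k => ∀' ∀' ((tComps (&0) (k + 1) =' &0) ⟹ ((tComps (&1) (k + 1) =' &1) ⟹
      (tComp k (tSup (&0) (&1)) =' tSup (tComp k (&0)) (tComp k (&1)))))
  | compInf i j => if i ≠ j then ∀' (tComps (tInf (tComp i (&0)) (tComp j (&0))) (min i j) ='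
      tInf (tComp i (&0)) (tComp j (&0))) else ⊤
  | compSdiff k => ∀' ∀' ((tComps (&1) (k + 1) =' &1) ⟹
      (tSdiff (tComp k (&0)) (&1) =' tSdiff (tComp k (&0)) (tComp k (&1))))
  | muchBelow k => ∀' ∀' ((tSup (&1) (&0) =' &0) ⟹ ((tSdiff (&0) (&1) =' &0) ⟹
      (∼(&0 =' tBot) ⟹ ((tComps (&0) (k + 1) =' &0) ⟹ (tComps (&1) k =' &1)))))

/-- The meaning of the axioms of subscaled lattices. -/
def SubAxiom.meaning (I : Set ℕ) (d : ℕ) (M : Type u) [(lang I).Structure M] : SubAxiom → Prop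
  | supComm => ∀ a b : M, oSup I a b = oSup I b a
  | supAssoc => ∀ a b c : M, oSup I (oSup I a b) c = oSup I a (oSup I b c)
  | infComm => ∀ a b : M, oInf I a b = oInf I b a
  | infAssoc => ∀ a b c : M, oInf I (oInf I a b) c = oInf I a (oInf I b c)
  | supInf => ∀ a b : M, oSup I a (oInf I a b) = a
  | infSup => ∀ a b : M, oInf I a (oSup I a b) = a
  | botSup => ∀ a : M, oSup I (oBot I) a = a
  | supTop => ∀ a : M, oSup I a (oTop I) = oTop I
  | sdiff => ∀ a b c : M, oSup I (oSdiff I a b) c = c ↔ oSup I a (oSup I b c) = oSup I b c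
  | compBot k => d < k → ∀ a : M, oComp I k a = oBot I
  | supComp => ∀ a : M, oComps I a (d + 1) = a
  | compComp k => ∀ a : M, oComp I k (oComp I k a) = oComp I k a
  | compSupBot k l => k ≤ l → ∀ a : M, oComp I l (oComps I a k) = oBot I
  | compSup k => ∀ a b : M, oComps I a (k + 1) = a → oComps I b (k + 1) = b →
      oComp I k (oSup I a b) = oSup I (oComp I k a) (oComp I k b)
  | compInf i j => i ≠ j → ∀ a : M, oComps I (oInf I (oComp I i a) (oComp I j a)) (min i j) =
      oInf I (oComp I i a) (oComp I j a)
  | compSdiff k => ∀ a b : M, oComps I b (k + 1) = b →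
      oSdiff I (oComp I k a) b = oSdiff I (oComp I k a) (oComp I k b)
  | muchBelow k => ∀ a b : M, oSup I b a = a → oSdiff I a b = a → a ≠ oBot I →
      oComps I a (k + 1) = a → oComps I b k = b

theorem SubAxiom.realize_sentence (I : Set ℕ) (d : ℕ) (M : Type u) [(lang I).Structure M] (a : SubAxiom) :
    M ⊨ a.sentence I d ↔ a.meaning I d M := by
  cases a with
  | compBot k =>
    by_cases h : d < k <;>
    simp [SubAxiom.sentence, SubAxiom.meaning, h, Sentence.Realize, Formula.Realize, Fin.snoc, realize_tBot,
      realize_tComp]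
  | compSupBot k l =>
    by_cases h : k ≤ l <;>
    simp [SubAxiom.sentence, SubAxiom.meaning, h, Sentence.Realize, Formula.Realize, Fin.snoc, realize_tBot,
      realize_tComp, realize_tComps]
  | compInf i j =>
    by_cases h : i = j <;>
    simp [SubAxiom.sentence, SubAxiom.meaning, h, Sentence.Realize, Formula.Realize, Fin.snoc, realize_tInf,
      realize_tComp, realize_tComps]
  | _ =>
    simp [SubAxiom.sentence, SubAxiom.meaning, Sentence.Realize, Formula.Realize, Fin.snoc, realize_tBot,
      realize_tTop, realize_tSup, realize_tInf, realize_tSdiff, realize_tComp, realize_tComps]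

/-- Names for the additional axioms of super scaled lattices. -/
inductive SuperAxiom : Type
  | scal (k : ℕ) | cat (r q p : ℕ) | split

/-- The additional axioms of super scaled lattices as sentences. -/
noncomputable def SuperAxiom.sentence (I : Set ℕ) : SuperAxiom → (lang I).Sentence
  | scal k => ∀' ((tComp (k + 1) (&0) =' &0) ⟹ (∼(&0 =' tBot) ⟹
      ∃' ((tSup (&1) (&0) =' &0) ⊓ (∼(&1 =' tBot) ⊓ (tComp k (&1) =' &1)))))
  | cat r q p => if r ≤ q ∧ q ≤ p then ∀' ∀' ((tSup (&0) (&1) =' &1) ⟹ ((tComp p (&1) =' &1) ⟹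
      ((tComp r (&0) =' &0) ⟹
        ∃' ((tComp q (&2) =' &2) ⊓ ((tSup (&0) (&2) =' &2) ⊓ (tSup (&2) (&1) =' &1)))))) else ⊤
  | split => ∀' ∀' ∀' ((tSup (tSup (&0) (&1)) (&2) =' &2) ⟹
      ((tSdiff (&2) (tSup (&0) (&1)) =' &2) ⟹ (∼(&2 =' tBot) ⟹
        ∃' ∃' (∼(&3 =' tBot) ⊓ (∼(&4 =' tBot) ⊓ ((tSup (&0) (&3) =' &3) ⊓ ((tSup (&1) (&4) =' &4) ⊓
          ((&3 =' tSdiff (&2) (&4)) ⊓ ((&4 =' tSdiff (&2) (&3)) ⊓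
            (tInf (&3) (&4) =' tInf (&0) (&1)))))))))))

/-- The meaning of the additional axioms of super scaled lattices. -/
def SuperAxiom.meaning (I : Set ℕ) (M : Type u) [(lang I).Structure M] : SuperAxiom → Prop
  | scal k => ∀ a : M, oComp I (k + 1) a = a → a ≠ oBot I →
      ∃ c : M, oSup I c a = a ∧ c ≠ oBot I ∧ oComp I k c = c
  | cat r q p => r ≤ q → q ≤ p → ∀ c a : M, oSup I c a = a → oComp I p a = a → oComp I r c = c →
      ∃ b : M, oComp I q b = b ∧ oSup I c b = b ∧ oSup I b a = a
  | split => ∀ b₁ b₂ a : M, oSup I (oSup I b₁ b₂) a = a → oSdiff I a (oSup I b₁ b₂) = a → a ≠ oBot I →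
      ∃ a₁ a₂ : M, a₁ ≠ oBot I ∧ a₂ ≠ oBot I ∧ oSup I b₁ a₁ = a₁ ∧ oSup I b₂ a₂ = a₂ ∧
        a₁ = oSdiff I a a₂ ∧ a₂ = oSdiff I a a₁ ∧ oInf I a₁ a₂ = oInf I b₁ b₂

theorem SuperAxiom.realize_sentence (I : Set ℕ) (M : Type u) [(lang I).Structure M] (a : SuperAxiom) :
    M ⊨ a.sentence I ↔ a.meaning I M := by
  cases a with
  | cat r q p =>
    by_cases h : r ≤ q ∧ q ≤ p
    · simp [SuperAxiom.sentence, SuperAxiom.meaning, h, Sentence.Realize, Formula.Realize, Fin.snoc,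
        realize_tSup, realize_tComp]
    · simp only [SuperAxiom.sentence, SuperAxiom.meaning, if_neg h]
      exact iff_of_true (by simp [Sentence.Realize, Formula.Realize]) fun h1 h2 => absurd ⟨h1, h2⟩ h
  | _ =>
    simp [-existsAndEq, SuperAxiom.sentence, SuperAxiom.meaning, Sentence.Realize, Formula.Realize, Fin.snoc, realize_tBot,
      realize_tSup, realize_tInf, realize_tSdiff, realize_tComp]

end Axioms

/-! ### The sentences axiomatize the laws -/

section AxiomsAndLaws

open FirstOrder.Language

variable {I : Set ℕ} {d : ℕ} {M : Type u} [(lang I).Structure M]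

section Ops

variable [CoheytingAlgebra M] {C : ℕ → M → M}

theorem Interprets.oComp_eq (hI : Set.Iic d ⊆ I) (h : Interprets M fun i : I => C i) (hl : Laws d C)
    (k : ℕ) (a : M) : oComp I k a = C k a := by
  unfold oComp
  split_ifs with hk
  · exact h.comp ⟨k, hk⟩ a
  · rw [hl.comp_eq_bot k a (not_le.1 fun h => hk (hI h))]
    exact h.zero

theorem oComps_eq (hb : (oBot I : M) = ⊥) (hs : ∀ a b : M, oSup I a b = a ⊔ b)
    (hc : ∀ k (a : M), oComp I k a = C k a) (a : M) (k : ℕ) :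
    oComps I a k = (Finset.range k).sup fun i => C i a := by
  induction k with
  | zero => exact hb
  | succ k ih => rw [oComps, ih, hc, hs, Finset.range_add_one, Finset.sup_insert]

theorem Laws.meaning (hI : Set.Iic d ⊆ I) (h : Interprets M fun i : I => C i) (hl : Laws d C)
    (a : SubAxiom) : a.meaning I d M := by
  have hb : (oBot I : M) = ⊥ := h.zero
  have ht : (oTop I : M) = ⊤ := h.one
  have hs : ∀ a b : M, oSup I a b = a ⊔ b := h.sup
  have hi : ∀ a b : M, oInf I a b = a ⊓ b := h.inf
  have hd : ∀ a b : M, oSdiff I a b = a \ b := h.sdiff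
  have hc : ∀ k (a : M), oComp I k a = C k a := h.oComp_eq hI hl
  have hcs := oComps_eq hb hs hc
  cases a <;> simp only [SubAxiom.meaning, hb, ht, hs, hi, hd, hc, hcs]
  case supComm => exact sup_comm
  case supAssoc => exact sup_assoc
  case infComm => exact inf_comm
  case infAssoc => exact inf_assoc
  case supInf => simp
  case infSup => simp
  case botSup => simp
  case supTop => simp
  case sdiff => exact fun a b c => by rw [sup_eq_right, sup_eq_right, sdiff_le_iff]
  case compBot k => exact fun hk a => hl.comp_eq_bot k a hk
  case supComp => exact hl.sup_comp
  case compComp k => exact hl.comp_comp k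
  case compSupBot k l => exact fun hkl a => hl.comp_sup_eq_bot k l a hkl
  case compSup k => exact hl.comp_sup k
  case compInf i j => exact fun hij a => hl.comp_inf i j a hij
  case compSdiff k => exact hl.comp_sdiff k
  case muchBelow k => exact fun a b hba => hl.muchBelow k a b (sup_eq_right.1 hba)

theorem SuperLaws.meaning_iff (hI : Set.Iic d ⊆ I) (h : Interprets M fun i : I => C i) (hl : Laws d C) :
    SuperLaws C ↔ ∀ a : SuperAxiom, a.meaning I M := by
  have hb : (oBot I : M) = ⊥ := h.zero
  have hs : ∀ a b : M, oSup I a b = a ⊔ b := h.sup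
  have hi : ∀ a b : M, oInf I a b = a ⊓ b := h.inf
  have hd : ∀ a b : M, oSdiff I a b = a \ b := h.sdiff
  have hc : ∀ k (a : M), oComp I k a = C k a := h.oComp_eq hI hl
  have key : (∀ a : SuperAxiom, a.meaning I M) ↔ (∀ k, (SuperAxiom.scal k).meaning I M) ∧
      (∀ r q p, (SuperAxiom.cat r q p).meaning I M) ∧ SuperAxiom.split.meaning I M :=
    ⟨fun h => ⟨fun _ => h _, fun _ _ _ => h _, h _⟩, fun h a => by
      cases a
      exacts [h.1 _, h.2.1 _ _ _, h.2.2]⟩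
  rw [key]
  simp only [SuperAxiom.meaning, hb, hs, hi, hd, hc, sup_eq_right]
  exact ⟨fun h => ⟨h.scal, h.cat, h.split⟩, fun h => ⟨h.1, h.2.1, h.2.2⟩⟩

end Ops

/-- The co-Heyting algebra defined by the axioms. -/
noncomputable abbrev algebraOfAxioms (h : ∀ a : SubAxiom, a.meaning I d M) : CoheytingAlgebra M :=
  letI : Max M := ⟨oSup I⟩
  letI : Min M := ⟨oInf I⟩
  letI : Lattice M := Lattice.mk' (h .supComm) (h .supAssoc) (h .infComm) (h .infAssoc) (h .supInf) (h .infSup)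
  { bot := oBot I
    bot_le := fun a => sup_eq_right.1 (h .botSup a)
    top := oTop I
    le_top := fun a => sup_eq_right.1 (h .supTop a)
    sdiff := oSdiff I
    hnot := fun a => oSdiff I (oTop I) a
    top_sdiff := fun _ => rfl
    sdiff_le_iff := fun a b c => by
      rw [← sup_eq_right, ← sup_eq_right]
      exact h .sdiff a b c }

theorem hasLaws_of_axioms (h : ∀ a : SubAxiom, a.meaning I d M) : HasLaws I d M := by
  let _ := algebraOfAxioms h
  have hcs : ∀ (a : M) k, oComps I a k = (Finset.range k).sup fun i => oComp I i a :=
    oComps_eq rfl (fun _ _ => rfl) (fun _ _ => rfl)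
  have hlt : ∀ k (a : M), ScLt (oComp I) k a ↔ oComps I a k = a := fun k a => by rw [hcs]; rfl
  refine ⟨inferInstance, oComp I, ⟨rfl, rfl, fun _ _ => rfl, fun _ _ => rfl, fun _ _ => rfl, fun i a => ?_⟩, ?_⟩
  · unfold oComp
    rw [dif_pos i.2]
  · refine ⟨fun k a hk => h (.compBot k) hk a, fun a => (hlt _ _).2 (h .supComp a), fun k a => h (.compComp k) a,
      fun k l a hkl => ?_, fun k a b ha hb => ?_, fun i j a hij => ?_, fun k a b hb => ?_,
      fun k a b hba hab h0 ha => ?_⟩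
    · rw [← hcs]; exact h (.compSupBot k l) hkl a
    · exact h (.compSup k) a b ((hlt _ _).1 ha) ((hlt _ _).1 hb)
    · exact (hlt _ _).2 (h (.compInf i j) hij a)
    · exact h (.compSdiff k) a b ((hlt _ _).1 hb)
    · exact (hlt _ _).2 (h (.muchBelow k) a b (sup_eq_right.2 hba) hab h0 ((hlt _ _).1 ha))

/-- The axioms of subscaled lattices of sc-dimension at most `d`. -/
noncomputable def subTheory (I : Set ℕ) (d : ℕ) : (lang I).Theory := Set.range (SubAxiom.sentence I d)

/-- The axioms of super scaled lattices of sc-dimension at most `d`. -/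
noncomputable def superTheory (I : Set ℕ) (d : ℕ) : (lang I).Theory :=
  subTheory I d ∪ Set.range (SuperAxiom.sentence I)

theorem models_subTheory (hI : Set.Iic d ⊆ I) : M ⊨ subTheory I d ↔ HasLaws I d M := by
  rw [Theory.model_iff, subTheory, Set.forall_mem_range]
  simp only [SubAxiom.realize_sentence]
  refine ⟨hasLaws_of_axioms, ?_⟩
  rintro ⟨_, C, h, hl⟩ a
  exact hl.meaning hI h a

theorem models_superTheory (hI : Set.Iic d ⊆ I) : M ⊨ superTheory I d ↔ HasSuperLaws I d M := by
  rw [superTheory, Theory.model_union_iff, models_subTheory hI, Theory.model_iff, Set.forall_mem_range]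
  simp only [SuperAxiom.realize_sentence]
  constructor
  · rintro ⟨⟨i, C, h, hl⟩, hs⟩
    exact ⟨i, C, h, hl, (SuperLaws.meaning_iff hI h hl).2 hs⟩
  · rintro ⟨i, C, h, hl, hs⟩
    exact ⟨⟨i, C, h, hl⟩, (SuperLaws.meaning_iff hI h hl).1 hs⟩

/-- The sentence saying that the sc-dimension of the lattice is at least `d`. -/
noncomputable def topSentence (I : Set ℕ) (d : ℕ) : (lang I).Sentence := ∼((tComps tTop d) =' tTop)

theorem realize_topSentence : M ⊨ topSentence I d ↔ oComps I (oTop I : M) d ≠ oTop I := by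
  simp [topSentence, Sentence.Realize, Formula.Realize, realize_tComps, realize_tTop]

theorem realize_topSentence_iff (hI : Set.Iic d ⊆ I) [CoheytingAlgebra M] {C : ℕ → M → M}
    (h : Interprets M fun i : I => C i) (hl : Laws d C) : M ⊨ topSentence I d ↔ ¬ ScLt C d (⊤ : M) := by
  have ht : (oTop I : M) = ⊤ := h.one
  rw [realize_topSentence, ht, oComps_eq h.zero h.sup (h.oComp_eq hI hl)]
  rfl

/-- The sentence is free of quantifiers and variables, so embeddings preserve and reflect it. -/
theorem realize_topSentence_embedding {N : Type u} [(lang I).Structure N] (f : M ↪[lang I] N) :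
    M ⊨ topSentence I d ↔ N ⊨ topSentence I d := by
  have ht : f (oTop I : M) = (oTop I : N) :=
    (f.map_fun' (Func.one : (lang I).Functions 0) ![]).trans
      (congrArg (Structure.funMap (L := lang I) Func.one) (Subsingleton.elim _ _))
  have hs : ∀ k, f (oComps I (oTop I : M) k) = oComps I (oTop I : N) k := fun k => by
    have h := HomClass.realize_term (M := M) (N := N) f (t := tComps (I := I) tTop k) (v := (Empty.elim : Empty → M))
    rw [realize_tComps, realize_tComps, realize_tTop, realize_tTop] at h
    exact h.symm
  rw [realize_topSentence, realize_topSentence, ← hs, ← ht, f.injective.ne_iff]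

end AxiomsAndLaws

/-! ### Elementary classes and model-completions -/

theorem isElementaryClass_of {L : FirstOrder.Language.{0, 0}} {K : StructClass.{u} L} (T : L.Theory)
    (h : ∀ (M : Type u) [L.Structure M], M ⊨ T ↔ K M) : IsElementaryClass.{u} K := by
  intro M _
  refine ⟨fun hM => (h M).1 ?_, fun hM => ?_⟩
  · rw [Language.Theory.model_iff] at hM ⊢
    intro φ hφ
    refine hM φ fun N _ hN => ?_
    exact (Language.Theory.model_iff (M := N) T).1 ((h N).2 hN) φ hφ
  · rw [Language.Theory.model_iff]
    exact fun φ hφ => hφ M hM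

theorem isModelCompletion_of {L : FirstOrder.Language.{0, 0}} {K K' : StructClass.{u} L}
    (hK : IsElementaryClass.{u} K) (hK' : IsElementaryClass.{u} K')
    (h₁ : ∀ (M : Type u) [L.Structure M], K' M → K M)
    (h₂ : ∀ (M : Type u) [L.Structure M], K M →
      ∃ (N : Type u) (_ : L.Structure N), K' N ∧ Nonempty (M ↪[L] N))
    (h₃ : ∀ (M N₁ N₂ : Type u) [L.Structure M] [L.Structure N₁] [L.Structure N₂], K M → K' N₁ → K' N₂ →
      ∀ (f₁ : M ↪[L] N₁) (f₂ : M ↪[L] N₂) (n : ℕ) (φ : L.Formula (Fin n)) (v : Fin n → M),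
        φ.Realize (f₁ ∘ v) ↔ φ.Realize (f₂ ∘ v)) :
    IsModelCompletion.{u} (theoryOf K') (theoryOf K) where
  models M _ h := (hK M).2 (h₁ M ((hK' M).1 h))
  extends_to M _ h := by
    obtain ⟨N, i, hN, f⟩ := h₂ M ((hK M).1 h)
    exact ⟨N, i, (hK' N).2 hN, f⟩
  diagram_complete M N₁ N₂ _ _ _ h h1 h2 :=
    h₃ M N₁ N₂ ((hK M).1 h) ((hK' N₁).1 h1) ((hK' N₂).1 h2)

/-- The operations Cᵏ with k > d vanish, so only the symbols with index at most d matter and both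
languages are treated at once. -/
theorem main_hasLaws {I : Set ℕ} {d : ℕ} (hI : Set.Iic d ⊆ I) :
    IsElementaryClass.{u} (HasLaws.{u} I d) ∧ IsElementaryClass.{u} (HasSuperLaws.{u} I d) ∧
      IsModelCompletion.{u} (theoryOf (HasSuperLaws.{u} I d)) (theoryOf (HasLaws.{u} I d)) := by
  have h1 : IsElementaryClass.{u} (HasLaws.{u} I d) :=
    isElementaryClass_of (subTheory I d) fun M _ => models_subTheory hI
  have h2 : IsElementaryClass.{u} (HasSuperLaws.{u} I d) :=
    isElementaryClass_of (superTheory I d) fun M _ => models_superTheory hI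
  exact ⟨h1, h2, isModelCompletion_of h1 h2 (fun M _ h => h.hasLaws) (fun M _ h => h.exists_embedding)
    fun M N₁ N₂ _ _ _ h h1 h2 => h.realize_iff hI h1 h2⟩

/-- The members of a class of structures that satisfy a sentence. -/
def StructClass.satisfying {L : FirstOrder.Language.{0, 0}} (K : StructClass.{u} L) (φ : L.Sentence) :
    StructClass.{u} L := fun M _ => K M ∧ M ⊨ φ

/-- Exact sc-dimension d adds a sentence that an extension inherits from the structure it extends,
so nothing changes in the argument. -/
theorem main_hasLaws_top {I : Set ℕ} {d : ℕ} (hI : Set.Iic d ⊆ I) :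
    IsElementaryClass.{u} (StructClass.satisfying (HasLaws.{u} I d) (topSentence I d)) ∧
    IsElementaryClass.{u} (StructClass.satisfying (HasSuperLaws.{u} I d) (topSentence I d)) ∧
      IsModelCompletion.{u} (theoryOf (StructClass.satisfying (HasSuperLaws.{u} I d) (topSentence I d)))
        (theoryOf (StructClass.satisfying (HasLaws.{u} I d) (topSentence I d))) := by
  have h1 : IsElementaryClass.{u} (StructClass.satisfying (HasLaws.{u} I d) (topSentence I d)) :=
    isElementaryClass_of (subTheory I d ∪ {topSentence I d}) fun M _ => by
      rw [Language.Theory.model_union_iff, models_subTheory hI, Language.Theory.model_singleton_iff]; rfl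
  have h2 : IsElementaryClass.{u} (StructClass.satisfying (HasSuperLaws.{u} I d) (topSentence I d)) :=
    isElementaryClass_of (superTheory I d ∪ {topSentence I d}) fun M _ => by
      rw [Language.Theory.model_union_iff, models_superTheory hI, Language.Theory.model_singleton_iff]; rfl
  refine ⟨h1, h2, isModelCompletion_of h1 h2 (fun M _ h => ⟨h.1.hasLaws, h.2⟩) (fun M _ h => ?_)
    fun M N₁ N₂ _ _ _ h h1 h2 => h.1.realize_iff hI h1.1 h2.1⟩
  obtain ⟨N, i, hN, ⟨f⟩⟩ := h.1.exists_embedding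
  exact ⟨N, i, ⟨hN, (realize_topSentence_embedding f).1 h.2⟩, ⟨f⟩⟩

/-! ### Sc-dimension and the laws of subscaled lattices -/

section ScDim

variable {L : Type u} [CoheytingAlgebra L] {C : ℕ → L → L} {d : ℕ} {I : Set ℕ}

theorem ScLt.mono (hle : ∀ k (a : L), C k a ≤ a) {k l : ℕ} (hkl : k ≤ l) {a : L} (ha : ScLt C k a) :
    ScLt C l a := by
  apply le_antisymm (Finset.sup_le fun i _ => hle i a)
  conv_lhs => rw [← ha]
  exact Finset.sup_mono (Finset.range_mono hkl)

theorem isLUB_comp_iff (hI : IsLowerSet I) {n : ℕ} (hn : n ∈ I) (a : L) :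
    IsLUB {x : L | ∃ i : I, ((i : ℕ) : WithBot ℕ∞) ≤ (n : WithBot ℕ∞) ∧ x = C i a} a ↔ ScLt C (n + 1) a := by
  have h : IsLUB {x : L | ∃ i : I, ((i : ℕ) : WithBot ℕ∞) ≤ (n : WithBot ℕ∞) ∧ x = C i a}
      ((Finset.range (n + 1)).sup fun i => C i a) := by
    constructor
    · rintro _ ⟨i, hi, rfl⟩
      exact Finset.le_sup (f := fun i => C i a) (Finset.mem_range.2 (Nat.lt_succ_of_le (Nat.cast_le.1 hi)))
    · intro b hb
      refine Finset.sup_le fun i hi => ?_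
      have hin : i ≤ n := Nat.lt_succ_iff.1 (Finset.mem_range.1 hi)
      exact hb ⟨⟨i, hI hin hn⟩, Nat.cast_le.2 hin, rfl⟩
  exact ⟨fun h' => h.unique h', fun h' => by rwa [show _ = a from h'] at h⟩

theorem scDim_lt_iff (hI : IsLowerSet I) (hd : d ∈ I) (hle : ∀ k (a : L), C k a ≤ a)
    (hsup : ∀ a : L, ScLt C (d + 1) a) {k : ℕ} {a : L} :
    scDim (fun i : I => C i) a < (k : WithBot ℕ∞) ↔ ScLt C k a := by
  unfold scDim
  rw [sInf_lt_iff]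
  constructor
  · rintro ⟨l, ⟨rfl | ⟨n, hn, rfl⟩, hl⟩, hlk⟩
    · have h0 : a = ⊥ := by
        refine le_bot_iff.1 (hl.2 ?_)
        rintro _ ⟨i, hi, rfl⟩
        exact absurd hi (by simp)
      subst h0
      exact le_bot_iff.1 (Finset.sup_le fun i _ => hle i ⊥)
    · exact ((isLUB_comp_iff hI hn a).1 hl).mono hle (Nat.cast_lt.1 hlk)
  · intro h
    cases k with
    | zero =>
      have h0 : a = ⊥ := Laws.scLt_zero.1 h
      subst h0
      refine ⟨⊥, ⟨Or.inl rfl, ⟨?_, fun _ _ => bot_le⟩⟩, WithBot.bot_lt_coe _⟩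
      rintro _ ⟨i, -, rfl⟩
      exact hle _ _
    | succ j =>
      -- j itself need not be an index; beyond d the join of the components up to d is already
      -- everything.
      have hm : min j d ∈ I := hI (min_le_right _ _) hd
      refine ⟨(min j d : ℕ), ⟨Or.inr ⟨_, hm, rfl⟩, (isLUB_comp_iff hI hm a).2 ?_⟩,
        Nat.cast_lt.2 (Nat.lt_succ_of_le (min_le_left _ _))⟩
      rcases le_total j d with h' | h'
      · rwa [min_eq_left h']
      · rw [min_eq_right h']; exact hsup a

theorem scDim_cases (hI : IsLowerSet I) (hd : d ∈ I) (hsup : ∀ a : L, ScLt C (d + 1) a) (a : L) :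
    scDim (fun i : I => C i) a = ⊥ ∨ ∃ n : ℕ, scDim (fun i : I => C i) a = (n : WithBot ℕ∞) := by
  have hne : {l : WithBot ℕ∞ | (l = ⊥ ∨ ∃ n ∈ I, l = (n : WithBot ℕ∞)) ∧
      IsLUB {x : L | ∃ i : I, ((i : ℕ) : WithBot ℕ∞) ≤ l ∧ x = C i a} a}.Nonempty :=
    ⟨d, Or.inr ⟨d, hd, rfl⟩, (isLUB_comp_iff hI hd a).2 (hsup a)⟩
  rcases (csInf_mem hne).1 with h | ⟨n, -, h⟩
  · exact Or.inl h
  · exact Or.inr ⟨n, h⟩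

theorem scDim_le_iff (hI : IsLowerSet I) (hd : d ∈ I) (hle : ∀ k (a : L), C k a ≤ a)
    (hsup : ∀ a : L, ScLt C (d + 1) a) {k : ℕ} {a : L} :
    scDim (fun i : I => C i) a ≤ (k : WithBot ℕ∞) ↔ ScLt C (k + 1) a := by
  rw [← scDim_lt_iff hI hd hle hsup]
  rcases scDim_cases hI hd hsup a with h | ⟨n, h⟩
  · rw [h]
    exact iff_of_true bot_le (WithBot.bot_lt_coe _)
  · rw [h, Nat.cast_le, Nat.cast_lt, Nat.lt_succ_iff]

theorem scDim_eq_bot_iff (hI : IsLowerSet I) (hd : d ∈ I) (hle : ∀ k (a : L), C k a ≤ a)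
    (hsup : ∀ a : L, ScLt C (d + 1) a) {a : L} : scDim (fun i : I => C i) a = ⊥ ↔ a = ⊥ := by
  rw [← Laws.scLt_zero (C := C), ← scDim_lt_iff hI hd hle hsup]
  rcases scDim_cases hI hd hsup a with h | ⟨n, h⟩
  · rw [h]
    exact iff_of_true rfl (WithBot.bot_lt_coe _)
  · rw [h, Nat.cast_lt]
    exact iff_of_false (WithBot.coe_ne_bot) (Nat.not_lt_zero n)

theorem sup_Iic_eq (s : Finset (Set.Iic d)) (a : L) :
    (s.sup fun i => C i a) = (s.image Subtype.val).sup fun i => C i a := by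
  rw [Finset.sup_image]; rfl

/-- The laws keep only singletons and initial segments from the second axiom. Its general form is
recovered through the representation by lower sets, where it is `comp_finset_sup_comp`. -/
theorem isDSubscaled_iff (h0 : ∀ k (a : L), d < k → C k a = ⊥) :
    IsDSubscaled d (fun i : Set.Iic d => C i) ↔ Laws d C := by
  have hI : IsLowerSet (Set.Iic d) := isLowerSet_Iic d
  have hd : d ∈ Set.Iic d := Set.self_mem_Iic
  constructor
  · intro h
    have hle : ∀ k (a : L), C k a ≤ a := fun k a => by
      by_cases hk : k ≤ d
      · conv_rhs => rw [← h.sc1 a]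
        exact Finset.le_sup (f := fun i : Set.Iic d => C i a) (Finset.mem_univ (⟨k, hk⟩ : Set.Iic d))
      · rw [h0 k a (not_le.1 hk)]; exact bot_le
    have hsup : ∀ a : L, ScLt C (d + 1) a := fun a => by
      apply le_antisymm (Finset.sup_le fun i _ => hle i a)
      conv_lhs => rw [← h.sc1 a]
      exact Finset.sup_le fun i _ => Finset.le_sup (f := fun i => C i a)
        (Finset.mem_range.2 (Nat.lt_succ_of_le i.2))
    refine ⟨h0, hsup, fun k a => ?_, fun k l a hkl => ?_, fun k a b ha hb => ?_, fun i j a hij => ?_,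
      fun k a b hb => ?_, fun k a b hba hab ha hk => ?_⟩
    · by_cases hk : k ≤ d
      · have := h.sc2 {⟨k, hk⟩} ⟨k, hk⟩ a
        rwa [Finset.sup_singleton, if_pos (Finset.mem_singleton_self _)] at this
      · rw [h0 k _ (not_le.1 hk), h0 k _ (not_le.1 hk)]
    · by_cases hl : l ≤ d
      · have := h.sc2 (Finset.univ.filter fun i => (i : ℕ) < k) ⟨l, hl⟩ a
        rw [if_neg (by simpa using hkl), sup_Iic_eq] at this
        convert this using 2
        congr 1
        ext i
        simp only [Finset.mem_range, Finset.mem_image, Finset.mem_filter, Finset.mem_univ, true_and]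
        exact ⟨fun hi => ⟨⟨i, (hi.le.trans hkl).trans hl⟩, hi, rfl⟩, by rintro ⟨i, hi, rfl⟩; exact hi⟩
      · exact h0 l _ (not_le.1 hl)
    · by_cases hk : k ≤ d
      · exact h.sc3 ⟨k, hk⟩ a b (max_le ((scDim_le_iff hI hd hle hsup).2 ha) ((scDim_le_iff hI hd hle hsup).2 hb))
      · simp only [h0 k _ (not_le.1 hk), sup_bot_eq]
    · have hb : ScLt C (min i j) (⊥ : L) := le_bot_iff.1 (Finset.sup_le fun i _ => hle i ⊥)
      by_cases hi : i ≤ d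
      · by_cases hj : j ≤ d
        · exact (scDim_lt_iff hI hd hle hsup).1 (h.sc4 ⟨i, hi⟩ ⟨j, hj⟩ a fun e => hij (congrArg Subtype.val e))
        · rwa [h0 j _ (not_le.1 hj), inf_bot_eq]
      · rwa [h0 i _ (not_le.1 hi), bot_inf_eq]
    · by_cases hk : k ≤ d
      · exact h.sc5 ⟨k, hk⟩ a b ((scDim_le_iff hI hd hle hsup).2 hb)
      · simp only [h0 k _ (not_le.1 hk), bot_sdiff]
    · exact (scDim_lt_iff hI hd hle hsup).1 ((h.sc6 a b (muchBelow_iff.2 ⟨hba, hab, ha⟩)).trans_le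
        ((scDim_le_iff hI hd hle hsup).2 hk))
  · intro h
    have hlt : ∀ {k : ℕ} {a : L}, scDim (fun i : Set.Iic d => C i) a < (k : WithBot ℕ∞) ↔ ScLt C k a :=
      scDim_lt_iff hI hd h.comp_le h.sup_comp
    have hle : ∀ {k : ℕ} {a : L}, scDim (fun i : Set.Iic d => C i) a ≤ (k : WithBot ℕ∞) ↔ ScLt C (k + 1) a :=
      scDim_le_iff hI hd h.comp_le h.sup_comp
    refine ⟨fun a => ?_, fun s k a => ?_, fun k a b hab => ?_, fun i j a hij => ?_, fun k a b hb => ?_,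
      fun a b hab => ?_⟩
    · refine le_antisymm (Finset.sup_le fun i _ => h.comp_le _ a) ?_
      conv_lhs => rw [← h.sup_comp a]
      exact Finset.sup_le fun i hi => Finset.le_sup (f := fun i : Set.Iic d => C i a)
        (Finset.mem_univ (⟨i, Nat.lt_succ_iff.1 (Finset.mem_range.1 hi)⟩ : Set.Iic d))
    · have hE := h.isEmb_specMap
      apply hE.inj
      rw [sup_Iic_eq, hE.comp, hE.finset_sup]
      simp only [hE.comp]
      rw [comp_finset_sup_comp, apply_ite h.specMap, hE.comp, hE.bot]
      refine if_congr ?_ rfl rfl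
      simpa using fun _ => Set.mem_Iic.1 k.2
    · exact h.comp_sup k a b (hle.1 ((le_max_left _ _).trans hab)) (hle.1 ((le_max_right _ _).trans hab))
    · exact hlt.2 (h.comp_inf i j a fun e => hij (Subtype.ext e))
    · exact h.comp_sdiff k a b (hle.1 hb)
    · obtain ⟨hba, hab, ha⟩ := muchBelow_iff.1 hab
      rcases scDim_cases hI hd h.sup_comp a with hk | ⟨k, hk⟩
      · exact absurd ((scDim_eq_bot_iff hI hd h.comp_le h.sup_comp).1 hk) ha
      · rw [hk]
        exact hlt.2 (h.muchBelow k a b hba hab ha (hle.1 hk.le))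

end ScDim

/-! ### Lattice dimension and the laws of super scaled lattices -/

theorem LTSeries.length_sub_le {α : Type*} [Preorder α] {g : α → ℕ} (hg : StrictAnti g) (s : LTSeries α)
    (j : Fin (s.length + 1)) : s.length - j ≤ g (s j) := by
  induction j using Fin.reverseInduction with
  | last => simp
  | cast i ih =>
    have := hg (s.step i)
    simp only [Fin.val_succ, Fin.val_castSucc] at ih ⊢
    omega

section LatDim

open Order

variable {L : Type u} [CoheytingAlgebra L] {C : ℕ → L → L} {d : ℕ} {I : Set ℕ}

/-- The point of the spectrum given by a prime filter that contains `a`. -/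
def Spec.ofMem {a : L} (p : {p : PFilter L // p.IsPrime ∧ a ∈ p}) : Spec L := Spec.of p.1 p.2.1

theorem Laws.specRk_ofMem_strictAnti (h : Laws d C) (a : L) :
    StrictAnti fun p : {p : PFilter L // p.IsPrime ∧ a ∈ p} => h.specRk (Spec.ofMem p) :=
  fun _ _ hpq => h.specRk_strict hpq

theorem latDim_bot : latDim (⊥ : L) = ⊥ :=
  krullDim_eq_bot_iff.2 ⟨fun p => prime_bot_notMem p.2.1 p.2.2⟩

/-- The rank strictly decreases as prime filters grow, and it is at most k on filters containing a.
-/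
theorem Laws.latDim_le (h : Laws d C) {k : ℕ} {a : L} (ha : ScLt C (k + 1) a) :
    latDim a ≤ (k : WithBot ℕ∞) := by
  have : latDim a < ((k + 1 : ℕ) : WithBot ℕ∞) := by
    refine krullDim_lt_coe_iff.2 fun s => ?_
    have h1 := LTSeries.length_sub_le (h.specRk_ofMem_strictAnti a) s 0
    have h2 := h.specRk_lt (p := Spec.ofMem (s 0)) (s 0).2.2 ha
    simp only [Fin.val_zero] at h1
    omega
  rwa [Nat.cast_add, Nat.cast_one, ENat.WithBot.lt_add_one_iff] at this

theorem Laws.sdiff_eq_self_of_comp_eq (h : Laws d C) {k : ℕ} {a c : L} (ha : C k a = a) (hc : ScLt C k c) :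
    a \ c = a := by
  have := h.comp_sdiff k a c (h.scLt_of_le (Nat.le_succ k) hc)
  rwa [h.comp_eq_bot_of_scLt hc, sdiff_bot, ha] at this

/-- Each application of scaling gives c ≤ a one dimension lower with a - c = a. Hence a prime filter
containing c has strictly inside it one that contains a and not c, and the chain grows by one at its
small end. -/
theorem Laws.exists_le_coheight (h : Laws d C) (hs : ∀ (k : ℕ) (a : L), C (k + 1) a = a → a ≠ ⊥ →
    ∃ c : L, c ≤ a ∧ c ≠ ⊥ ∧ C k c = c) (k : ℕ) (a : L) (ha : C k a = a) (h0 : a ≠ ⊥) :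
    ∃ p : {p : PFilter L // p.IsPrime ∧ a ∈ p}, (k : ℕ∞) ≤ coheight p := by
  induction k generalizing a with
  | zero =>
    obtain ⟨q, hq, haq, -⟩ := exists_prime_of_not_le (a := a) (b := ⊥) fun h => h0 (le_bot_iff.1 h)
    exact ⟨⟨q, hq, haq⟩, by simp⟩
  | succ k ih =>
    obtain ⟨c, hca, hc0, hc⟩ := hs k a ha h0
    obtain ⟨p, hp⟩ := ih c hc hc0
    have hsd : a \ c = a := h.sdiff_eq_self_of_comp_eq ha (hc ▸ h.scLt_comp k c)
    have hap : a ∈ p.1 := PFilter.mem_of_le hca p.2.2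
    obtain ⟨q, hq, hqp, haq, hcq⟩ := exists_prime_le_of_sdiff_mem p.2.1 (hsd.symm ▸ hap)
    refine ⟨⟨q, hq, haq⟩, ?_⟩
    have h1 : (⟨q, hq, haq⟩ : {p : PFilter L // p.IsPrime ∧ a ∈ p}) < ⟨p.1, p.2.1, hap⟩ :=
      lt_of_le_of_ne hqp fun e => hcq (by rw [show q = p.1 from congrArg Subtype.val e]; exact p.2.2)
    have h2 := coheight_le_coheight_apply_of_strictMono
      (fun r : {p : PFilter L // p.IsPrime ∧ c ∈ p} =>
        (⟨r.1, r.2.1, PFilter.mem_of_le hca r.2.2⟩ : {p : PFilter L // p.IsPrime ∧ a ∈ p}))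
      (fun _ _ h => h) p
    rw [Nat.cast_add, Nat.cast_one]
    exact (add_le_add_left (hp.trans h2) 1).trans (coheight_add_one_le h1)

theorem Laws.scDim_eq_of_comp_eq (h : Laws d C) (hI : IsLowerSet I) (hd : d ∈ I) {k : ℕ} {a : L}
    (ha : C k a = a) (h0 : a ≠ ⊥) : scDim (fun i : I => C i) a = (k : WithBot ℕ∞) := by
  refine le_antisymm ((scDim_le_iff hI hd h.comp_le h.sup_comp).2 (ha ▸ h.scLt_comp k a)) ?_
  refine not_lt.1 fun hlt => h0 ?_
  rw [← ha]
  exact h.comp_eq_bot_of_scLt ((scDim_lt_iff hI hd h.comp_le h.sup_comp).1 hlt)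

/-- The inequality dim ≤ sc-dim always holds. The condition on the right produces chains long enough
for the converse; in turn, such a chain contains a filter of rank k from which c is read off. -/
theorem Laws.scDim_eq_latDim_iff (h : Laws d C) (hI : IsLowerSet I) (hd : d ∈ I) :
    (∀ a : L, scDim (fun i : I => C i) a = latDim a) ↔ ∀ (k : ℕ) (a : L), C (k + 1) a = a → a ≠ ⊥ →
      ∃ c : L, c ≤ a ∧ c ≠ ⊥ ∧ C k c = c := by
  constructor
  · intro hs k a ha h0
    have hdim : ((k + 1 : ℕ) : WithBot ℕ∞) ≤ latDim a := by
      rw [← hs, h.scDim_eq_of_comp_eq hI hd ha h0]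
    obtain ⟨s, hsl⟩ := le_krullDim_iff.1 hdim
    have hj1 : 1 < s.length + 1 := by omega
    -- The second filter of a chain of length k + 1 has rank exactly k: k strict drops follow it,
    -- and the first filter has rank at most k + 1.
    set p : Spec L := Spec.ofMem (s ⟨1, hj1⟩) with hp
    have h1 : k ≤ h.specRk p := by
      have := LTSeries.length_sub_le (h.specRk_ofMem_strictAnti a) s ⟨1, hj1⟩
      simp only [hsl, Nat.add_sub_cancel] at this
      exact this
    have h2 : h.specRk p < k + 1 := by
      have h3 : h.specRk p < h.specRk (Spec.ofMem (s 0)) :=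
        h.specRk_ofMem_strictAnti a (s.strictMono (Fin.mk_lt_mk.2 Nat.zero_lt_one : (0 : Fin _) < ⟨1, hj1⟩))
      have h4 := h.specRk_lt (p := Spec.ofMem (s 0)) (s 0).2.2 (ha ▸ h.scLt_comp (k + 1) a)
      omega
    obtain ⟨y, hy, hyk⟩ := h.exists_mem_specRk p
    have hz : y ⊓ a ∈ p.filter := PFilter.inf_mem hy (s ⟨1, hj1⟩).2.2
    have hzk : ScLt C (k + 1) (y ⊓ a) := h.scLt_anti inf_le_left (h.scLt_of_le h2 hyk)
    refine ⟨C k (y ⊓ a), (h.comp_le _ _).trans inf_le_right, fun hb => ?_, h.comp_comp _ _⟩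
    have hzk' : ScLt C k (y ⊓ a) := by
      unfold ScLt at hzk ⊢
      rwa [Finset.range_add_one, Finset.sup_insert, hb, bot_sup_eq] at hzk
    exact absurd (h.specRk_lt hz hzk') (not_lt.2 h1)
  · intro hs a
    rcases scDim_cases hI hd h.sup_comp a with hk | ⟨k, hk⟩
    · rw [hk, (scDim_eq_bot_iff hI hd h.comp_le h.sup_comp).1 hk, latDim_bot]
    · have hak := (scDim_le_iff hI hd h.comp_le h.sup_comp).1 hk.le
      rw [hk]
      refine le_antisymm ?_ (h.latDim_le hak)
      have hc : C k a ≠ ⊥ := fun hb => by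
        have : ScLt C k a := by
          unfold ScLt at hak ⊢
          rwa [Finset.range_add_one, Finset.sup_insert, hb, bot_sup_eq] at hak
        exact absurd hk ((scDim_lt_iff hI hd h.comp_le h.sup_comp).2 this).ne
      obtain ⟨p, hp⟩ := h.exists_le_coheight hs k _ (h.comp_comp k a) hc
      have h2 := coheight_le_coheight_apply_of_strictMono
        (fun r : {p : PFilter L // p.IsPrime ∧ C k a ∈ p} =>
          (⟨r.1, r.2.1, PFilter.mem_of_le (h.comp_le k a) r.2.2⟩ : {p : PFilter L // p.IsPrime ∧ a ∈ p}))
        (fun _ _ h => h) p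
      exact (WithBot.coe_le_coe.2 (hp.trans h2)).trans (coheight_le_krullDim _)

/-- If a - Cᵏa were non-zero, it would have sc-dimension k and thus a maximal point of rank k. That
point would be maximal in a as well, hence belong to Cᵏa, which the maximal points of the difference
do not. -/
theorem Laws.isPure_iff (h : Laws d C) (hI : IsLowerSet I) (hd : d ∈ I)
    (hs : ∀ a : L, scDim (fun i : I => C i) a = latDim a) {k : ℕ} {a : L} : IsPure k a ↔ C k a = a := by
  have hE := h.isEmb_specMap
  constructor
  · intro ha
    refine le_antisymm (h.comp_le k a) ?_
    rw [← sdiff_eq_bot_iff]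
    by_contra h0
    have hdim := (hs _).trans (ha _ h0)
    have hc : C k (a \ C k a) ≠ ⊥ := fun hb => by
      have hak := (scDim_le_iff hI hd h.comp_le h.sup_comp).1 hdim.le
      have : ScLt C k (a \ C k a) := by
        unfold ScLt at hak ⊢
        rwa [Finset.range_add_one, Finset.sup_insert, hb, bot_sup_eq] at hak
      exact absurd hdim ((scDim_lt_iff hI hd h.comp_le h.sup_comp).2 this).ne
    obtain ⟨x, hx⟩ := ne_bot_iff.1 fun e => hc (hE.eq_bot_iff.1 e)
    rw [hE.comp] at hx
    obtain ⟨y, ⟨hy, hyk, hym⟩, -⟩ := mem_comp.1 hx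
    have hab : ∀ z ∈ h.specMap a, z ∉ h.specMap (C k a) → z ∈ h.specMap (a \ C k a) := fun z hz hz' => by
      rw [hE.sdiff, mem_sdiff_iff]; exact ⟨z, ⟨hz, hz'⟩, le_rfl⟩
    have hy' := hy
    rw [hE.sdiff, mem_sdiff_iff] at hy'
    obtain ⟨w, ⟨hw, hwn⟩, hyw⟩ := hy'
    have hwy := hym w (hab w hw hwn) hyw
    subst hwy
    apply hwn
    rw [hE.comp]
    exact mem_comp.2 ⟨w, ⟨hw, hyk, fun z hz hwz => hym z (hab z hz fun hz' =>
      hwn ((h.specMap (C k a)).lower hwz hz')) hwz⟩, le_rfl⟩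
  · intro ha b h0
    rw [← hs]
    refine h.scDim_eq_of_comp_eq hI hd (hE.inj ?_) h0
    rw [hE.comp, comp_eq_self_iff, hE.sdiff]
    refine (comp_eq_self_iff.1 ?_).sdiff _
    rw [← hE.comp, ha]

theorem Laws.superLaws_iff (h : Laws d C) (hI : IsLowerSet I) (hd : d ∈ I) :
    SuperLaws C ↔ (∀ a : L, scDim (fun i : I => C i) a = latDim a) ∧ Catenarity L ∧ Splitting L := by
  have hsplit : Splitting L ↔ ∀ b₁ b₂ a : L, b₁ ⊔ b₂ ≤ a → a \ (b₁ ⊔ b₂) = a → a ≠ ⊥ →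
      ∃ a₁ a₂ : L, a₁ ≠ ⊥ ∧ a₂ ≠ ⊥ ∧ b₁ ≤ a₁ ∧ b₂ ≤ a₂ ∧ a₁ = a \ a₂ ∧ a₂ = a \ a₁ ∧ a₁ ⊓ a₂ = b₁ ⊓ b₂ := by
    unfold Splitting
    simp only [muchBelow_iff, and_imp]
  have hcat : (∀ a : L, scDim (fun i : I => C i) a = latDim a) → (Catenarity L ↔ ∀ r q p : ℕ, r ≤ q → q ≤ p →
      ∀ c a : L, c ≤ a → C p a = a → C r c = c → ∃ b : L, C q b = b ∧ c ≤ b ∧ b ≤ a) := by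
    intro hs
    unfold Catenarity HasPureDim
    simp only [h.isPure_iff hI hd hs]
    constructor
    · intro H r q p hrq hqp c a hca ha hc
      -- Pure dimension excludes zero, whereas Cʳc = c allows it; then b = 0 works.
      by_cases h0 : c = ⊥
      · exact ⟨⊥, le_bot_iff.1 (h.comp_le q ⊥), h0.le, bot_le⟩
      · exact H r q p hrq hqp c a hca ⟨ha, fun e => h0 (le_bot_iff.1 (e ▸ hca))⟩ ⟨hc, h0⟩
    · exact fun H r q p hrq hqp c a hca ha hc => H r q p hrq hqp c a hca ha.1 hc.1
  constructor
  · intro H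
    have hs := (h.scDim_eq_latDim_iff hI hd).2 H.scal
    exact ⟨hs, (hcat hs).2 H.cat, hsplit.2 H.split⟩
  · rintro ⟨hs, hc, hsp⟩
    exact ⟨(h.scDim_eq_latDim_iff hI hd).1 hs, (hcat hs).1 hc, hsplit.1 hsp⟩

end LatDim

/-! ### The classes of subscaled and super scaled lattices -/

section Link

variable {L : Type u} [CoheytingAlgebra L] {C : ℕ → L → L} {d : ℕ}

theorem isSuperDScaled_iff (h0 : ∀ k (a : L), d < k → C k a = ⊥) :
    IsSuperDScaled d (fun i : Set.Iic d => C i) ↔ Laws d C ∧ SuperLaws C := by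
  rw [← isDSubscaled_iff h0]
  constructor
  · intro h
    exact ⟨h.toIsDSubscaled, (((isDSubscaled_iff h0).1 h.toIsDSubscaled).superLaws_iff (isLowerSet_Iic d)
      Set.self_mem_Iic).2 ⟨h.scDim_eq, h.catenarity, h.splitting⟩⟩
  · rintro ⟨h, hs⟩
    obtain ⟨h1, h2, h3⟩ := (((isDSubscaled_iff h0).1 h).superLaws_iff (isLowerSet_Iic d) Set.self_mem_Iic).1 hs
    exact ⟨⟨h, h1⟩, h2, h3⟩

/-- The operations `Cᵏ` for `k ≤ d`, extended by `0`. -/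
def extend (C : Set.Iic d → L → L) (k : ℕ) (a : L) : L := if h : k ≤ d then C ⟨k, h⟩ a else ⊥

theorem extend_eq_bot (C : Set.Iic d → L → L) (k : ℕ) (a : L) (hk : d < k) : extend C k a = ⊥ :=
  dif_neg (not_le.2 hk)

theorem extend_coe (C : Set.Iic d → L → L) : (fun i : Set.Iic d => extend C i) = C := by
  ext i a
  exact dif_pos i.2

theorem dSubscaled_eq (d : ℕ) : dSubscaled.{u} d = HasLaws.{u} (Set.Iic d) d := by
  funext M _
  refine propext ⟨?_, ?_⟩
  · rintro ⟨i, C, hC, h⟩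
    rw [← extend_coe C] at hC h
    exact ⟨i, extend C, hC, (isDSubscaled_iff (extend_eq_bot C)).1 h⟩
  · rintro ⟨i, C, hC, h⟩
    exact ⟨i, _, hC, (isDSubscaled_iff h.comp_eq_bot).2 h⟩

theorem superDScaled_eq (d : ℕ) : superDScaled.{u} d = HasSuperLaws.{u} (Set.Iic d) d := by
  funext M _
  refine propext ⟨?_, ?_⟩
  · rintro ⟨i, C, hC, h⟩
    rw [← extend_coe C] at hC h
    exact ⟨i, extend C, hC, (isSuperDScaled_iff (extend_eq_bot C)).1 h⟩
  · rintro ⟨i, C, hC, h⟩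
    exact ⟨i, _, hC, (isSuperDScaled_iff h.1.comp_eq_bot).2 h⟩

theorem Laws.of_le (h : Laws d C) {e : ℕ} (hde : d ≤ e) : Laws e C where
  comp_eq_bot k a hk := h.comp_eq_bot k a (hde.trans_lt hk)
  sup_comp a := h.scLt_of_le (Nat.succ_le_succ hde) (h.sup_comp a)
  comp_comp := h.comp_comp
  comp_sup_eq_bot := h.comp_sup_eq_bot
  comp_sup := h.comp_sup
  comp_inf := h.comp_inf
  comp_sdiff := h.comp_sdiff
  muchBelow := h.muchBelow

/-- Sc-dimension is monotone, so a bound for the top element bounds every element and kills the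
higher components. -/
theorem Laws.of_scLt_top {e : ℕ} (h : Laws e C) (ht : ScLt C (d + 1) (⊤ : L)) : Laws d C where
  comp_eq_bot _ _ hk := h.comp_eq_bot_of_scLt (h.scLt_of_le hk (h.scLt_anti le_top ht))
  sup_comp _ := h.scLt_anti le_top ht
  comp_comp := h.comp_comp
  comp_sup_eq_bot := h.comp_sup_eq_bot
  comp_sup := h.comp_sup
  comp_inf := h.comp_inf
  comp_sdiff := h.comp_sdiff
  muchBelow := h.muchBelow

theorem isSubscaled_iff : (IsSubscaled (fun i : ↥(Set.univ : Set ℕ) => C i) ∧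
    scDim (fun i : ↥(Set.univ : Set ℕ) => C i) (⊤ : L) ≤ (d : WithBot ℕ∞)) ↔ Laws d C := by
  constructor
  · rintro ⟨⟨d₀, h⟩, ht⟩
    have hl : ∀ e, d₀ ≤ e → Laws e (extend fun i : Set.Iic e => C i) := fun e he =>
      (isDSubscaled_iff (extend_eq_bot _)).1 (by rw [extend_coe]; exact h e he)
    have hext : ∀ {e k : ℕ}, k ≤ e → ∀ a, extend (fun i : Set.Iic e => C i) k a = C k a :=
      fun hk a => dif_pos hk
    have hsc : ∀ {e k : ℕ} {a : L}, k ≤ e + 1 → (ScLt (extend fun i : Set.Iic e => C i) k a ↔ ScLt C k a) := by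
      intro e k a hk
      unfold ScLt
      rw [Finset.sup_congr rfl fun i hi =>
        hext (Nat.lt_succ_iff.1 ((Finset.mem_range.1 hi).trans_le hk)) a]
    have hle : ∀ k (a : L), C k a ≤ a := fun k a => by
      rw [← hext (le_max_right d₀ k)]
      exact (hl _ (le_max_left d₀ k)).comp_le k a
    have htop : ScLt C (d + 1) (⊤ : L) :=
      (scDim_le_iff isLowerSet_univ (Set.mem_univ d₀) hle fun a => (hsc le_rfl).1 ((hl d₀ le_rfl).sup_comp a)).1 ht
    have hl' : ∀ e, d₀ ≤ e → d ≤ e → Laws d (extend fun i : Set.Iic e => C i) := fun e he hde =>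
      (hl e he).of_scLt_top ((hsc (Nat.succ_le_succ hde)).2 htop)
    -- For k beyond the truncation, the laws for the truncation at k itself show that Cᵏ vanishes.
    have hC : (extend fun i : Set.Iic (max d₀ d) => C i) = C := by
      funext k a
      by_cases hk : k ≤ max d₀ d
      · exact hext hk a
      · have hk' := not_le.1 hk
        rw [extend_eq_bot _ _ _ hk', ← hext (le_refl k), (hl' k ((le_max_left _ _).trans hk'.le)
          ((le_max_right _ _).trans hk'.le)).comp_eq_bot k a ((le_max_right _ _).trans_lt hk')]
    have := hl' _ (le_max_left d₀ d) (le_max_right d₀ d)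
    rwa [hC] at this
  · intro h
    refine ⟨⟨d, fun e he => ?_⟩, ?_⟩
    · exact (isDSubscaled_iff (h.of_le he).comp_eq_bot).2 (h.of_le he)
    · exact (scDim_le_iff isLowerSet_univ (Set.mem_univ d) h.comp_le h.sup_comp).2 (h.sup_comp ⊤)

theorem isSuperScaled_iff : (IsSuperScaled (fun i : ↥(Set.univ : Set ℕ) => C i) ∧
    scDim (fun i : ↥(Set.univ : Set ℕ) => C i) (⊤ : L) ≤ (d : WithBot ℕ∞)) ↔ Laws d C ∧ SuperLaws C := by
  constructor
  · rintro ⟨hs, ht⟩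
    have h : Laws d C := isSubscaled_iff.1 ⟨hs.subscaled, ht⟩
    obtain ⟨d₀, hd₀⟩ := hs.scaled
    refine ⟨h, (h.superLaws_iff (isLowerSet_Iic (max d₀ d)) (le_max_right d₀ d)).2
      ⟨(hd₀ _ (le_max_left d₀ d)).scDim_eq, hs.catenarity, hs.splitting⟩⟩
  · rintro ⟨h, hs⟩
    obtain ⟨h1, h2⟩ := isSubscaled_iff.2 h
    obtain ⟨h3, h4⟩ := ((h.superLaws_iff isLowerSet_univ (Set.mem_univ d)).1 hs).2
    exact ⟨⟨h1, ⟨d, fun e he => ((isSuperDScaled_iff (h.of_le he).comp_eq_bot).2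
      ⟨h.of_le he, hs⟩).toIsDScaled⟩, h3, h4⟩, h2⟩

theorem subscaledLE_eq (d : ℕ) : subscaledLE.{u} d = HasLaws.{u} Set.univ d := by
  funext M _
  refine propext ⟨?_, ?_⟩
  · rintro ⟨i, C, hC, h⟩
    exact ⟨i, fun k => C ⟨k, trivial⟩, hC, isSubscaled_iff.1 h⟩
  · rintro ⟨i, C, hC, h⟩
    exact ⟨i, _, hC, isSubscaled_iff.2 h⟩

theorem superScaledLE_eq (d : ℕ) : superScaledLE.{u} d = HasSuperLaws.{u} Set.univ d := by
  funext M _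
  refine propext ⟨?_, ?_⟩
  · rintro ⟨i, C, hC, h⟩
    exact ⟨i, fun k => C ⟨k, trivial⟩, hC, isSuperScaled_iff.1 h⟩
  · rintro ⟨i, C, hC, h⟩
    exact ⟨i, _, hC, isSuperScaled_iff.2 h⟩

theorem Laws.scDim_top_eq_iff (h : Laws d C) [(lang Set.univ).Structure L]
    (hC : Interprets L fun i : ↥(Set.univ : Set ℕ) => C i) :
    scDim (fun i : ↥(Set.univ : Set ℕ) => C i) (⊤ : L) = (d : WithBot ℕ∞) ↔ L ⊨ topSentence Set.univ d := by
  rw [realize_topSentence_iff (Set.subset_univ _) hC h,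
    ← scDim_lt_iff isLowerSet_univ (Set.mem_univ d) h.comp_le h.sup_comp, not_lt]
  exact ⟨fun e => e.ge, fun e => le_antisymm
    ((scDim_le_iff isLowerSet_univ (Set.mem_univ d) h.comp_le h.sup_comp).2 (h.sup_comp ⊤)) e⟩

theorem subscaledEQ_eq (d : ℕ) :
    subscaledEQ.{u} d = StructClass.satisfying (HasLaws.{u} Set.univ d) (topSentence Set.univ d) := by
  funext M _
  refine propext ⟨?_, ?_⟩
  · rintro ⟨i, C, hC, h, ht⟩
    have hl : Laws d fun k => C ⟨k, trivial⟩ := isSubscaled_iff.1 ⟨h, ht.le⟩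
    exact ⟨⟨i, fun k => C ⟨k, trivial⟩, hC, hl⟩, (hl.scDim_top_eq_iff hC).1 ht⟩
  · rintro ⟨⟨i, C, hC, h⟩, ht⟩
    exact ⟨i, _, hC, (isSubscaled_iff.2 h).1, (h.scDim_top_eq_iff hC).2 ht⟩

theorem superScaledEQ_eq (d : ℕ) :
    superScaledEQ.{u} d = StructClass.satisfying (HasSuperLaws.{u} Set.univ d) (topSentence Set.univ d) := by
  funext M _
  refine propext ⟨?_, ?_⟩
  · rintro ⟨i, C, hC, h, ht⟩
    have hl : Laws d (fun k => C ⟨k, trivial⟩) ∧ SuperLaws (fun k => C ⟨k, trivial⟩) :=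
      isSuperScaled_iff.1 ⟨h, ht.le⟩
    exact ⟨⟨i, fun k => C ⟨k, trivial⟩, hC, hl⟩, (hl.1.scDim_top_eq_iff hC).1 ht⟩
  · rintro ⟨⟨i, C, hC, h⟩, ht⟩
    exact ⟨i, _, hC, (isSuperScaled_iff.2 h).1, (h.1.scDim_top_eq_iff hC).2 ht⟩

end Link

end ScaledLattice

theorem mainTheorem1 (d : ℕ) :
    (ScaledLattice.IsElementaryClass.{u} (ScaledLattice.dSubscaled.{u} d) ∧
      ScaledLattice.IsElementaryClass.{u} (ScaledLattice.superDScaled.{u} d) ∧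
      ScaledLattice.IsModelCompletion.{u}
        (ScaledLattice.theoryOf (ScaledLattice.superDScaled.{u} d))
        (ScaledLattice.theoryOf (ScaledLattice.dSubscaled.{u} d))) ∧
    (ScaledLattice.IsElementaryClass.{u} (ScaledLattice.subscaledLE.{u} d) ∧
      ScaledLattice.IsElementaryClass.{u} (ScaledLattice.superScaledLE.{u} d) ∧
      ScaledLattice.IsModelCompletion.{u}
        (ScaledLattice.theoryOf (ScaledLattice.superScaledLE.{u} d))
        (ScaledLattice.theoryOf (ScaledLattice.subscaledLE.{u} d))) ∧
    (ScaledLattice.IsElementaryClass.{u} (ScaledLattice.subscaledEQ.{u} d) ∧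
      ScaledLattice.IsElementaryClass.{u} (ScaledLattice.superScaledEQ.{u} d) ∧
      ScaledLattice.IsModelCompletion.{u}
        (ScaledLattice.theoryOf (ScaledLattice.superScaledEQ.{u} d))
        (ScaledLattice.theoryOf (ScaledLattice.subscaledEQ.{u} d))) := by
  simp only [ScaledLattice.dSubscaled_eq, ScaledLattice.superDScaled_eq, ScaledLattice.subscaledLE_eq,
    ScaledLattice.superScaledLE_eq, ScaledLattice.subscaledEQ_eq, ScaledLattice.superScaledEQ_eq]
  exact ⟨ScaledLattice.main_hasLaws subset_rfl, ScaledLattice.main_hasLaws (Set.subset_univ _),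
    ScaledLattice.main_hasLaws_top (Set.subset_univ _)⟩
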